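/- Let $M$ be a connected oriented smooth $5$-manifold. Write $S=\Lambda^{ev}T^*$ and $S^*=\Lambda^{od}T^*$, let $v=X+\xi\in T\oplus T^*$ act on forms by $v\cdot\varphi=i_X\varphi+\xi\wedge\varphi$, and put $(v,v)=i_X\xi$. Let $\langle\psi,\varphi\rangle=\psi_1\wedge\varphi_4-\psi_3\wedge\varphi_2+\psi_5\wedge\varphi_0\in\Lambda^5T^*$ for $\psi$ odd and $\varphi$ even. Define $Q(\varphi)\in(T\oplus T^*)\otimes\Lambda^5T^*$ by $(Q(\varphi),v)=\langle v\cdot\varphi,\varphi\rangle$ and, for $\rho=(\rho_1,\rho_2)\in S\otimes\mathbf R^2$, put $f(\rho)=(Q(\rho_1),Q(\rho_2))\in(\Lambda^5T^*)^2$. The invariant volume form of $\rho$ is $\phi(\rho)=|f(\rho)|^{1/2}$ (the positive root for the orientation), and $\hat\rho=(\hat\rho_1,\hat\rho_2)$ is the pair of odd forms given by the derivative of $\phi$ at $\rho$: $D\phi(\dot\rho)=\langle\hat\rho_1,\dot\rho_1\rangle+\langle\hat\rho_2,\dot\rho_2\rangle$. A *solution* is a smooth $\mathbf R^2$-valued even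 form $\rho$ on $M$ which at each point lies in an open orbit of $Spin(5,5)\times GL(2,\mathbf R)$ on $S\otimes\mathbf R^2$ and satisfies $d\rho=0=d\hat\rho$. (i) Let $\rho$ be a solution whose degree-zero component is not identically zero. Then $f(\rho)$ is nowhere zero and has a constant sign $\varepsilon\in\{1,-1\}$, and there are $A\in SL(2,\mathbf R)$, a closed $2$-form $B$, a closed $2$-form $\omega$, a positive volume form $\phi$ and vector fields $Y_1,Y_2$ (all smooth) such that $[Y_1,Y_2]=0$, $\mathcal L_{Y_i}\omega=0=\mathcal L_{Y_i}\phi$ for $i=1,2$, $$\omega(Y_1,Y_2)=-\varepsilon/8,$$ $\phi(\rho)=\phi$, and $$e^B(A\rho)=(\omega+i_{Y_1}\phi,\ 1+i_{Y_2}\phi).$$ In particular $\omega(Y_1,Y_2)=-1/8$ when $\rho$ lies in the orbit where $f>0$, so that $\phi(\rho)=f(\rho)^{1/2}$. (ii) Conversely, let $\varepsilon\in\{1,-1\}$, let $\omega,\phi,Y_1,Y_2$ be as in (i), with $\phi$ positive and $\omega(Y_1,Y_2)=-\varepsilon/8$, let $A\in SL(2,\mathbf R)$ and let $B$ be a closed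 $2$-form. If $e^B(A\rho)=(\omega+i_{Y_1}\phi,\ 1+i_{Y_2}\phi)$ (for example $A=1$, $B=0$), then $\rho$ is a solution with nowhere vanishing degree-zero component, $f(\rho)$ has sign $\varepsilon$, and its invariant volume form is $\phi$. -/

import Mathlib

open scoped Manifold ContDiff

noncomputable section

namespace GenGeom

/-! ### Exterior algebra of a five-dimensional vector space

All pointwise constructions take place on the model space `E5`, which is by definition the
tangent space `TangentSpace (𝓡 5) x` at each point `x` of a `5`-manifold. -/

/-- The model vector space `ℝ⁵`. -/
abbrev E5 : Type := EuclideanSpace ℝ (Fin 5)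

/-- Alternating `k`-forms on `ℝ⁵`. -/
abbrev Alt (k : ℕ) : Type := E5 [⋀^Fin k]→L[ℝ] ℝ

/-- The (not yet antisymmetrised) tensor product of two alternating forms. -/
def tensor {p q : ℕ} (α : Alt p) (β : Alt q) :
    ContinuousMultilinearMap ℝ (fun _ : Fin (p + q) => E5) ℝ where
  toMultilinearMap :=
    (LinearMap.mul' ℝ ℝ).compMultilinearMap
      ((MultilinearMap.domCoprod α.toAlternatingMap.toMultilinearMap
        β.toAlternatingMap.toMultilinearMap).domDomCongr finSumFinEquiv)
  cont := by
    change Continuous fun v : Fin (p + q) → E5 =>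
      α (fun i => v (Fin.castAdd q i)) * β (fun j => v (Fin.natAdd p j))
    exact (α.cont.comp (by fun_prop)).mul (β.cont.comp (by fun_prop))

@[simp] theorem tensor_apply {p q : ℕ} (α : Alt p) (β : Alt q) (v : Fin (p + q) → E5) :
    tensor α β v = α (fun i => v (Fin.castAdd q i)) * β (fun j => v (Fin.natAdd p j)) := rfl

/-- The wedge product
`(α ∧ β)(v₁,…,v_{p+q}) = (1/(p! q!)) ∑_σ sign σ · α(v_{σ1},…,v_{σp}) β(v_{σ(p+1)},…,v_{σ(p+q)})`. -/
def wedge {p q : ℕ} (α : Alt p) (β : Alt q) : Alt (p + q) :=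
  ((p.factorial : ℝ) * (q.factorial : ℝ))⁻¹ •
    ContinuousMultilinearMap.alternatization (tensor α β)

theorem wedge_apply {p q : ℕ} (α : Alt p) (β : Alt q) (v : Fin (p + q) → E5) :
    wedge α β v = ((p.factorial : ℝ) * (q.factorial : ℝ))⁻¹ *
      ∑ σ : Equiv.Perm (Fin (p + q)), (Equiv.Perm.sign σ : ℤ) •
        (α (fun i => v (σ (Fin.castAdd q i))) * β (fun j => v (σ (Fin.natAdd p j)))) := by
  rw [wedge, ContinuousAlternatingMap.smul_apply,
    ContinuousMultilinearMap.alternatization_apply_apply]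
  rfl

/-- The interior product `i_X α = α(X, ·, …, ·)`. -/
def interior {k : ℕ} (X : E5) (α : Alt (k + 1)) : Alt k := α.curryLeft X

/-- A real number as a form of degree zero. -/
def const (c : ℝ) : Alt 0 := ContinuousAlternatingMap.constOfIsEmpty ℝ E5 (Fin 0) c

/-- Even forms `φ₀ + φ₂ + φ₄`: the half-spin representation `S = Λ^{ev} T*`. -/
abbrev Ev : Type := Alt 0 × Alt 2 × Alt 4

/-- Odd forms `ψ₁ + ψ₃ + ψ₅`: the dual half-spin representation `S* = Λ^{od} T*`. -/
abbrev Od : Type := Alt 1 × Alt 3 × Alt 5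

/-- Elements `X + ξ` of `T ⊕ T*`. -/
abbrev Gen : Type := E5 × Alt 1

/-- The pairing `i_X ξ` of a vector and a covector. -/
def pair (X : E5) (ξ : Alt 1) : ℝ := ξ ![X]

/-- The inner product on `T ⊕ T*` polarising `(X + ξ, X + ξ) = i_X ξ`. -/
def inner (u v : Gen) : ℝ := (pair u.1 v.2 + pair v.1 u.2) / 2

/-- Clifford multiplication `(X + ξ) · φ = i_X φ + ξ ∧ φ` of an even form. -/
def cliffEv (u : Gen) (φ : Ev) : Od :=
  (interior u.1 φ.2.1 + wedge u.2 φ.1,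
   interior u.1 φ.2.2 + wedge u.2 φ.2.1,
   wedge u.2 φ.2.2)

/-- Clifford multiplication `(X + ξ) · ψ = i_X ψ + ξ ∧ ψ` of an odd form. -/
def cliffOd (u : Gen) (ψ : Od) : Ev :=
  (interior u.1 ψ.1,
   interior u.1 ψ.2.1 + wedge u.2 ψ.1,
   interior u.1 ψ.2.2 + wedge u.2 ψ.2.1)

/-- The Mukai pairing `⟨ψ, φ⟩ = [ψ ∧ σ(φ)]₅` of an odd form with an even form, with values in
`Λ⁵ T*`, where `σ` is multiplication by `(-1)^m` in degrees `2m` and `2m+1`. -/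
def mukai (ψ : Od) (φ : Ev) : Alt 5 :=
  wedge ψ.1 φ.2.2 - wedge ψ.2.1 φ.2.1 + wedge ψ.2.2 φ.1

/-- The standard basis of the model space. -/
def stdE (i : Fin 5) : E5 := EuclideanSpace.single i 1

/-- The dual standard basis of the model space. -/
def stdDual (i : Fin 5) : Alt 1 :=
  ContinuousAlternatingMap.ofSubsingleton ℝ E5 ℝ (0 : Fin 1) (EuclideanSpace.proj i)

/-- The coefficient `c` in `α = c μ`, for `α ∈ Λ⁵ T*` and `μ ∈ Λ⁵ T*` non-zero. -/
def coeff (μ α : Alt 5) : ℝ := α stdE / μ stdE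

/-- The quadratic map `Q : S → (T ⊕ T*) ⊗ Λ⁵ T*`, `(Q(φ), v) = ⟨v · φ, φ⟩`, written as
`Q(φ) = quadMap μ φ ⊗ μ` by means of a non-zero `μ ∈ Λ⁵ T*`; see `inner_quadMap`. -/
def quadMap (μ : Alt 5) (φ : Ev) : Gen :=
  (∑ i, (2 * coeff μ (mukai (cliffEv (0, stdDual i) φ) φ)) • stdE i,
   ∑ i, (2 * coeff μ (mukai (cliffEv (stdE i, 0) φ) φ)) • stdDual i)

/-- The quartic `f(ρ) = (Q(ρ₁), Q(ρ₂)) ∈ (Λ⁵ T*)²`, written as `f(ρ) = quartic μ ρ · μ²`. -/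
def quartic (μ : Alt 5) (ρ : Fin 2 → Ev) : ℝ := inner (quadMap μ (ρ 0)) (quadMap μ (ρ 1))

/-- The invariant volume form `φ(ρ) = |f(ρ)|^{1/2} ∈ Λ⁵ T*`, the square root being taken positive
for the orientation given by `μ`.  It depends on `μ` only through this orientation. -/
def vol (μ : Alt 5) (ρ : Fin 2 → Ev) : Alt 5 := Real.sqrt |quartic μ ρ| • μ

/-- `ρ' = (ρ'₁, ρ'₂)` is the form `ρ̂` attached to `ρ`: the derivative of `ρ ↦ φ(ρ)` is
`ρ̇ ↦ ⟨ρ̂, ρ̇⟩`. -/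
def IsHat (μ : Alt 5) (ρ : Fin 2 → Ev) (ρ' : Fin 2 → Od) : Prop :=
  ∃ L : (Fin 2 → Ev) →L[ℝ] Alt 5, HasFDerivAt (vol μ) L ρ ∧
    ∀ ρdot : Fin 2 → Ev, L ρdot = ∑ i, mukai (ρ' i) (ρdot i)

/-- The action of `Spin(5,5)` on `S`: the group of operators generated by the products of two
vectors of `T ⊕ T*` of square `±1`. -/
def spinOn : Submonoid (Function.End Ev) :=
  Submonoid.closure {g | ∃ u v : Gen, |inner u u| = 1 ∧ |inner v v| = 1 ∧
    g = fun φ => cliffOd u (cliffEv v φ)}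

/-- The standard action of `2 × 2` matrices on `S ⊗ ℝ²`. -/
def matAct (A : Matrix (Fin 2) (Fin 2) ℝ) (ρ : Fin 2 → Ev) : Fin 2 → Ev :=
  fun i => ∑ j, A i j • ρ j

/-- The orbit of `ρ ∈ S ⊗ ℝ²` under `Spin(5,5) × GL(2,ℝ)`. -/
def orbit (ρ : Fin 2 → Ev) : Set (Fin 2 → Ev) :=
  {τ | ∃ g ∈ spinOn, ∃ A : Matrix.GeneralLinearGroup (Fin 2) ℝ,
    τ = matAct (A : Matrix (Fin 2) (Fin 2) ℝ) (fun i => g (ρ i))}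

/-- `ρ` lies in an open orbit of `Spin(5,5) × GL(2,ℝ)` on `S ⊗ ℝ²`. -/
def InOpenOrbit (ρ : Fin 2 → Ev) : Prop := IsOpen (orbit ρ)

/-- The action `φ ↦ e^B φ` of a `2`-form on even forms. -/
def expB (B : Alt 2) (φ : Ev) : Ev :=
  (φ.1, φ.2.1 + wedge B φ.1,
   φ.2.2 + wedge B φ.2.1 + (2⁻¹ : ℝ) • wedge B (wedge B φ.1))

/-- The pair `ρ₁ = Ω + i_{Y₁} φ`, `ρ₂ = 1 + i_{Y₂} φ`. -/
def normalForm (Ω : Alt 2) (φ : Alt 5) (Y₁ Y₂ : E5) : Fin 2 → Ev :=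
  ![(0, Ω, interior Y₁ φ), (const 1, 0, interior Y₂ φ)]

/-! #### The defining property of `quadMap` -/

theorem pair_add_left (X Y : E5) (ξ : Alt 1) : pair (X + Y) ξ = pair X ξ + pair Y ξ := by
  have h := ξ.map_update_add (![0] : Fin 1 → E5) 0 X Y
  have e : ∀ Z : E5, Function.update (![0] : Fin 1 → E5) 0 Z = ![Z] := by
    intro Z; ext i; fin_cases i; simp
  simpa only [e, pair] using h

theorem pair_smul_left (c : ℝ) (X : E5) (ξ : Alt 1) : pair (c • X) ξ = c * pair X ξ := by
  have h := ξ.map_update_smul (![0] : Fin 1 → E5) 0 c X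
  have e : ∀ Z : E5, Function.update (![0] : Fin 1 → E5) 0 Z = ![Z] := by
    intro Z; ext i; fin_cases i; simp
  simpa only [e, pair, smul_eq_mul] using h

theorem wedge_add_left {p q : ℕ} (α α' : Alt p) (β : Alt q) :
    wedge (α + α') β = wedge α β + wedge α' β := by
  ext v
  simp only [wedge_apply, ContinuousAlternatingMap.add_apply, add_mul, smul_add,
    Finset.sum_add_distrib, mul_add]

theorem wedge_smul_left {p q : ℕ} (c : ℝ) (α : Alt p) (β : Alt q) :
    wedge (c • α) β = c • wedge α β := by
  ext v
  simp only [wedge_apply, ContinuousAlternatingMap.smul_apply, smul_eq_mul, Finset.mul_sum]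
  refine Finset.sum_congr rfl fun σ _ => ?_
  simp only [zsmul_eq_mul]
  ring

/-- `v ↦ ⟨v · φ, φ⟩` as a linear functional. -/
def quadForm (μ : Alt 5) (φ : Ev) : Gen →ₗ[ℝ] ℝ where
  toFun v := coeff μ (mukai (cliffEv v φ) φ)
  map_add' u v := by
    simp only [coeff, mukai, cliffEv, interior, Prod.fst_add, Prod.snd_add, map_add,
      wedge_add_left, ContinuousAlternatingMap.add_apply, ContinuousAlternatingMap.sub_apply]
    ring
  map_smul' c v := by
    simp only [coeff, mukai, cliffEv, interior, Prod.smul_fst, Prod.smul_snd, map_smul,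
      wedge_add_left, wedge_smul_left, ContinuousAlternatingMap.add_apply,
      ContinuousAlternatingMap.sub_apply, ContinuousAlternatingMap.smul_apply, smul_eq_mul,
      RingHom.id_apply]
    ring

theorem pair_stdDual (X : E5) (i : Fin 5) : pair X (stdDual i) = X i := rfl

theorem sum_stdE (X : E5) : X = ∑ i, X i • stdE i := by
  ext j
  simp [stdE, Finset.sum_apply, Pi.single_apply]

theorem sum_stdDual (ξ : Alt 1) : ξ = ∑ i, pair (stdE i) ξ • stdDual i := by
  ext v
  have hv : v = ![v 0] := by ext i; fin_cases i; rfl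
  have key : ∀ X : E5, pair X ξ = ∑ i, X i * pair (stdE i) ξ := by
    intro X
    let l : E5 →ₗ[ℝ] ℝ :=
      { toFun := fun X => pair X ξ
        map_add' := fun X Y => pair_add_left X Y ξ
        map_smul' := fun c X => pair_smul_left c X ξ }
    change l X = ∑ i, X i * l (stdE i)
    conv_lhs => rw [sum_stdE X]
    simp
  rw [hv]
  change pair (v 0) ξ = _
  rw [key, ContinuousAlternatingMap.sum_apply]
  refine Finset.sum_congr rfl fun i _ => ?_
  rw [ContinuousAlternatingMap.smul_apply, smul_eq_mul, mul_comm]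
  rfl

theorem inner_quadMap (μ : Alt 5) (φ : Ev) (v : Gen) :
    inner (quadMap μ φ) v = coeff μ (mukai (cliffEv v φ) φ) := by
  change _ = quadForm μ φ v
  have hv : v = ∑ i, v.1 i • ((stdE i, 0) : Gen)
      + ∑ i, pair (stdE i) v.2 • ((0, stdDual i) : Gen) := by
    ext1
    · simpa [Prod.fst_sum] using sum_stdE v.1
    · simpa [Prod.snd_sum] using sum_stdDual v.2
  have h1 : pair (quadMap μ φ).1 v.2
      = ∑ i, 2 * quadForm μ φ (0, stdDual i) * pair (stdE i) v.2 := by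
    let l : E5 →ₗ[ℝ] ℝ :=
      { toFun := fun X => pair X v.2
        map_add' := fun X Y => pair_add_left X Y v.2
        map_smul' := fun c X => pair_smul_left c X v.2 }
    change l (∑ i, (2 * quadForm μ φ (0, stdDual i)) • stdE i) = _
    simp only [map_sum, map_smul, smul_eq_mul]
    rfl
  have h2 : pair v.1 (quadMap μ φ).2
      = ∑ i, 2 * quadForm μ φ (stdE i, 0) * v.1 i := by
    change (∑ i, (2 * quadForm μ φ (stdE i, 0)) • stdDual i) ![v.1] = _
    rw [ContinuousAlternatingMap.sum_apply]
    rfl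
  conv_rhs => rw [hv]
  rw [inner, h1, h2]
  simp only [map_add, map_sum, map_smul, smul_eq_mul]
  rw [← Finset.sum_add_distrib, ← Finset.sum_add_distrib, Finset.sum_div]
  refine Finset.sum_congr rfl fun i _ => ?_
  ring

/-! ### Differential forms on a five-manifold -/

section Manifold

variable {M : Type*} [TopologicalSpace M] [ChartedSpace E5 M]

/-- A differential `k`-form: an alternating form on `TangentSpace (𝓡 5) x = E5` for each `x`. -/
abbrev Form (M : Type*) (k : ℕ) : Type _ := M → Alt k

/-- The representation of a `k`-form in the chart around `x₀`: its pullback under the inverse of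
the chart. -/
def inChart {k : ℕ} (α : Form M k) (x₀ : M) : E5 → Alt k := fun y =>
  (α ((extChartAt (𝓡 5) x₀).symm y)).compContinuousLinearMap
    (mfderiv 𝓘(ℝ, E5) (𝓡 5) (extChartAt (𝓡 5) x₀).symm y : E5 →L[ℝ] E5)

/-- Smoothness of a `k`-form: its representations in the charts are smooth. -/
def SmoothForm {k : ℕ} (α : Form M k) : Prop :=
  ∀ x₀ : M, ContDiffOn ℝ ∞ (inChart α x₀) (extChartAt (𝓡 5) x₀).target

/-- Pull a form at the image of `x` in the chart around `x` back to `x`. -/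
def fromChart {k : ℕ} (x : M) (α : Alt k) : Alt k :=
  α.compContinuousLinearMap
    (mfderiv (𝓡 5) 𝓘(ℝ, E5) (extChartAt (𝓡 5) x) x : E5 →L[ℝ] E5)

/-- The exterior derivative, computed at `x` in the chart around `x`. -/
def d {k : ℕ} (α : Form M k) : Form M (k + 1) := fun x =>
  fromChart x (extDeriv (inChart α x) (extChartAt (𝓡 5) x x))

/-- A vector field represented in the chart around `x₀`. -/
def fieldInChart (Y : (x : M) → TangentSpace (𝓡 5) x) (x₀ : M) : E5 → E5 :=
  VectorField.mpullback 𝓘(ℝ, E5) (𝓡 5) (extChartAt (𝓡 5) x₀).symm Y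

/-- The Lie derivative of a `k`-form along a vector field, computed at `x` in the chart around
`x`, where `(L_Y α)(v₁,…,v_k) = (D_Y α)(v₁,…,v_k) + ∑ᵢ α(v₁,…,DY(vᵢ),…,v_k)`. -/
def lieDeriv {k : ℕ} (Y : (x : M) → TangentSpace (𝓡 5) x) (α : Form M k) : Form M k := fun x =>
  let y := extChartAt (𝓡 5) x x
  fromChart x (fderiv ℝ (inChart α x) y (fieldInChart Y x y) +
    ContinuousAlternatingMap.fderivCompContinuousLinearMap (inChart α x y)
      (ContinuousLinearMap.id ℝ E5) (fderiv ℝ (fieldInChart Y x) y))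

/-- Smoothness of a vector field. -/
def SmoothField [IsManifold (𝓡 5) ∞ M] (Y : (x : M) → TangentSpace (𝓡 5) x) : Prop :=
  ContMDiff (𝓡 5) (𝓡 5).tangent ∞ (fun x => (⟨x, Y x⟩ : TangentBundle (𝓡 5) M))

/-- The form is smooth and closed. -/
def SmoothClosed {k : ℕ} (α : Form M k) : Prop := SmoothForm α ∧ ∀ x, d α x = 0

/-- A mixed even form all of whose components are smooth and closed. -/
def SmoothClosedEv (φ : M → Ev) : Prop :=
  SmoothClosed (fun x => (φ x).1) ∧ SmoothClosed (fun x => (φ x).2.1) ∧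
    SmoothClosed (fun x => (φ x).2.2)

/-- A mixed odd form all of whose components are smooth and closed. -/
def SmoothClosedOd (ψ : M → Od) : Prop :=
  SmoothClosed (fun x => (ψ x).1) ∧ SmoothClosed (fun x => (ψ x).2.1) ∧
    SmoothClosed (fun x => (ψ x).2.2)

/-- A volume form: a smooth nowhere vanishing `5`-form. -/
def IsVolumeForm (μ : Form M 5) : Prop := SmoothForm μ ∧ ∀ x, μ x ≠ 0

/-- A solution of `dρ = 0 = dρ̂`: a smooth `ℝ²`-valued even form `ρ`, lying in an open orbit of
`Spin(5,5) × GL(2,ℝ)` at each point, such that `ρ` and `ρ̂` are closed.  The manifold is oriented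
by `μ`. -/
def IsSolution (μ : Form M 5) (ρ : M → Fin 2 → Ev) : Prop :=
  (∀ x, InOpenOrbit (ρ x)) ∧ (∀ i, SmoothClosedEv fun x => ρ x i) ∧
    ∃ ρ' : M → Fin 2 → Od, (∀ x, IsHat (μ x) (ρ x) (ρ' x)) ∧
      ∀ i, SmoothClosedOd fun x => ρ' x i

/-- A closed `2`-form `Ω`, a positive volume form `φ` and two commuting vector fields preserving
both, with `Ω(Y₁, Y₂) = -ε/8`. -/
structure IsReducedData [IsManifold (𝓡 5) ∞ M] (μ : Form M 5) (ε : ℝ) (Ω : Form M 2)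
    (φ : Form M 5) (Y₁ Y₂ : (x : M) → TangentSpace (𝓡 5) x) : Prop where
  closed : SmoothClosed Ω
  volume : IsVolumeForm φ
  positive : ∀ x, 0 < coeff (μ x) (φ x)
  smooth₁ : SmoothField Y₁
  smooth₂ : SmoothField Y₂
  commute : ∀ x, VectorField.mlieBracket (𝓡 5) Y₁ Y₂ x = 0
  preserve_form₁ : ∀ x, lieDeriv Y₁ Ω x = 0
  preserve_form₂ : ∀ x, lieDeriv Y₂ Ω x = 0
  preserve_vol₁ : ∀ x, lieDeriv Y₁ φ x = 0
  preserve_vol₂ : ∀ x, lieDeriv Y₂ φ x = 0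
  pairing : ∀ x, Ω x ![Y₁ x, Y₂ x] = -ε / 8

/-- `ρ` is carried to the pair `(Ω + i_{Y₁} φ, 1 + i_{Y₂} φ)` by `A ∈ SL(2,ℝ)` followed by the
`B`-field `B`. -/
def TransformsTo (A : Matrix.SpecialLinearGroup (Fin 2) ℝ) (B : Form M 2) (ρ : M → Fin 2 → Ev)
    (Ω : Form M 2) (φ : Form M 5) (Y₁ Y₂ : (x : M) → TangentSpace (𝓡 5) x) : Prop :=
  ∀ x i, expB (B x) (matAct (A : Matrix (Fin 2) (Fin 2) ℝ) (ρ x) i) =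
    normalForm (Ω x) (φ x) (Y₁ x) (Y₂ x) i

end Manifold

end GenGeom

end

/-!
The argument has a pointwise part, about the action of `Spin(5,5) × GL(2, ℝ)` on pairs of even
forms on `ℝ⁵`, and a differential part.

*Orbits.* Clifford multiplication is symmetric for the Mukai pairing, so a vector `u` changes the
quadratic map `Q` by a scaled reflection (`quadMap_cliffOd`, `quadMapOd_cliffEv`). Hence the quartic
`f` is invariant under the spin group (`quartic_spin`), and since all the vectors `Q(φ)` are null
(`inner_quadMap_self`), it is multiplied by `(det A)²` under `A ∈ GL(2, ℝ)` (`quartic_matAct`). A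
pair whose degree-zero part is not zero is carried by a matrix of prescribed determinant and a
`B`-field to a normal form `(Ω + i_{Y₁} φ, 1 + i_{Y₂} φ)` (`exists_matrix_normalizing`,
`expB_eq_normalForm`), on which `f = -8 Ω(Y₁, Y₂)` in units of `φ²` (`quartic_normalForm`). The
group contains, up to scale, the `B`-fields, the bivectors and `GL(5, ℝ)`, which suffices to bring
a normal form with `f ≠ 0` to a standard one that depends only on the sign of `f`
(`standard_mem_orbit`). So the pairs with non-zero degree-zero part and `f` of a given sign lie in
a single orbit, which is therefore open (`inOpenOrbit_of_sign`); conversely `f`, a semi-invariant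
polynomial, vanishes at no point of an open orbit (`quartic_ne_zero_of_inOpenOrbit`).

*The form `ρ̂`.* The volume is invariant under `e^B A` with `A ∈ SL(2, ℝ)`, so `ρ̂` is transported by
the transpose of that map (`IsHat.of_transform`); it is unique because the Mukai pairing is
non-degenerate (`IsHat.unique`). On a normal form with `Ω(Y₁, Y₂) = -ε / 8` the derivative of `f`
gives (`isHat_normalForm`)

  `ρ̂₁ = 4ε (i_{Y₂} Ω + i_{Y₂} i_{Y₁} φ)`,
  `ρ̂₂ = -4ε i_{Y₁} Ω + 4ε i_{Y₂} Ω ∧ Ω + φ / 2`.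

*Closedness.* The degree-zero part of a solution is closed, hence constant on the connected
manifold (`SmoothClosed.exists_eq_const`). So the matrix `A` above can be taken constant, and the
`B`-field is closed, being minus a component of `A ρ`; both preserve closedness of `ρ` and of `ρ̂`.
It remains to see what it means for a normal form and its `ρ̂` to be closed. Closedness of `i_Y Ω`
and `i_Y φ` is invariance of the closed forms `Ω` and `φ` under `Y`, by Cartan's formula
(`lieDeriv_eq_zero_iff`). Given this for `Y₁` and `Y₂`, closedness of `i_{Y₁} i_{Y₂} φ` is
`[Y₁, Y₂] = 0`, by the formula for `i_{[Y₁, Y₂]}` (`mlieBracket_eq_zero_iff_closed`). The remaining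
component `i_{Y₂} Ω ∧ Ω` is then closed by the Leibniz rule. These equivalences, read in the two
directions (`isReducedData_of_closed`, `IsReducedData.closed_normalFormHat`), give the two halves
of the theorem.
-/

noncomputable section

namespace GenGeom

/-! ### Wedge products in low degrees -/

/-- The signed sum of `G` over all permutations of its arguments. -/
def altSum {n : ℕ} (G : (Fin n → E5) → ℝ) (v : Fin n → E5) : ℝ :=
  ∑ σ : Equiv.Perm (Fin n), (Equiv.Perm.sign σ : ℤ) • G (fun i => v (σ i))

/-- Expansion of an alternating sum along its first argument. The transposition of `0` and `i`
that brings `v i` to the front leaves the remaining arguments in the order `v ∘ swap 0 i`. -/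
theorem altSum_succ {n : ℕ} (G : (Fin (n + 1) → E5) → ℝ) (v : Fin (n + 1) → E5) :
    altSum G v = ∑ i : Fin (n + 1), (if i = 0 then (1 : ℝ) else -1) *
        altSum (fun w => G (Matrix.vecCons (v i) w)) (fun j => v (Equiv.swap 0 i j.succ)) := by
  unfold altSum
  rw [← Equiv.Perm.decomposeFin.symm.sum_comp, Fintype.sum_prod_type]
  refine Finset.sum_congr rfl fun i _ => ?_
  rw [Finset.mul_sum]
  refine Finset.sum_congr rfl fun σ _ => ?_
  rw [Equiv.Perm.decomposeFin.symm_sign]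
  have : (fun k => v (Equiv.Perm.decomposeFin.symm (i, σ) k)) =
      Matrix.vecCons (v i) (fun j => v (Equiv.swap 0 i (σ j).succ)) := by
    funext k
    refine Fin.cases ?_ (fun j => ?_) k <;> simp
  rw [this]
  split_ifs <;> simp

theorem altSum_one (G : (Fin 1 → E5) → ℝ) (v : Fin 1 → E5) : altSum G v = G ![v 0] := by
  simp only [altSum, Finset.univ_unique, Finset.sum_singleton]
  have : (fun i => v ((default : Equiv.Perm (Fin 1)) i)) = ![v 0] := by
    funext i; fin_cases i; rfl
  rw [this]; simp

theorem altSum_two (G : (Fin 2 → E5) → ℝ) (v : Fin 2 → E5) :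
    altSum G v = G ![v 0, v 1] - G ![v 1, v 0] := by
  rw [altSum_succ, Fin.sum_univ_two]
  simp only [altSum_one]
  simp [sub_eq_add_neg]

theorem altSum_three (G : (Fin 3 → E5) → ℝ) (v : Fin 3 → E5) :
    altSum G v = G ![v 0, v 1, v 2] - G ![v 0, v 2, v 1] - G ![v 1, v 0, v 2] + G ![v 1, v 2, v 0]
      - G ![v 2, v 1, v 0] + G ![v 2, v 0, v 1] := by
  rw [altSum_succ, Fin.sum_univ_three]
  simp only [altSum_two]
  simp [Equiv.swap_apply_def]
  ring

theorem altSum_four (G : (Fin 4 → E5) → ℝ) (v : Fin 4 → E5) :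
    altSum G v = altSum (fun w => G (Matrix.vecCons (v 0) w)) ![v 1, v 2, v 3]
      - altSum (fun w => G (Matrix.vecCons (v 1) w)) ![v 0, v 2, v 3]
      - altSum (fun w => G (Matrix.vecCons (v 2) w)) ![v 1, v 0, v 3]
      - altSum (fun w => G (Matrix.vecCons (v 3) w)) ![v 1, v 2, v 0] := by
  rw [altSum_succ, Fin.sum_univ_four]
  simp only [altSum_three]
  simp [Equiv.swap_apply_def]
  ring

theorem altSum_five (G : (Fin 5 → E5) → ℝ) (v : Fin 5 → E5) :
    altSum G v = altSum (fun w => G (Matrix.vecCons (v 0) w)) ![v 1, v 2, v 3, v 4]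
      - altSum (fun w => G (Matrix.vecCons (v 1) w)) ![v 0, v 2, v 3, v 4]
      - altSum (fun w => G (Matrix.vecCons (v 2) w)) ![v 1, v 0, v 3, v 4]
      - altSum (fun w => G (Matrix.vecCons (v 3) w)) ![v 1, v 2, v 0, v 4]
      - altSum (fun w => G (Matrix.vecCons (v 4) w)) ![v 1, v 2, v 3, v 0] := by
  have e : ∀ i : Fin 5, (fun j : Fin 4 => v (Equiv.swap 0 i j.succ)) =
    ![v (Equiv.swap 0 i 1), v (Equiv.swap 0 i 2), v (Equiv.swap 0 i 3), v (Equiv.swap 0 i 4)] := by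
    intro i; funext j; fin_cases j <;> rfl
  rw [altSum_succ, Fin.sum_univ_five]
  simp only [e]
  simp [Equiv.swap_apply_def]
  ring

theorem alt_swap {k : ℕ} (α : Alt k) (v w : Fin k → E5) (i j : Fin k) (hij : i ≠ j)
    (h : w = v ∘ Equiv.swap i j) : α w = -α v := by
  subst h
  exact α.toAlternatingMap.map_swap v hij

theorem alt2_swap (α : Alt 2) (a b : E5) : α ![a, b] = -α ![b, a] :=
  alt_swap α _ _ 0 1 (by decide) (by funext i; fin_cases i <;> rfl)
theorem alt3_swap₀ (α : Alt 3) (a b c : E5) : α ![a, b, c] = -α ![b, a, c] :=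
  alt_swap α _ _ 0 1 (by decide) (by funext i; fin_cases i <;> rfl)
theorem alt3_swap₁ (α : Alt 3) (a b c : E5) : α ![a, b, c] = -α ![a, c, b] :=
  alt_swap α _ _ 1 2 (by decide) (by funext i; fin_cases i <;> rfl)
theorem alt4_swap₀ (α : Alt 4) (a b c d : E5) : α ![a, b, c, d] = -α ![b, a, c, d] :=
  alt_swap α _ _ 0 1 (by decide) (by funext i; fin_cases i <;> rfl)
theorem alt4_swap₁ (α : Alt 4) (a b c d : E5) : α ![a, b, c, d] = -α ![a, c, b, d] :=
  alt_swap α _ _ 1 2 (by decide) (by funext i; fin_cases i <;> rfl)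
theorem alt4_swap₂ (α : Alt 4) (a b c d : E5) : α ![a, b, c, d] = -α ![a, b, d, c] :=
  alt_swap α _ _ 2 3 (by decide) (by funext i; fin_cases i <;> rfl)

/-! In the following rewriting rules the hypothesis `j < i` only orients the transposition, so that
`simp` sorts the arguments of a form and terminates. -/

section sorting
variable {n : ℕ} (v : Fin n → E5) {i j : Fin n}

theorem alt2_sort (α : Alt 2) (_ : j < i) : α ![v i, v j] = -α ![v j, v i] := alt2_swap ..
theorem alt3_sort₀ (α : Alt 3) (_ : j < i) (a : E5) :
    α ![v i, v j, a] = -α ![v j, v i, a] := alt3_swap₀ ..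
theorem alt3_sort₁ (α : Alt 3) (_ : j < i) (a : E5) :
    α ![a, v i, v j] = -α ![a, v j, v i] := alt3_swap₁ ..
theorem alt4_sort₀ (α : Alt 4) (_ : j < i) (a b : E5) :
    α ![v i, v j, a, b] = -α ![v j, v i, a, b] := alt4_swap₀ ..
theorem alt4_sort₁ (α : Alt 4) (_ : j < i) (a b : E5) :
    α ![a, v i, v j, b] = -α ![a, v j, v i, b] := alt4_swap₁ ..
theorem alt4_sort₂ (α : Alt 4) (_ : j < i) (a b : E5) :
    α ![a, b, v i, v j] = -α ![a, b, v j, v i] := alt4_swap₂ ..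
end sorting

theorem wedge_eq_altSum {p q : ℕ} (α : Alt p) (β : Alt q) (v : Fin (p + q) → E5) :
    wedge α β v = ((p.factorial : ℝ) * (q.factorial : ℝ))⁻¹ *
      altSum (fun w => α (fun i => w (Fin.castAdd q i)) * β (fun j => w (Fin.natAdd p j))) v :=
  wedge_apply α β v

theorem wedge22_apply (α β : Alt 2) (v : Fin 4 → E5) :
    wedge α β v = α ![v 0, v 1] * β ![v 2, v 3] - α ![v 0, v 2] * β ![v 1, v 3]
      + α ![v 0, v 3] * β ![v 1, v 2] + α ![v 1, v 2] * β ![v 0, v 3]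
      - α ![v 1, v 3] * β ![v 0, v 2] + α ![v 2, v 3] * β ![v 0, v 1] := by
  let G : (Fin 4 → E5) → ℝ := fun w => α ![w 0, w 1] * β ![w 2, w 3]
  have h : (fun w : Fin (2 + 2) → E5 => α (fun i => w (Fin.castAdd 2 i)) *
      β (fun j => w (Fin.natAdd 2 j))) = G := by
    funext w
    have e1 : (fun i => w (Fin.castAdd 2 i)) = ![w 0, w 1] := by
      funext i; fin_cases i <;> rfl
    have e2 : (fun i => w (Fin.natAdd 2 i)) = ![w 2, w 3] := by
      funext i; fin_cases i <;> rfl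
    rw [e1, e2]
  rw [wedge_eq_altSum, h]
  change _ * altSum (n := 4) G v = _
  simp [altSum_four, altSum_three, G, alt2_sort]
  ring

theorem wedge32_apply (α : Alt 3) (β : Alt 2) (v : Fin 5 → E5) :
    wedge α β v =
      α ![v 0, v 1, v 2] * β ![v 3, v 4] - α ![v 0, v 1, v 3] * β ![v 2, v 4]
      + α ![v 0, v 1, v 4] * β ![v 2, v 3] + α ![v 0, v 2, v 3] * β ![v 1, v 4]
      - α ![v 0, v 2, v 4] * β ![v 1, v 3] + α ![v 0, v 3, v 4] * β ![v 1, v 2]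
      - α ![v 1, v 2, v 3] * β ![v 0, v 4] + α ![v 1, v 2, v 4] * β ![v 0, v 3]
      - α ![v 1, v 3, v 4] * β ![v 0, v 2] + α ![v 2, v 3, v 4] * β ![v 0, v 1] := by
  let G : (Fin 5 → E5) → ℝ := fun w => α ![w 0, w 1, w 2] * β ![w 3, w 4]
  have h : (fun w : Fin (3 + 2) → E5 => α (fun i => w (Fin.castAdd 2 i)) *
      β (fun j => w (Fin.natAdd 3 j))) = G := by
    funext w
    have e1 : (fun i => w (Fin.castAdd 2 i)) = ![w 0, w 1, w 2] := by
      funext i; fin_cases i <;> rfl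
    have e2 : (fun i => w (Fin.natAdd 3 i)) = ![w 3, w 4] := by
      funext i; fin_cases i <;> rfl
    rw [e1, e2]
  rw [wedge_eq_altSum, h]
  change _ * altSum (n := 5) G v = _
  simp [altSum_five, altSum_four, altSum_three, G, alt2_sort, alt3_sort₀, alt3_sort₁, Nat.factorial]
  ring

/-- The wedge product of a covector and a `k`-form, as an alternating sum of `k + 1` terms. -/
def wedgeOne {k : ℕ} (ξ : Alt 1) (φ : Alt k) : Alt (k + 1) :=
  ContinuousAlternatingMap.alternatizeUncurryFin
    (((ContinuousLinearMap.smulRight (1 : ℝ →L[ℝ] ℝ) φ)).comp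
      (LinearMap.toContinuousLinearMap (⟨⟨fun X => pair X ξ, fun X Y => pair_add_left X Y ξ⟩,
        fun c X => pair_smul_left c X ξ⟩ : E5 →ₗ[ℝ] ℝ)))

theorem wedgeOne_apply {k : ℕ} (ξ : Alt 1) (φ : Alt k) (v : Fin (k + 1) → E5) :
    wedgeOne ξ φ v = ∑ i : Fin (k + 1), (-1) ^ (i : ℕ) * (pair (v i) ξ * φ (i.removeNth v)) := by
  simp [wedgeOne, ContinuousAlternatingMap.alternatizeUncurryFin_apply]

/-- A form is alternating already, so that its alternating sum has `k!` equal terms. -/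
theorem altSum_smul_of_alternating {k : ℕ} (c : ℝ) (φ : Alt k) (v : Fin k → E5) :
    altSum (fun w => c * φ w) v = k.factorial * (c * φ v) := by
  have : ∀ σ : Equiv.Perm (Fin k), (Equiv.Perm.sign σ : ℤ) • (c * φ (fun i => v (σ i))) = c * φ v := by
    intro σ
    have := φ.toAlternatingMap.map_perm v σ
    change φ (fun i => v (σ i)) = Equiv.Perm.sign σ • φ v at this
    rw [this]
    rcases Int.units_eq_one_or (Equiv.Perm.sign σ) with h | h <;> simp [h]
  simp [altSum, this, Fintype.card_perm]

/-- Of the `(k + 1)!` terms of the wedge product of a covector and a `k`-form, those with the same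
vector in the covector coincide. -/
theorem wedge_one_left {k : ℕ} (ξ : Alt 1) (φ : Alt k) (v : Fin (1 + k) → E5) :
    wedge ξ φ v = wedgeOne ξ φ (fun i => v (Fin.cast (add_comm _ _) i)) := by
  let G : (Fin (k + 1) → E5) → ℝ := fun w => ξ ![w 0] * φ (fun i => w i.succ)
  have key : ∀ w : Fin (k + 1) → E5, altSum G w = k.factorial * wedgeOne ξ φ w := by
    intro w
    rw [altSum_succ, wedgeOne_apply, Finset.mul_sum]
    refine Finset.sum_congr rfl fun i _ => ?_
    simp only [G, Matrix.cons_val_zero, Matrix.cons_val_succ]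
    rw [altSum_smul_of_alternating]
    rcases Fin.eq_zero_or_eq_succ i with rfl | ⟨j, rfl⟩
    · simp [pair, Fin.tail_def]
    · obtain ⟨m, rfl⟩ : ∃ m, k = m + 1 := ⟨k - 1, by have := j.pos; omega⟩
      have e1 : (fun l : Fin (m + 1) => w (Equiv.swap 0 j.succ l.succ)) =
          j.insertNth (w 0) (j.removeNth (Fin.tail w)) := by
        funext l
        refine Fin.succAboveCases j ?_ (fun l => ?_) l
        · simp
        · rw [Fin.insertNth_apply_succAbove, Equiv.swap_apply_of_ne_of_ne (Fin.succ_ne_zero _)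
            (by simp [Fin.succ_inj])]
          rfl
      have e2 : j.succ.removeNth w = Matrix.vecCons (w 0) (j.removeNth (Fin.tail w)) := by
        funext l
        refine Fin.cases ?_ (fun l => ?_) l
        · simp [Fin.removeNth]
        · simp [Fin.removeNth, Fin.tail]
      rw [e1, e2, ← φ.neg_one_pow_smul_map_insertNth j]
      have h1 : ((-1 : ℝ) ^ (j : ℕ)) * (-1) ^ (j : ℕ) = 1 := by
        rw [← mul_pow]; simp
      simp [pair, pow_succ]
      left
      linear_combination -(ξ ![w j.succ] * φ (Function.update (Fin.tail w) j (w 0))) * h1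
  have h : ∀ n (hn : n = k + 1) (a : Fin 1 → Fin n) (b : Fin k → Fin n) (v : Fin n → E5),
      (∀ i, (a i : ℕ) = i) → (∀ i, (b i : ℕ) = 1 + i) →
      altSum (fun w => ξ (fun i => w (a i)) * φ (fun j => w (b j))) v
        = altSum G (fun i => v (Fin.cast hn.symm i)) := by
    rintro n rfl a b v ha hb
    congr 1
    funext w
    have e1 : (fun i => w (a i)) = ![w 0] := by
      funext i; fin_cases i
      simp; congr 1; ext; simpa using ha 0
    have e2 : (fun i => w (b i)) = fun i => w i.succ := by
      funext i; congr 1; ext; simp [hb, add_comm]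
    simp only [e1, e2, G]
  rw [wedge_eq_altSum, h (1 + k) (add_comm _ _) _ _ v (by simp) (by simp), key]
  field_simp
  simp

/-! The cast in `wedge_one_left` disappears for numerals, where `1 + k` and `k + 1` are
definitionally equal. -/

theorem wedge10_eq (ξ : Alt 1) (φ : Alt 0) : wedge ξ φ = (wedgeOne ξ φ : Alt 1) := by
  ext v; exact wedge_one_left ξ φ v
theorem wedge11_eq (ξ : Alt 1) (φ : Alt 1) : wedge ξ φ = (wedgeOne ξ φ : Alt 2) := by
  ext v; exact wedge_one_left ξ φ v
theorem wedge12_eq (ξ : Alt 1) (φ : Alt 2) : wedge ξ φ = (wedgeOne ξ φ : Alt 3) := by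
  ext v; exact wedge_one_left ξ φ v
theorem wedge13_eq (ξ : Alt 1) (φ : Alt 3) : wedge ξ φ = (wedgeOne ξ φ : Alt 4) := by
  ext v; exact wedge_one_left ξ φ v
theorem wedge14_eq (ξ : Alt 1) (φ : Alt 4) : wedge ξ φ = (wedgeOne ξ φ : Alt 5) := by
  ext v; exact wedge_one_left ξ φ v

/-- The value of a form of degree zero. -/
def val0 (φ : Alt 0) : ℝ := φ ![]

theorem wedge_zero_right {p : ℕ} (α : Alt p) (φ : Alt 0) :
    wedge α φ = val0 φ • α := by
  ext v
  have : altSum (n := p + 0) (fun w => α (fun i => w (Fin.castAdd 0 i)) * φ (fun j => w (Fin.natAdd p j))) v =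
     altSum (n := p) (fun w => val0 φ * α w) v := by
    unfold altSum
    refine Finset.sum_congr rfl fun σ _ => ?_
    have e : (fun j : Fin 0 => v (σ (Fin.natAdd p j))) = ![] := Subsingleton.elim _ _
    simp only [e]
    rw [mul_comm]; rfl
  rw [wedge_eq_altSum, this, altSum_smul_of_alternating]
  simp
  field_simp

theorem wedge11_apply (ξ : Alt 1) (φ : Alt 1) (v : Fin 2 → E5) :
    wedge ξ φ v = pair (v 0) ξ * pair (v 1) φ - pair (v 1) ξ * pair (v 0) φ := by
  rw [wedge11_eq, wedgeOne_apply]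
  have e : ∀ i : Fin 2, φ (i.removeNth v) = pair (i.removeNth v 0) φ := by
    intro i; unfold pair; congr 1; funext j; fin_cases j; rfl
  simp [Fin.sum_univ_succ, e, Fin.removeNth]
  rfl

theorem wedge12_apply (ξ : Alt 1) (φ : Alt 2) (v : Fin 3 → E5) :
    wedge ξ φ v = pair (v 0) ξ * φ ![v 1, v 2] - pair (v 1) ξ * φ ![v 0, v 2]
      + pair (v 2) ξ * φ ![v 0, v 1] := by
  rw [wedge12_eq, wedgeOne_apply, Fin.sum_univ_three]
  have e0 : Fin.removeNth 0 v = ![v 1, v 2] := by funext i; fin_cases i <;> rfl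
  have e1 : Fin.removeNth 1 v = ![v 0, v 2] := by funext i; fin_cases i <;> rfl
  have e2 : Fin.removeNth 2 v = ![v 0, v 1] := by funext i; fin_cases i <;> rfl
  rw [e0, e1, e2]; simp; ring

theorem wedge13_apply (ξ : Alt 1) (φ : Alt 3) (v : Fin 4 → E5) :
    wedge ξ φ v = pair (v 0) ξ * φ ![v 1, v 2, v 3] - pair (v 1) ξ * φ ![v 0, v 2, v 3]
      + pair (v 2) ξ * φ ![v 0, v 1, v 3] - pair (v 3) ξ * φ ![v 0, v 1, v 2] := by
  rw [wedge13_eq, wedgeOne_apply, Fin.sum_univ_four]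
  have e0 : Fin.removeNth 0 v = ![v 1, v 2, v 3] := by funext i; fin_cases i <;> rfl
  have e1 : Fin.removeNth 1 v = ![v 0, v 2, v 3] := by funext i; fin_cases i <;> rfl
  have e2 : Fin.removeNth 2 v = ![v 0, v 1, v 3] := by funext i; fin_cases i <;> rfl
  have e3 : Fin.removeNth 3 v = ![v 0, v 1, v 2] := by funext i; fin_cases i <;> rfl
  rw [e0, e1, e2, e3]; simp; ring

theorem wedge14_apply (ξ : Alt 1) (φ : Alt 4) (v : Fin 5 → E5) :
    wedge ξ φ v = pair (v 0) ξ * φ ![v 1, v 2, v 3, v 4] - pair (v 1) ξ * φ ![v 0, v 2, v 3, v 4]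
      + pair (v 2) ξ * φ ![v 0, v 1, v 3, v 4] - pair (v 3) ξ * φ ![v 0, v 1, v 2, v 4]
      + pair (v 4) ξ * φ ![v 0, v 1, v 2, v 3] := by
  rw [wedge14_eq, wedgeOne_apply, Fin.sum_univ_five]
  have e0 : Fin.removeNth 0 v = ![v 1, v 2, v 3, v 4] := by funext i; fin_cases i <;> rfl
  have e1 : Fin.removeNth 1 v = ![v 0, v 2, v 3, v 4] := by funext i; fin_cases i <;> rfl
  have e2 : Fin.removeNth 2 v = ![v 0, v 1, v 3, v 4] := by funext i; fin_cases i <;> rfl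
  have e3 : Fin.removeNth 3 v = ![v 0, v 1, v 2, v 4] := by funext i; fin_cases i <;> rfl
  have e4 : Fin.removeNth 4 v = ![v 0, v 1, v 2, v 3] := by funext i; fin_cases i <;> rfl
  rw [e0, e1, e2, e3, e4]; simp; ring

/-! ### Multilinear algebra of wedge and interior products -/

theorem wedge_add_right {p q : ℕ} (α : Alt p) (β β' : Alt q) :
    wedge α (β + β') = wedge α β + wedge α β' := by
  ext v
  simp only [wedge_apply, ContinuousAlternatingMap.add_apply, mul_add, smul_add,
    Finset.sum_add_distrib]

theorem wedge_smul_right {p q : ℕ} (c : ℝ) (α : Alt p) (β : Alt q) :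
    wedge α (c • β) = c • wedge α β := by
  ext v
  simp only [wedge_apply, ContinuousAlternatingMap.smul_apply, smul_eq_mul, Finset.mul_sum]
  refine Finset.sum_congr rfl fun σ _ => ?_
  simp only [zsmul_eq_mul]
  ring

/-- The wedge product as a bilinear map. -/
def wedgeL (p q : ℕ) : Alt p →ₗ[ℝ] Alt q →ₗ[ℝ] Alt (p + q) :=
  LinearMap.mk₂ ℝ wedge wedge_add_left wedge_smul_left wedge_add_right wedge_smul_right

@[simp] theorem wedgeL_apply {p q : ℕ} (α : Alt p) (β : Alt q) : wedgeL p q α β = wedge α β := rfl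

@[simp] theorem wedge_zero {p q : ℕ} (α : Alt p) : wedge α (0 : Alt q) = 0 :=
  map_zero (wedgeL p q α)
@[simp] theorem zero_wedge {p q : ℕ} (β : Alt q) : wedge (0 : Alt p) β = 0 :=
  LinearMap.map_zero₂ (wedgeL p q) β

theorem pair_add_right (X : E5) (ξ η : Alt 1) : pair X (ξ + η) = pair X ξ + pair X η := rfl
theorem pair_smul_right (c : ℝ) (X : E5) (ξ : Alt 1) : pair X (c • ξ) = c * pair X ξ := rfl
@[simp] theorem pair_zero_right (X : E5) : pair X 0 = 0 := rfl
@[simp] theorem pair_zero_left (ξ : Alt 1) : pair 0 ξ = 0 := by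
  simpa using pair_smul_left 0 0 ξ

/-- Interior multiplication as a bilinear map. -/
def interiorL (k : ℕ) : E5 →ₗ[ℝ] Alt (k + 1) →ₗ[ℝ] Alt k :=
  LinearMap.mk₂ ℝ interior (fun X Y α => by simp [interior]) (fun c X α => by simp [interior])
    (fun X α β => rfl) (fun c X α => rfl)

@[simp] theorem interiorL_apply {k : ℕ} (X : E5) (α : Alt (k + 1)) :
    interiorL k X α = interior X α := rfl

theorem interior_apply {k : ℕ} (X : E5) (α : Alt (k + 1)) (v : Fin k → E5) :
    interior X α v = α (Matrix.vecCons X v) := rfl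

@[simp] theorem interior_zero {k : ℕ} (X : E5) : interior X (0 : Alt (k + 1)) = 0 := rfl
@[simp] theorem zero_interior {k : ℕ} (α : Alt (k + 1)) : interior 0 α = 0 :=
  LinearMap.map_zero₂ (interiorL k) α
theorem interior_add {k : ℕ} (X : E5) (α β : Alt (k + 1)) :
    interior X (α + β) = interior X α + interior X β := rfl
theorem interior_smul {k : ℕ} (X : E5) (c : ℝ) (α : Alt (k + 1)) :
    interior X (c • α) = c • interior X α := rfl
theorem add_interior {k : ℕ} (X Y : E5) (α : Alt (k + 1)) :
    interior (X + Y) α = interior X α + interior Y α := LinearMap.map_add₂ (interiorL k) X Y α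
theorem smul_interior {k : ℕ} (c : ℝ) (X : E5) (α : Alt (k + 1)) :
    interior (c • X) α = c • interior X α := LinearMap.map_smul₂ (interiorL k) c X α

theorem interior_interior_self {k : ℕ} (X : E5) (α : Alt (k + 2)) :
    interior X (interior X α) = 0 := by
  ext v
  exact α.map_eq_zero_of_eq _ (i := 0) (j := 1) rfl (by simp)

theorem interior_swap {k : ℕ} (X Y : E5) (α : Alt (k + 2)) :
    interior X (interior Y α) = -interior Y (interior X α) := by
  have h := interior_interior_self (X + Y) α
  simp only [add_interior, interior_add, interior_interior_self, zero_add, add_zero] at h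
  exact eq_neg_of_add_eq_zero_left (by rw [add_comm]; exact h)

theorem alt_ext_interior {k : ℕ} {α β : Alt (k + 1)} (h : ∀ X, interior X α = interior X β) :
    α = β := by
  ext v
  have := congrArg (fun γ : Alt k => γ (Fin.tail v)) (h (v 0))
  simp only [interior_apply] at this
  rwa [show Matrix.vecCons (v 0) (Fin.tail v) = v from Fin.cons_self_tail v] at this

/-- Exterior multiplication by a covector as a bilinear map. -/
def wedgeOneL (k : ℕ) : Alt 1 →ₗ[ℝ] Alt k →ₗ[ℝ] Alt (k + 1) :=
  LinearMap.mk₂ ℝ wedgeOne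
    (fun ξ η φ => by
      ext v; simp only [wedgeOne_apply, ContinuousAlternatingMap.add_apply, pair]
      rw [← Finset.sum_add_distrib]; exact Finset.sum_congr rfl fun i _ => by ring)
    (fun c ξ φ => by
      ext v; simp only [wedgeOne_apply, ContinuousAlternatingMap.smul_apply, pair, smul_eq_mul]
      rw [Finset.mul_sum]; exact Finset.sum_congr rfl fun i _ => by ring)
    (fun ξ η φ => by
      ext v; simp only [wedgeOne_apply, ContinuousAlternatingMap.add_apply]
      rw [← Finset.sum_add_distrib]; exact Finset.sum_congr rfl fun i _ => by ring)
    (fun c ξ φ => by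
      ext v; simp only [wedgeOne_apply, ContinuousAlternatingMap.smul_apply, smul_eq_mul]
      rw [Finset.mul_sum]; exact Finset.sum_congr rfl fun i _ => by ring)

theorem wedgeOne_add {k : ℕ} (ξ : Alt 1) (φ φ' : Alt k) :
    wedgeOne ξ (φ + φ') = wedgeOne ξ φ + wedgeOne ξ φ' := map_add (wedgeOneL k ξ) φ φ'
theorem wedgeOne_sub {k : ℕ} (ξ : Alt 1) (φ φ' : Alt k) :
    wedgeOne ξ (φ - φ') = wedgeOne ξ φ - wedgeOne ξ φ' := map_sub (wedgeOneL k ξ) φ φ'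
theorem wedgeOne_smul {k : ℕ} (ξ : Alt 1) (c : ℝ) (φ : Alt k) :
    wedgeOne ξ (c • φ) = c • wedgeOne ξ φ := map_smul (wedgeOneL k ξ) c φ
@[simp] theorem wedgeOne_zero {k : ℕ} (ξ : Alt 1) : wedgeOne ξ (0 : Alt k) = 0 :=
  map_zero (wedgeOneL k ξ)

theorem interior_wedgeOne_zero (X : E5) (ξ : Alt 1) (φ : Alt 0) :
    interior X (wedgeOne ξ φ) = pair X ξ • φ := by
  ext v
  have e : Fin.removeNth 0 (Matrix.vecCons X v) = v := funext fun i => i.elim0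
  simp [interior_apply, wedgeOne_apply, e]

/-- Interior multiplication is an antiderivation with respect to exterior multiplication by a
covector. -/
theorem interior_wedgeOne {k : ℕ} (X : E5) (ξ : Alt 1) (φ : Alt (k + 1)) :
    interior X (wedgeOne ξ φ) = pair X ξ • φ - wedgeOne ξ (interior X φ) := by
  ext v
  simp only [interior_apply, wedgeOne_apply, ContinuousAlternatingMap.sub_apply,
    ContinuousAlternatingMap.smul_apply, smul_eq_mul]
  rw [Fin.sum_univ_succ, sub_eq_add_neg, ← Finset.sum_neg_distrib]
  congr 1
  · simp only [Fin.val_zero, pow_zero, one_mul, Matrix.cons_val_zero]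
    rfl
  · refine Finset.sum_congr rfl fun i _ => ?_
    have : i.succ.removeNth (Matrix.vecCons X v) = Matrix.vecCons X (i.removeNth v) := by
      funext l
      refine Fin.cases ?_ (fun l => ?_) l <;> simp [Fin.removeNth]
    rw [this, Matrix.cons_val_succ, Fin.val_succ, pow_succ]
    ring

theorem wedgeOne_wedgeOne_self {k : ℕ} (ξ : Alt 1) (φ : Alt k) :
    wedgeOne ξ (wedgeOne ξ φ) = 0 := by
  induction k with
  | zero =>
    refine alt_ext_interior fun X => ?_
    rw [interior_wedgeOne, interior_wedgeOne_zero, wedgeOne_smul, sub_self, interior_zero]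
  | succ k ih =>
    refine alt_ext_interior fun X => ?_
    rw [interior_wedgeOne, interior_wedgeOne, wedgeOne_sub, wedgeOne_smul, ih, sub_zero, sub_self,
      interior_zero]

/-- There are no non-zero forms of degree greater than five. -/
theorem alt_eq_zero_of_lt {k : ℕ} (hk : 5 < k) (α : Alt k) : α = 0 := by
  ext v
  refine α.toAlternatingMap.map_linearDependent v fun h => ?_
  have := h.fintype_card_le_finrank
  simp at this
  omega

/-- A form of top degree is determined by its value on the standard basis. -/
theorem alt5_ext {α β : Alt 5} (h : α stdE = β stdE) : α = β := by
  have : α.toAlternatingMap = β.toAlternatingMap := by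
    refine Module.Basis.ext_alternating (EuclideanSpace.basisFun (Fin 5) ℝ).toBasis fun v hv => ?_
    have e : (fun i => (EuclideanSpace.basisFun (Fin 5) ℝ).toBasis (v i)) =
        stdE ∘ (Equiv.ofBijective v ⟨hv, Finite.injective_iff_surjective.1 hv⟩) := by
      funext i; simp only [OrthonormalBasis.coe_toBasis, EuclideanSpace.basisFun_apply]; rfl
    rw [e, AlternatingMap.map_perm, AlternatingMap.map_perm]
    congr 1
  ext v
  exact congrArg (fun γ => γ v) this

/-- A form is determined by its values on distinct standard basis vectors. -/
theorem alt_ext_std {k : ℕ} {α β : Alt k} (h : ∀ v : Fin k → Fin 5, Function.Injective v →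
    α (fun i => stdE (v i)) = β (fun i => stdE (v i))) : α = β := by
  have : α.toAlternatingMap = β.toAlternatingMap := by
    refine Module.Basis.ext_alternating (EuclideanSpace.basisFun (Fin 5) ℝ).toBasis fun v hv => ?_
    simpa [stdE] using h v hv
  ext v
  exact congrArg (fun γ => γ v) this

/-! ### Clifford multiplication -/

theorem cliffEv_eq (u : Gen) (φ : Ev) : cliffEv u φ =
    (interior u.1 φ.2.1 + wedgeOne u.2 φ.1, interior u.1 φ.2.2 + wedgeOne u.2 φ.2.1,
      wedgeOne u.2 φ.2.2) := by
  rw [← wedge10_eq, ← wedge12_eq, ← wedge14_eq]; rfl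

theorem cliffOd_eq (u : Gen) (ψ : Od) : cliffOd u ψ =
    (interior u.1 ψ.1, interior u.1 ψ.2.1 + wedgeOne u.2 ψ.1,
      interior u.1 ψ.2.2 + wedgeOne u.2 ψ.2.1) := by
  rw [← wedge11_eq, ← wedge13_eq]; rfl

/-- Clifford multiplication of even forms as a bilinear map. -/
def cliffEvL : Gen →ₗ[ℝ] Ev →ₗ[ℝ] Od :=
  LinearMap.mk₂ ℝ cliffEv
    (fun u v φ => by
      simp only [cliffEv, Prod.fst_add, Prod.snd_add, add_interior, wedge_add_left,
        Prod.mk_add_mk]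
      congr 1 <;> [skip; congr 1] <;> abel)
    (fun c u φ => by
      simp only [cliffEv, Prod.smul_fst, Prod.smul_snd, smul_interior, wedge_smul_left,
        Prod.smul_mk, smul_add])
    (fun u φ φ' => by
      simp only [cliffEv, Prod.fst_add, Prod.snd_add, interior_add, wedge_add_right,
        Prod.mk_add_mk]
      congr 1 <;> [skip; congr 1] <;> abel)
    (fun c u φ => by
      simp only [cliffEv, Prod.smul_fst, Prod.smul_snd, interior_smul, wedge_smul_right,
        Prod.smul_mk, smul_add])

/-- Clifford multiplication of odd forms as a bilinear map. -/
def cliffOdL : Gen →ₗ[ℝ] Od →ₗ[ℝ] Ev :=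
  LinearMap.mk₂ ℝ cliffOd
    (fun u v φ => by
      simp only [cliffOd, Prod.fst_add, Prod.snd_add, add_interior, wedge_add_left,
        Prod.mk_add_mk]
      congr 2 <;> abel)
    (fun c u φ => by
      simp only [cliffOd, Prod.smul_fst, Prod.smul_snd, smul_interior, wedge_smul_left,
        Prod.smul_mk, smul_add])
    (fun u φ φ' => by
      simp only [cliffOd, Prod.fst_add, Prod.snd_add, interior_add, wedge_add_right,
        Prod.mk_add_mk]
      congr 2 <;> abel)
    (fun c u φ => by
      simp only [cliffOd, Prod.smul_fst, Prod.smul_snd, interior_smul, wedge_smul_right,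
        Prod.smul_mk, smul_add])

theorem cliffEvL_apply (u : Gen) (φ : Ev) : cliffEvL u φ = cliffEv u φ := rfl
theorem cliffOdL_apply (u : Gen) (φ : Od) : cliffOdL u φ = cliffOd u φ := rfl

theorem inner_self (u : Gen) : inner u u = pair u.1 u.2 := by simp [inner]

/-- The Clifford relation `u v + v u = 2 (u, v)`, by polarisation of `u u = (u, u)`. -/
theorem cliffOd_cliffEv_self (u : Gen) (φ : Ev) :
    cliffOd u (cliffEv u φ) = inner u u • φ := by
  rw [cliffOd_eq, cliffEv_eq, inner_self]
  refine Prod.ext ?_ (Prod.ext ?_ ?_)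
  · simp [interior_add, interior_interior_self, interior_wedgeOne_zero]
  · simp [interior_add, interior_interior_self, interior_wedgeOne, wedgeOne_add,
      wedgeOne_wedgeOne_self]
  · simp [interior_wedgeOne, wedgeOne_add, wedgeOne_wedgeOne_self]

theorem cliffEv_cliffOd_self (u : Gen) (ψ : Od) :
    cliffEv u (cliffOd u ψ) = inner u u • ψ := by
  rw [cliffOd_eq, cliffEv_eq, inner_self]
  refine Prod.ext ?_ (Prod.ext ?_ ?_)
  · simp [interior_add, interior_interior_self, interior_wedgeOne]
  · simp [interior_add, interior_interior_self, interior_wedgeOne, wedgeOne_add,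
      wedgeOne_wedgeOne_self]
  · have h := interior_wedgeOne u.1 u.2 ψ.2.2
    rw [alt_eq_zero_of_lt (by norm_num) (wedgeOne u.2 ψ.2.2), interior_zero] at h
    simp [wedgeOne_add, wedgeOne_wedgeOne_self]
    exact (sub_eq_zero.1 h.symm).symm

theorem inner_comm (u v : Gen) : inner u v = inner v u := by simp [inner, add_comm]

/-- The inner product as a bilinear map. -/
def innerL : Gen →ₗ[ℝ] Gen →ₗ[ℝ] ℝ :=
  LinearMap.mk₂ ℝ inner
    (fun u v w => by simp [inner, pair_add_left, pair_add_right]; ring)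
    (fun c u w => by simp [inner, pair_smul_left, pair_smul_right]; ring)
    (fun u v w => by simp [inner, pair_add_left, pair_add_right]; ring)
    (fun c u w => by simp [inner, pair_smul_left, pair_smul_right]; ring)

theorem innerL_apply (u v : Gen) : innerL u v = inner u v := rfl

theorem inner_add_add_self (u v : Gen) :
    inner (u + v) (u + v) = inner u u + 2 * inner u v + inner v v := by
  simp only [← innerL_apply, map_add, LinearMap.add_apply]
  rw [innerL_apply v u, inner_comm v u, innerL_apply u v]; ring

theorem cliffOd_cliffEv (u v : Gen) (φ : Ev) :
    cliffOd u (cliffEv v φ) = (2 * inner u v) • φ - cliffOd v (cliffEv u φ) := by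
  have h := cliffOd_cliffEv_self (u + v) φ
  rw [inner_add_add_self] at h
  simp only [← cliffOdL_apply, ← cliffEvL_apply, map_add, LinearMap.add_apply] at h ⊢
  simp only [cliffOdL_apply, cliffEvL_apply, cliffOd_cliffEv_self, add_smul] at h ⊢
  rw [eq_sub_iff_add_eq]
  rw [show (2 * inner u v) • φ = inner u u • φ + (2 * inner u v) • φ + inner v v • φ
    - inner u u • φ - inner v v • φ by abel, ← h]
  abel

theorem cliffEv_cliffOd (u v : Gen) (φ : Od) :
    cliffEv u (cliffOd v φ) = (2 * inner u v) • φ - cliffEv v (cliffOd u φ) := by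
  have h := cliffEv_cliffOd_self (u + v) φ
  rw [inner_add_add_self] at h
  simp only [← cliffOdL_apply, ← cliffEvL_apply, map_add, LinearMap.add_apply] at h ⊢
  simp only [cliffOdL_apply, cliffEvL_apply, cliffEv_cliffOd_self, add_smul] at h ⊢
  rw [eq_sub_iff_add_eq]
  rw [show (2 * inner u v) • φ = inner u u • φ + (2 * inner u v) • φ + inner v v • φ
    - inner u u • φ - inner v v • φ by abel, ← h]
  abel

theorem mukai_add_left (ψ ψ' : Od) (φ : Ev) : mukai (ψ + ψ') φ = mukai ψ φ + mukai ψ' φ := by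
  simp only [mukai, Prod.fst_add, Prod.snd_add, wedge_add_left]; abel
theorem mukai_smul_left (c : ℝ) (ψ : Od) (φ : Ev) : mukai (c • ψ) φ = c • mukai ψ φ := by
  simp only [mukai, Prod.smul_fst, Prod.smul_snd, wedge_smul_left, smul_add, smul_sub]
theorem mukai_add_right (ψ : Od) (φ φ' : Ev) : mukai ψ (φ + φ') = mukai ψ φ + mukai ψ φ' := by
  simp only [mukai, Prod.fst_add, Prod.snd_add, wedge_add_right]; abel
theorem mukai_smul_right (c : ℝ) (ψ : Od) (φ : Ev) : mukai ψ (c • φ) = c • mukai ψ φ := by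
  simp only [mukai, Prod.smul_fst, Prod.smul_snd, wedge_smul_right, smul_add, smul_sub]

/-- The Mukai pairing as a bilinear map. -/
def mukaiL : Od →ₗ[ℝ] Ev →ₗ[ℝ] Alt 5 :=
  LinearMap.mk₂ ℝ mukai mukai_add_left mukai_smul_left mukai_add_right mukai_smul_right

theorem mukaiL_apply (ψ : Od) (φ : Ev) : mukaiL ψ φ = mukai ψ φ := rfl

/-! ### Symmetry of the Mukai pairing -/

theorem alt2_zero (α : Alt 2) (a : E5) : α ![a, a] = 0 :=
  α.map_eq_zero_of_eq _ (i := 0) (j := 1) rfl (by decide)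
theorem alt3_zero₀ (α : Alt 3) (a b : E5) : α ![a, a, b] = 0 :=
  α.map_eq_zero_of_eq _ (i := 0) (j := 1) rfl (by decide)
theorem alt3_zero₁ (α : Alt 3) (a b : E5) : α ![b, a, a] = 0 :=
  α.map_eq_zero_of_eq _ (i := 1) (j := 2) rfl (by decide)
theorem alt4_zero₀ (α : Alt 4) (a b c : E5) : α ![a, a, b, c] = 0 :=
  α.map_eq_zero_of_eq _ (i := 0) (j := 1) rfl (by decide)
theorem alt4_zero₁ (α : Alt 4) (a b c : E5) : α ![b, a, a, c] = 0 :=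
  α.map_eq_zero_of_eq _ (i := 1) (j := 2) rfl (by decide)
theorem alt4_zero₂ (α : Alt 4) (a b c : E5) : α ![b, c, a, a] = 0 :=
  α.map_eq_zero_of_eq _ (i := 2) (j := 3) rfl (by decide)

theorem wedge_zero_form {p : ℕ} (α : Alt p) (φ : Alt 0) (v : Fin p → E5) :
    wedge α φ v = val0 φ * α v := by
  rw [wedge_zero_right]; rfl

theorem stdE_apply (i j : Fin 5) : stdE i j = if j = i then 1 else 0 := by
  simp [stdE]

theorem pair_stdE_stdDual (i j : Fin 5) : pair (stdE i) (stdDual j) = if j = i then 1 else 0 := by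
  rw [pair_stdDual, stdE_apply]

/-- The value of the Mukai pairing on the standard basis. -/
theorem mukai_stdE (ψ : Od) (φ : Ev) : mukai ψ φ stdE =
    wedge ψ.1 φ.2.2 stdE - wedge ψ.2.1 φ.2.1 stdE + val0 φ.1 * ψ.2.2 stdE := by
  rw [← wedge_zero_form]; rfl

theorem cliffEv_covector (ξ : Alt 1) (φ : Ev) :
    cliffEv (0, ξ) φ = (val0 φ.1 • ξ, wedge ξ φ.2.1, wedge ξ φ.2.2) := by
  simp [cliffEv, wedge_zero_right]

theorem cliffEv_vector (X : E5) (φ : Ev) :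
    cliffEv (X, 0) φ = (interior X φ.2.1, interior X φ.2.2, 0) := by
  simp [cliffEv]

theorem cliffOd_covector (ξ : Alt 1) (ψ : Od) :
    cliffOd (0, ξ) ψ = (0, wedge ξ ψ.1, wedge ξ ψ.2.1) := by
  simp [cliffOd]

theorem cliffOd_vector (X : E5) (ψ : Od) :
    cliffOd (X, 0) ψ = (interior X ψ.1, interior X ψ.2.1, interior X ψ.2.2) := by
  simp [cliffOd]

/-- Only the vector part is expanded in a basis: the identities below are natural in the covector.
-/
theorem gen_eq (v : Gen) : v = ∑ i, v.1 i • ((stdE i, 0) : Gen) + (0, v.2) := by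
  ext1
  · simpa [Prod.fst_sum] using sum_stdE v.1
  · simp [Prod.snd_sum]

/-- Linear maps on `T ⊕ T*` agree if they agree on the standard vectors and on all covectors. -/
theorem linear_ext_gen {V : Type*} [AddCommGroup V] [Module ℝ V] {F G : Gen → V}
    (hF : IsLinearMap ℝ F) (hG : IsLinearMap ℝ G) (hX : ∀ l, F (stdE l, 0) = G (stdE l, 0))
    (hξ : ∀ ξ, F (0, ξ) = G (0, ξ)) (v : Gen) : F v = G v := by
  change hF.mk' F v = hG.mk' G v
  rw [gen_eq v]
  simp only [map_add, map_sum, map_smul, IsLinearMap.mk'_apply, hX, hξ]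

theorem cliffEv_add_left (u v : Gen) (φ : Ev) : cliffEv (u + v) φ = cliffEv u φ + cliffEv v φ :=
  LinearMap.map_add₂ cliffEvL u v φ
theorem cliffEv_smul_left (c : ℝ) (u : Gen) (φ : Ev) : cliffEv (c • u) φ = c • cliffEv u φ :=
  LinearMap.map_smul₂ cliffEvL c u φ
theorem cliffEv_add_right (u : Gen) (φ φ' : Ev) :
    cliffEv u (φ + φ') = cliffEv u φ + cliffEv u φ' := map_add (cliffEvL u) φ φ'
theorem cliffEv_smul_right (c : ℝ) (u : Gen) (φ : Ev) : cliffEv u (c • φ) = c • cliffEv u φ :=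
  map_smul (cliffEvL u) c φ
theorem cliffOd_add_left (u v : Gen) (ψ : Od) : cliffOd (u + v) ψ = cliffOd u ψ + cliffOd v ψ :=
  LinearMap.map_add₂ cliffOdL u v ψ
theorem cliffOd_smul_left (c : ℝ) (u : Gen) (ψ : Od) : cliffOd (c • u) ψ = c • cliffOd u ψ :=
  LinearMap.map_smul₂ cliffOdL c u ψ
theorem cliffOd_add_right (u : Gen) (ψ ψ' : Od) :
    cliffOd u (ψ + ψ') = cliffOd u ψ + cliffOd u ψ' := map_add (cliffOdL u) ψ ψ'
theorem cliffOd_smul_right (c : ℝ) (u : Gen) (ψ : Od) : cliffOd u (c • ψ) = c • cliffOd u ψ :=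
  map_smul (cliffOdL u) c ψ
/-- Contracting a top-degree form with the `l`-th basis vector and evaluating on the basis without
its `m`-th vector. -/
theorem interior_stdE_removeNth (l m : Fin 5) (α : Alt 5) :
    interior (stdE l) α (m.removeNth stdE) = if l = m then (-1) ^ (m : ℕ) * α stdE else 0 := by
  split_ifs with h
  · subst h
    rw [interior_apply, ← α.neg_one_pow_smul_map_insertNth l, Fin.insertNth_self_removeNth]
    simp
  · obtain ⟨n, rfl⟩ := Fin.exists_succAbove_eq h
    exact α.map_eq_zero_of_eq _ (i := 0) (j := n.succ) (by simp [Fin.removeNth])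
      (Fin.succ_ne_zero n).symm

theorem interior_stdE_apply (l : Fin 5) (α : Alt 5) (i j k m n : Fin 5)
    (h : (![stdE i, stdE j, stdE k, stdE m] : Fin 4 → E5) = n.removeNth stdE) :
    interior (stdE l) α ![stdE i, stdE j, stdE k, stdE m] =
      if l = n then (-1) ^ (n : ℕ) * α stdE else 0 := by
  rw [h, interior_stdE_removeNth]

/-- Clifford multiplication is symmetric for the Mukai pairing, so that `⟨v · φ, φ⟩` is the
quadratic form of a symmetric bilinear form on even forms. -/
theorem mukai_cliffEv_symm (v : Gen) (φ φ' : Ev) :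
    mukai (cliffEv v φ) φ' = mukai (cliffEv v φ') φ := by
  have h1 : ∀ φ φ' : Ev, IsLinearMap ℝ fun v : Gen => mukai (cliffEv v φ) φ' := fun φ φ' =>
    ⟨fun u v => by simp only [cliffEv_add_left, mukai_add_left],
      fun c v => by simp only [cliffEv_smul_left, mukai_smul_left]⟩
  refine linear_ext_gen (h1 φ φ') (h1 φ' φ) ?_ ?_ v
  · intro l
    refine alt5_ext ?_
    rw [mukai_stdE, mukai_stdE, cliffEv_vector, cliffEv_vector]
    simp only [wedge32_apply, wedge14_apply, pair, interior_apply]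
    fin_cases l <;>
    simp [alt2_zero, alt4_zero₀, alt4_zero₁, alt4_zero₂, alt2_sort stdE, alt4_sort₀ stdE, alt4_sort₁ stdE,
      alt4_sort₂ stdE] <;> ring
  · intro ξ
    refine alt5_ext ?_
    rw [mukai_stdE, mukai_stdE, cliffEv_covector, cliffEv_covector]
    simp only [wedge32_apply, wedge14_apply, wedge12_apply, pair_smul_right]
    simp
    ring

/-- The counterpart of `mukai_cliffEv_symm` on odd forms. -/
theorem mukai_cliffOd_symm (v : Gen) (ψ ψ' : Od) :
    mukai ψ (cliffOd v ψ') = mukai ψ' (cliffOd v ψ) := by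
  have h1 : ∀ ψ ψ' : Od, IsLinearMap ℝ fun v : Gen => mukai ψ (cliffOd v ψ') := fun φ φ' =>
    ⟨fun u v => by simp only [cliffOd_add_left, mukai_add_right],
      fun c v => by simp only [cliffOd_smul_left, mukai_smul_right]⟩
  refine linear_ext_gen (h1 ψ ψ') (h1 ψ' ψ) ?_ ?_ v
  · intro l
    refine alt5_ext ?_
    rw [mukai_stdE, mukai_stdE, cliffOd_vector, cliffOd_vector]
    have h0 := fun α : Alt 5 => interior_stdE_apply l α 1 2 3 4 0 (by funext i; fin_cases i <;> rfl)
    have h1 := fun α : Alt 5 => interior_stdE_apply l α 0 2 3 4 1 (by funext i; fin_cases i <;> rfl)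
    have h2 := fun α : Alt 5 => interior_stdE_apply l α 0 1 3 4 2 (by funext i; fin_cases i <;> rfl)
    have h3 := fun α : Alt 5 => interior_stdE_apply l α 0 1 2 4 3 (by funext i; fin_cases i <;> rfl)
    have h4 := fun α : Alt 5 => interior_stdE_apply l α 0 1 2 3 4 (by funext i; fin_cases i <;> rfl)
    simp only [wedge32_apply, wedge14_apply, h0, h1, h2, h3, h4]
    simp only [interior_apply, val0, pair]
    clear h0 h1 h2 h3 h4
    fin_cases l <;>
    simp [alt3_zero₀, alt3_zero₁, alt3_sort₀ stdE, alt3_sort₁ stdE] <;> ring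
  · intro ξ
    refine alt5_ext ?_
    rw [mukai_stdE, mukai_stdE, cliffOd_covector, cliffOd_covector]
    simp only [wedge32_apply, wedge14_apply, wedge13_apply, wedge11_apply]
    simp [val0]
    ring

/-! ### The quadratic map and the quartic -/

theorem coeff_add (μ α β : Alt 5) : coeff μ (α + β) = coeff μ α + coeff μ β := add_div _ _ _
theorem coeff_sub (μ α β : Alt 5) : coeff μ (α - β) = coeff μ α - coeff μ β := sub_div _ _ _
theorem coeff_smul (c : ℝ) (μ α : Alt 5) : coeff μ (c • α) = c * coeff μ α := mul_div_assoc _ _ _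

theorem inner_add_left (u v w : Gen) : inner (u + v) w = inner u w + inner v w :=
  LinearMap.map_add₂ innerL u v w
theorem inner_add_right (u v w : Gen) : inner u (v + w) = inner u v + inner u w :=
  map_add (innerL u) v w
theorem inner_sub_left (u v w : Gen) : inner (u - v) w = inner u w - inner v w :=
  LinearMap.map_sub₂ innerL u v w
theorem inner_sub_right (u v w : Gen) : inner u (v - w) = inner u v - inner u w :=
  map_sub (innerL u) v w
theorem inner_smul_left (c : ℝ) (u w : Gen) : inner (c • u) w = c * inner u w :=
  LinearMap.map_smul₂ innerL c u w
theorem inner_smul_right (c : ℝ) (u w : Gen) : inner u (c • w) = c * inner u w :=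
  map_smul (innerL u) c w

/-- The inner product on `T ⊕ T*` is non-degenerate. -/
theorem inner_ext {u w : Gen} (h : ∀ v, inner u v = inner w v) : u = w := by
  have h1 : ∀ i, u.1 i = w.1 i := fun i => by
    have := h (0, stdDual i)
    simpa [inner, pair_stdDual] using this
  refine Prod.ext (by ext i; exact h1 i) ?_
  rw [sum_stdDual u.2, sum_stdDual w.2]
  refine Finset.sum_congr rfl fun i _ => ?_
  have := h (stdE i, 0)
  simp [inner] at this
  rw [this]

/-- The element of `T ⊕ T*` that represents a linear functional for the inner product. -/
def dualGen (l : Gen →ₗ[ℝ] ℝ) : Gen :=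
  (∑ i, (2 * l (0, stdDual i)) • stdE i, ∑ i, (2 * l (stdE i, 0)) • stdDual i)

theorem inner_stdE (u : Gen) (i : Fin 5) : inner u (stdE i, 0) = pair (stdE i) u.2 / 2 := by
  simp [inner]

theorem inner_stdDual (u : Gen) (i : Fin 5) : inner u (0, stdDual i) = u.1 i / 2 := by
  simp [inner, pair_stdDual]

theorem sum_smul_stdE_apply (a : Fin 5 → ℝ) (i : Fin 5) : (∑ j, a j • stdE j) i = a i := by
  simp [stdE_apply]

theorem pair_stdE_sum (b : Fin 5 → ℝ) (i : Fin 5) :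
    pair (stdE i) (∑ j, b j • stdDual j) = b i := by
  have : pair (stdE i) (∑ j, b j • stdDual j) = ∑ j, b j * pair (stdE i) (stdDual j) := by
    unfold pair; rw [ContinuousAlternatingMap.sum_apply]; rfl
  rw [this]
  simp [pair_stdE_stdDual]

theorem isLinearMap_inner (u : Gen) : IsLinearMap ℝ fun v => inner u v :=
  (innerL u).isLinear

theorem sum_pair_stdE (ξ : Alt 1) (F : Alt 1 →ₗ[ℝ] ℝ) :
    F ξ = ∑ i, pair (stdE i) ξ * F (stdDual i) := by
  conv_lhs => rw [sum_stdDual ξ]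
  simp

theorem inner_dualGen (l : Gen →ₗ[ℝ] ℝ) (v : Gen) : inner (dualGen l) v = l v := by
  refine linear_ext_gen (isLinearMap_inner _) l.isLinear (fun i => ?_) (fun ξ => ?_) v
  · rw [inner_stdE, dualGen, pair_stdE_sum]; ring
  · have h := fun F => sum_pair_stdE ξ F
    have h1 := h ((innerL (dualGen l)).comp (LinearMap.inr ℝ E5 (Alt 1)))
    have h2 := h (l.comp (LinearMap.inr ℝ E5 (Alt 1)))
    simp only [LinearMap.comp_apply, LinearMap.inr_apply, innerL_apply] at h1 h2
    rw [h1, h2]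
    refine Finset.sum_congr rfl fun i _ => ?_
    rw [inner_stdDual, dualGen]
    simp only [sum_smul_stdE_apply]
    ring

/-- The polarisation of the quadratic map `quadMap`. -/
def quadPol (μ : Alt 5) (φ φ' : Ev) : Gen :=
  dualGen
    { toFun := fun v => coeff μ (mukai (cliffEv v φ) φ')
      map_add' := fun u v => by rw [cliffEv_add_left, mukai_add_left, coeff_add]
      map_smul' := fun c v => by
        rw [cliffEv_smul_left, mukai_smul_left, coeff_smul]; rfl }

theorem inner_quadPol (μ : Alt 5) (φ φ' : Ev) (v : Gen) :
    inner (quadPol μ φ φ') v = coeff μ (mukai (cliffEv v φ) φ') := inner_dualGen _ v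

theorem quadPol_self (μ : Alt 5) (φ : Ev) : quadPol μ φ φ = quadMap μ φ :=
  inner_ext fun v => by rw [inner_quadPol, inner_quadMap]

theorem quadPol_comm (μ : Alt 5) (φ φ' : Ev) : quadPol μ φ φ' = quadPol μ φ' φ :=
  inner_ext fun v => by rw [inner_quadPol, inner_quadPol, mukai_cliffEv_symm]

theorem quadPol_add_left (μ : Alt 5) (φ χ φ' : Ev) :
    quadPol μ (φ + χ) φ' = quadPol μ φ φ' + quadPol μ χ φ' :=
  inner_ext fun v => by
    simp only [inner_add_left, inner_quadPol, cliffEv_add_right, mukai_add_left, coeff_add]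

theorem quadPol_smul_left (μ : Alt 5) (c : ℝ) (φ φ' : Ev) :
    quadPol μ (c • φ) φ' = c • quadPol μ φ φ' :=
  inner_ext fun v => by
    simp only [inner_smul_left, inner_quadPol, cliffEv_smul_right, mukai_smul_left, coeff_smul]

theorem quadMap_comb (μ : Alt 5) (a b : ℝ) (x y : Ev) :
    quadMap μ (a • x + b • y) =
      a ^ 2 • quadMap μ x + (2 * a * b) • quadPol μ x y + b ^ 2 • quadMap μ y := by
  refine inner_ext fun v => ?_
  simp only [inner_add_left, inner_smul_left, inner_quadMap, inner_quadPol, cliffEv_add_right,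
    cliffEv_smul_right, mukai_add_left, mukai_smul_left, mukai_add_right, mukai_smul_right,
    coeff_add, coeff_smul]
  rw [mukai_cliffEv_symm v y x]
  ring

/-- The analogue of `quadMap` for odd forms: `(Q'(ψ), v) = ⟨ψ, v · ψ⟩`. -/
def quadMapOd (μ : Alt 5) (ψ : Od) : Gen :=
  dualGen
    { toFun := fun v => coeff μ (mukai ψ (cliffOd v ψ))
      map_add' := fun u v => by rw [cliffOd_add_left, mukai_add_right, coeff_add]
      map_smul' := fun c v => by
        rw [cliffOd_smul_left, mukai_smul_right, coeff_smul]; rfl }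

theorem inner_quadMapOd (μ : Alt 5) (ψ : Od) (v : Gen) :
    inner (quadMapOd μ ψ) v = coeff μ (mukai ψ (cliffOd v ψ)) := inner_dualGen _ v

theorem mukai_sub_left (ψ ψ' : Od) (φ : Ev) : mukai (ψ - ψ') φ = mukai ψ φ - mukai ψ' φ :=
  eq_sub_of_add_eq (by rw [← mukai_add_left, sub_add_cancel])
theorem mukai_sub_right (ψ : Od) (φ φ' : Ev) : mukai ψ (φ - φ') = mukai ψ φ - mukai ψ φ' :=
  eq_sub_of_add_eq (by rw [← mukai_add_right, sub_add_cancel])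

/-- `Q` intertwines Clifford multiplication by `u` with minus the reflection in `u`, scaled by the
square of `u`. -/
theorem quadMap_cliffOd (μ : Alt 5) (u : Gen) (ψ : Od) :
    quadMap μ (cliffOd u ψ) =
      (2 * inner (quadMapOd μ ψ) u) • u - inner u u • quadMapOd μ ψ := by
  refine inner_ext fun w => ?_
  rw [inner_quadMap, cliffEv_cliffOd, mukai_sub_left, mukai_cliffEv_symm u (cliffOd w ψ),
    cliffEv_cliffOd_self, mukai_smul_left, mukai_smul_left, coeff_sub, coeff_smul, coeff_smul,
    inner_sub_left, inner_smul_left, inner_smul_left, inner_quadMapOd, inner_quadMapOd,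
    inner_comm u w]
  ring

/-- The counterpart of `quadMap_cliffOd` with the half-spin representations exchanged. -/
theorem quadMapOd_cliffEv (μ : Alt 5) (u : Gen) (φ : Ev) :
    quadMapOd μ (cliffEv u φ) =
      (2 * inner (quadMap μ φ) u) • u - inner u u • quadMap μ φ := by
  refine inner_ext fun w => ?_
  rw [inner_quadMapOd, cliffOd_cliffEv, mukai_sub_right, mukai_cliffOd_symm u (cliffEv u φ),
    cliffOd_cliffEv_self, mukai_smul_right, mukai_smul_right, coeff_sub, coeff_smul, coeff_smul,
    inner_sub_left, inner_smul_left, inner_smul_left, inner_quadMap, inner_quadMap,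
    inner_comm u w]
  ring

/-- The reflections in `u`, scaled by `(u, u)`, are similarities of ratio `(u, u)²`. -/
theorem inner_reflection (u x y : Gen) :
    inner ((2 * inner x u) • u - inner u u • x) ((2 * inner y u) • u - inner u u • y) =
      inner u u ^ 2 * inner x y := by
  simp only [inner_sub_left, inner_sub_right, inner_smul_left, inner_smul_right]
  rw [inner_comm u y]
  ring

theorem quartic_cliff (μ : Alt 5) (u v : Gen) (ρ : Fin 2 → Ev) :
    quartic μ (fun i => cliffOd u (cliffEv v (ρ i))) =
      inner u u ^ 2 * inner v v ^ 2 * quartic μ ρ := by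
  simp only [quartic, quadMap_cliffOd, quadMapOd_cliffEv]
  rw [inner_reflection, inner_reflection]
  ring

/-- The quartic is invariant under `Spin(5,5)`. -/
theorem quartic_spin (μ : Alt 5) {g : Function.End Ev} (hg : g ∈ spinOn) (ρ : Fin 2 → Ev) :
    quartic μ (fun i => g (ρ i)) = quartic μ ρ := by
  induction hg using Submonoid.closure_induction generalizing ρ with
  | mem g hg =>
    obtain ⟨u, v, hu, hv, rfl⟩ := hg
    rw [quartic_cliff, ← sq_abs (inner u u), ← sq_abs (inner v v), hu, hv]
    ring
  | one => rfl
  | mul g h _ _ ihg ihh => exact (ihg (fun i => h (ρ i))).trans (ihh ρ)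

set_option maxRecDepth 4000 in
/-- The vectors `Q(φ)` are null. -/
theorem inner_quadMap_self (μ : Alt 5) (φ : Ev) : inner (quadMap μ φ) (quadMap μ φ) = 0 := by
  have hV : ∀ i, (quadMap μ φ).1 i = 2 * mukai (cliffEv (0, stdDual i) φ) φ stdE / μ stdE := by
    intro i
    rw [mul_div_assoc]
    exact sum_smul_stdE_apply (fun i => 2 * coeff μ (mukai (cliffEv (0, stdDual i) φ) φ)) i
  have hη : (quadMap μ φ).2 =
      ∑ i, (2 * mukai (cliffEv (stdE i, 0) φ) φ stdE / μ stdE) • stdDual i := by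
    simp only [mul_div_assoc]; rfl
  have hs : inner (quadMap μ φ) (quadMap μ φ) = ∑ i, (quadMap μ φ).1 i *
      (2 * mukai (cliffEv (stdE i, 0) φ) φ stdE / μ stdE) := by
    rw [inner_self]
    have := sum_pair_stdE (quadMap μ φ).2
      ((innerL ((2 : ℝ) • (quadMap μ φ).1, 0)).comp (LinearMap.inr ℝ E5 (Alt 1)))
    simp only [LinearMap.comp_apply, LinearMap.inr_apply, innerL_apply, inner, pair_smul_left,
      pair_stdDual, pair_zero_left] at this
    simp only [add_zero, mul_div_cancel_left₀ _ (two_ne_zero (α := ℝ))] at this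
    rw [this]
    refine Finset.sum_congr rfl fun i _ => ?_
    rw [hη, pair_stdE_sum, mul_comm]
    congr 1
    simp
  rw [hs]
  -- in coordinates, the sum of the products of the components of `Q(φ)` cancels identically
  simp only [hV, mukai_stdE, cliffEv_vector, cliffEv_covector]
  simp only [wedge32_apply, wedge14_apply, wedge12_apply, interior_apply, pair_smul_right,
    pair_stdE_stdDual, Fin.sum_univ_five]
  have hp : ∀ X Y : E5, pair Y (interior X φ.2.1) = φ.2.1 ![X, Y] := fun X Y => rfl
  simp [hp, pair_stdE_stdDual, alt2_zero, alt4_zero₀, alt4_zero₁, alt4_zero₂, alt2_sort stdE, alt4_sort₀ stdE,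
    alt4_sort₁ stdE, alt4_sort₂ stdE]
  ring

/-- The quartic is a semi-invariant of `GL(2, ℝ)`. Expanding `Q(a ρ₁ + b ρ₂)` brings in the
polarisation `P = Q(ρ₁, ρ₂)`; since these vectors are null for all `a` and `b`, one has `(Q(ρ₁),
P) = 0 = (P, Q(ρ₂))` and `2 (P, P) = -(Q(ρ₁), Q(ρ₂))`. -/
theorem quartic_matAct (μ : Alt 5) (A : Matrix (Fin 2) (Fin 2) ℝ) (ρ : Fin 2 → Ev) :
    quartic μ (matAct A ρ) = A.det ^ 2 * quartic μ ρ := by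
  have key : ∀ a b : ℝ, inner (quadMap μ (a • ρ 0 + b • ρ 1)) (quadMap μ (a • ρ 0 + b • ρ 1)) = 0 :=
    fun a b => inner_quadMap_self μ _
  simp only [quartic, matAct, Fin.sum_univ_two, quadMap_comb, inner_add_left, inner_add_right,
    inner_smul_left, inner_smul_right, Matrix.det_fin_two, inner_quadMap_self] at key ⊢
  rw [inner_comm (quadMap μ (ρ 1)) (quadMap μ (ρ 0)),
    inner_comm (quadPol μ (ρ 0) (ρ 1)) (quadMap μ (ρ 0)),
    inner_comm (quadMap μ (ρ 1)) (quadPol μ (ρ 0) (ρ 1))] at key ⊢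
  set p := inner (quadMap μ (ρ 0)) (quadMap μ (ρ 1))
  set q := inner (quadMap μ (ρ 0)) (quadPol μ (ρ 0) (ρ 1))
  set r := inner (quadPol μ (ρ 0) (ρ 1)) (quadMap μ (ρ 1))
  set s := inner (quadPol μ (ρ 0) (ρ 1)) (quadPol μ (ρ 0) (ρ 1))
  -- the form `(Q(a ρ₁ + b ρ₂), Q(a ρ₁ + b ρ₂))` of degree four in `(a, b)` vanishes; three values
  -- determine its three coefficients
  have k1 := key 1 1
  have k2 := key 1 (-1)
  have k3 := key 1 2
  have hs : s = -p / 2 := by linarith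
  have hq : q = 0 := by linarith
  have hr : r = 0 := by linarith
  rw [hs, hq, hr]
  ring

/-! ### The spin group -/

theorem isLinearMap_of_mem_spinOn {g : Function.End Ev} (hg : g ∈ spinOn) : IsLinearMap ℝ g := by
  induction hg using Submonoid.closure_induction with
  | mem g hg =>
    obtain ⟨u, v, -, -, rfl⟩ := hg
    exact ⟨fun x y => by rw [cliffEv_add_right, cliffOd_add_right],
      fun c x => by rw [cliffEv_smul_right, cliffOd_smul_right]⟩
  | one => exact ⟨fun _ _ => rfl, fun _ _ => rfl⟩
  | mul g h _ _ ihg ihh =>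
    exact ⟨fun x y => (congrArg g (ihh.map_add x y)).trans (ihg.map_add _ _),
      fun c x => (congrArg g (ihh.map_smul c x)).trans (ihg.map_smul _ _)⟩

theorem mem_spinOn_congr {f g : Function.End Ev} (h : g ∈ spinOn) (e : ∀ φ, f φ = g φ) :
    f ∈ spinOn := by
  rwa [show f = g from funext e]

theorem mul_self_of_abs_eq_one {a : ℝ} (h : |a| = 1) : a * a = 1 := by
  rw [← abs_mul_abs_self, h, one_mul]

/-- The submonoid `spinOn` is a group: the inverse of `uv`, with `u` and `v` of square `±1`, is `±
vu`. -/
theorem exists_inverse_of_mem_spinOn {g : Function.End Ev} (hg : g ∈ spinOn) :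
    ∃ h ∈ spinOn, (∀ φ, h (g φ) = φ) ∧ ∀ φ, g (h φ) = φ := by
  induction hg using Submonoid.closure_induction with
  | mem g hg =>
    obtain ⟨u, v, hu, hv, rfl⟩ := hg
    have hu' := mul_self_of_abs_eq_one hu
    have hv' := mul_self_of_abs_eq_one hv
    refine ⟨fun φ => cliffOd ((inner u u * inner v v) • v) (cliffEv u φ),
      Submonoid.subset_closure ⟨_, u, ?_, hu, rfl⟩, fun φ => ?_, fun φ => ?_⟩
    · rw [inner_smul_left, inner_smul_right, ← mul_assoc]
      simp only [abs_mul, hu, hv]; norm_num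
    · change cliffOd _ (cliffEv u (cliffOd u (cliffEv v φ))) = φ
      rw [cliffEv_cliffOd_self, cliffOd_smul_right, cliffOd_smul_left, cliffOd_cliffEv_self,
        smul_smul, smul_smul]
      rw [show inner u u * (inner u u * inner v v) * inner v v =
        (inner u u * inner u u) * (inner v v * inner v v) by ring, hu', hv', one_mul, one_smul]
    · change cliffOd u (cliffEv v (cliffOd _ (cliffEv u φ))) = φ
      rw [cliffOd_smul_left, cliffEv_smul_right, cliffEv_cliffOd_self, cliffOd_smul_right,
        cliffOd_smul_right, cliffOd_cliffEv_self, smul_smul, smul_smul]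
      rw [show inner u u * inner v v * inner v v * inner u u =
        (inner u u * inner u u) * (inner v v * inner v v) by ring, hu', hv', one_mul, one_smul]
  | one => exact ⟨1, one_mem _, fun _ => rfl, fun _ => rfl⟩
  | mul g h _ _ ihg ihh =>
    obtain ⟨g', hg', hg1, hg2⟩ := ihg
    obtain ⟨h', hh', hh1, hh2⟩ := ihh
    refine ⟨h' * g', mul_mem hh' hg', fun φ => ?_, fun φ => ?_⟩
    · change h' (g' (g (h φ))) = φ
      rw [hg1, hh1]
    · change g (h (h' (g' φ))) = φ
      rw [hh2, hg2]

/-- The product of two vectors that are not null lies in the spin group, once both are normalised.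
-/
theorem smul_cliff_mem_spinOn {u v : Gen} (hu : inner u u ≠ 0) (hv : inner v v ≠ 0) :
    (fun φ => (√|inner u u| * √|inner v v|)⁻¹ • cliffOd u (cliffEv v φ) : Function.End Ev) ∈
      spinOn := by
  have key : ∀ w : Gen, inner w w ≠ 0 →
      |inner ((√|inner w w|)⁻¹ • w) ((√|inner w w|)⁻¹ • w)| = 1 := by
    intro w hw
    rw [inner_smul_left, inner_smul_right, ← mul_assoc, ← mul_inv,
      Real.mul_self_sqrt (abs_nonneg _), abs_mul, abs_inv, abs_abs]
    exact inv_mul_cancel₀ (abs_ne_zero.2 hw)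
  refine Submonoid.subset_closure ⟨_, _, key u hu, key v hv, ?_⟩
  funext φ
  rw [cliffOd_smul_left, cliffEv_smul_left, cliffOd_smul_right, smul_smul, mul_inv]

/-- If `w` is not null, then `1 + wη = w (w / (w, w) + η)` is a product of two vectors. -/
theorem one_add_cliff_mem_spinOn_aux {w η : Gen} (hη : inner η η = 0) (hw : inner w η = 0)
    (hww : inner w w ≠ 0) :
    (fun φ => φ + cliffOd w (cliffEv η φ) : Function.End Ev) ∈ spinOn := by
  have hv : inner ((inner w w)⁻¹ • w + η) ((inner w w)⁻¹ • w + η) = (inner w w)⁻¹ := by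
    rw [inner_add_add_self, inner_smul_left, inner_smul_right, inner_smul_left, hw, hη]
    field_simp
    ring
  have h := smul_cliff_mem_spinOn hww (v := (inner w w)⁻¹ • w + η) (by rw [hv]; exact inv_ne_zero hww)
  refine mem_spinOn_congr h fun φ => ?_
  rw [hv, ← Real.sqrt_mul (abs_nonneg _), ← abs_mul, mul_inv_cancel₀ hww, abs_one, Real.sqrt_one,
    inv_one, one_smul, cliffEv_add_left, cliffOd_add_right, cliffEv_smul_left, cliffOd_smul_right,
    cliffOd_cliffEv_self, smul_smul, inv_mul_cancel₀ hww, one_smul]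

set_option maxRecDepth 4000 in
/-- The operator `1 + wη` lies in the spin group if `w` and `η` span an isotropic plane: writing
`w = (w/2 + z) + (w/2 - z)` with `z` null, orthogonal to `η` but not to `w`, it is the product of
two operators `1 + w'η = w'(w'/(w', w') + η)` with `w'` not null. -/
theorem one_add_cliff_mem_spinOn {w η z : Gen} (hη : inner η η = 0) (hw : inner w η = 0)
    (hww : inner w w = 0) (hz : inner z z = 0) (hzη : inner z η = 0) (hwz : inner w z ≠ 0) :
    (fun φ => φ + cliffOd w (cliffEv η φ) : Function.End Ev) ∈ spinOn := by
  have h1 := one_add_cliff_mem_spinOn_aux (w := (2⁻¹ : ℝ) • w + z) hη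
    (by rw [inner_add_left, inner_smul_left, hw, hzη]; ring)
    (by rw [inner_add_add_self, inner_smul_left, inner_smul_right, inner_smul_left, hww, hz]
        simpa using hwz)
  have h2 := one_add_cliff_mem_spinOn_aux (w := (2⁻¹ : ℝ) • w + (-1 : ℝ) • z) hη
    (by rw [inner_add_left, inner_smul_left, inner_smul_left, hw, hzη]; ring)
    (by rw [inner_add_add_self, inner_smul_left, inner_smul_right, inner_smul_left,
          inner_smul_left, inner_smul_right, inner_smul_right, hww, hz]
        simpa using hwz)
  have hηη : ∀ (a : Gen) (φ : Ev), inner a η = 0 → cliffEv η (cliffOd a (cliffEv η φ)) = 0 := by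
    intro a φ ha
    rw [cliffEv_cliffOd, cliffOd_cliffEv_self, hη, inner_comm, ha, cliffEv_smul_right]
    simp
  refine mem_spinOn_congr (mul_mem h1 h2) fun φ => ?_
  set w₁ := (2⁻¹ : ℝ) • w + z
  set w₂ := (2⁻¹ : ℝ) • w + (-1 : ℝ) • z with hw₂
  have hsum : w₁ + w₂ = w := by module
  have hw₂η : inner w₂ η = 0 := by
    rw [hw₂, inner_add_left, inner_smul_left, inner_smul_left, hw, hzη]; ring
  have h3 : cliffEv η (φ + cliffOd w₂ (cliffEv η φ)) = cliffEv η φ :=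
    (cliffEv_add_right η φ _).trans
      ((congrArg (cliffEv η φ + ·) (hηη _ φ hw₂η)).trans (add_zero _))
  have h4 := congrArg (fun t => φ + cliffOd w₂ (cliffEv η φ) + cliffOd w₁ t) h3
  refine Eq.trans ?_ h4.symm
  rw [← hsum, cliffOd_add_left]
  abel

theorem expB_add (B B' : Alt 2) (φ : Ev) : expB (B + B') φ = expB B (expB B' φ) := by
  refine Prod.ext rfl (Prod.ext ?_ ?_)
  · simp only [expB, wedge_add_left]
    abel
  · simp only [expB, wedge_add_left, wedge_zero_right, wedge_add_right, wedge_smul_right]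
    have : wedge B B' = wedge B' B := by
      ext v
      simp only [wedge22_apply]
      ring
    rw [this]
    module

theorem expB_zero (φ : Ev) : expB 0 φ = φ := by
  simp [expB]

/-- A two-form as a combination of products of coordinate covectors. -/
theorem alt2_eq_sum (B : Alt 2) :
    B = ∑ p : Fin 5 × Fin 5, (2⁻¹ * B ![stdE p.1, stdE p.2]) • wedge (stdDual p.1) (stdDual p.2) := by
  refine alt_ext_std fun v _ => ?_
  have e : (fun i => stdE (v i)) = ![stdE (v 0), stdE (v 1)] := by
    funext i; fin_cases i <;> rfl
  rw [e, ContinuousAlternatingMap.sum_apply, Fintype.sum_prod_type]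
  have : ∀ i j : Fin 5, ((2⁻¹ * B ![stdE i, stdE j]) • wedge (stdDual i) (stdDual j) : Alt 2)
      ![stdE (v 0), stdE (v 1)] = 2⁻¹ * B ![stdE i, stdE j] *
        ((if i = v 0 then 1 else 0) * (if j = v 1 then 1 else 0)) -
        2⁻¹ * B ![stdE i, stdE j] *
        ((if i = v 1 then 1 else 0) * (if j = v 0 then 1 else 0)) := by
    intro i j
    rw [ContinuousAlternatingMap.smul_apply, wedge11_apply]
    simp only [Matrix.cons_val_zero, Matrix.cons_val_one, pair_stdE_stdDual, smul_eq_mul]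
    ring
  simp only [this, Finset.sum_sub_distrib]
  simp
  rw [alt2_swap B (stdE (v 1))]
  ring

theorem wedge22_wedge11 (α β : Alt 1) (φ : Alt 2) :
    wedge (wedge α β) φ = wedge α (wedge β φ) := by
  ext v
  have h1 := wedge22_apply (wedge α β) φ v
  have h2 := wedge13_apply α (wedge β φ) v
  simp only [wedge11_apply, wedge12_apply] at h1 h2
  rw [h1]
  refine Eq.trans ?_ h2.symm
  simp
  ring

/-- The exponential series of a decomposable two-form `α ∧ β`, whose square is zero, stops after
the linear term. -/
theorem expB_wedge (α β : Alt 1) (φ : Ev) :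
    expB (wedge α β) φ = φ + cliffOd (0, α) (cliffEv (0, β) φ) := by
  rw [cliffEv_covector, cliffOd_covector]
  have h0 : wedge (wedge α β) (wedge α β) = 0 := by
    ext v
    have h1 := wedge22_apply (wedge α β) (wedge α β) v
    simp only [wedge11_apply] at h1
    rw [h1]
    refine Eq.trans ?_ (show (0 : ℝ) = (0 : Alt 4) v from rfl)
    simp
    ring
  refine Prod.ext ?_ (Prod.ext ?_ ?_)
  · simp [expB]
  · simp [expB, wedge_zero_right, wedge_smul_right]
  · simp [expB, wedge_zero_right, wedge_smul_right, h0, wedge22_wedge11]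

/-- `B`-field transformations lie in the spin group: `e^B` is a product of operators `1 + αβ` with
`α` and `β` multiples of coordinate covectors, which span isotropic planes. -/
theorem expB_mem_spinOn (B : Alt 2) : (expB B : Function.End Ev) ∈ spinOn := by
  have key : ∀ (i j : Fin 5) (t : ℝ),
      (expB (t • wedge (stdDual i) (stdDual j)) : Function.End Ev) ∈ spinOn := by
    intro i j t
    by_cases h : t = 0 ∨ i = j
    · have : t • wedge (stdDual i) (stdDual j) = 0 := by
        rcases h with rfl | rfl
        · simp
        · ext v
          have := wedge11_apply (stdDual i) (stdDual i) v
          simp only [ContinuousAlternatingMap.smul_apply]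
          rw [this, mul_comm, sub_self, smul_zero]; rfl
      rw [this]
      exact mem_spinOn_congr (one_mem _) expB_zero
    · push Not at h
      rw [← wedge_smul_left]
      -- the auxiliary null vector is the basis vector dual to the first covector
      have := one_add_cliff_mem_spinOn (w := (0, t • stdDual i)) (η := (0, stdDual j))
        (z := (stdE i, 0)) (by simp [inner]) (by simp [inner]) (by simp [inner]) (by simp [inner])
        (by simp [inner, pair_stdE_stdDual, h.2.symm])
        (by simp [inner, pair_smul_right, pair_stdE_stdDual, h.1])
      exact mem_spinOn_congr this (expB_wedge _ _)
  rw [alt2_eq_sum B]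
  induction (Finset.univ : Finset (Fin 5 × Fin 5)) using Finset.induction_on with
  | empty =>
    rw [Finset.sum_empty]
    exact mem_spinOn_congr (one_mem _) expB_zero
  | insert p s hp ih =>
    rw [Finset.sum_insert hp]
    exact mem_spinOn_congr (mul_mem (key p.1 p.2 (2⁻¹ * B ![stdE p.1, stdE p.2])) ih)
      (expB_add _ _)

/-! ### Linear changes of frame -/

/-- The pullback of a form under a linear endomorphism of the model space. -/
def pull {k : ℕ} (g : E5 →L[ℝ] E5) (α : Alt k) : Alt k := α.compContinuousLinearMap g

theorem pull_apply {k : ℕ} (g : E5 →L[ℝ] E5) (α : Alt k) (v : Fin k → E5) :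
    pull g α v = α (fun i => g (v i)) := rfl

theorem pull_pull {k : ℕ} (g h : E5 →L[ℝ] E5) (α : Alt k) :
    pull h (pull g α) = pull (g.comp h) α := rfl

theorem pull_id {k : ℕ} (α : Alt k) : pull (ContinuousLinearMap.id ℝ E5) α = α := rfl

theorem interior_pull {k : ℕ} (g : E5 →L[ℝ] E5) (X : E5) (α : Alt (k + 1)) :
    interior X (pull g α) = pull g (interior (g X) α) := by
  ext v
  rw [interior_apply, pull_apply, pull_apply, interior_apply]
  congr 1
  funext i
  refine Fin.cases ?_ (fun i => ?_) i <;> simp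

theorem pull_wedge {p q : ℕ} (g : E5 →L[ℝ] E5) (α : Alt p) (β : Alt q) :
    pull g (wedge α β) = wedge (pull g α) (pull g β) := by
  ext v
  rw [pull_apply, wedge_apply, wedge_apply]
  rfl

/-- The pullback of an even form under a linear endomorphism of the model space. -/
def pullEv (g : E5 →L[ℝ] E5) (φ : Ev) : Ev := (φ.1, pull g φ.2.1, pull g φ.2.2)

/-- The endomorphism `v ↦ v + ξ(v) X`. -/
def rankOne (X : E5) (ξ : Alt 1) : E5 →L[ℝ] E5 :=
  ContinuousLinearMap.id ℝ E5 + LinearMap.toContinuousLinearMap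
    (LinearMap.smulRight (⟨⟨fun X => pair X ξ, fun X Y => pair_add_left X Y ξ⟩,
        fun c X => pair_smul_left c X ξ⟩ : E5 →ₗ[ℝ] ℝ) X)

theorem rankOne_apply (X : E5) (ξ : Alt 1) (v : E5) : rankOne X ξ v = v + pair v ξ • X := rfl

/-- Since `ξ ∧ ξ = 0`, the pullback under `v ↦ v + ξ(v) X` is affine in `ξ`. -/
theorem pull_rankOne_zero (X : E5) (ξ : Alt 1) (φ : Alt 0) : pull (rankOne X ξ) φ = φ := by
  ext v
  rw [pull_apply]
  congr 1
  funext i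
  exact i.elim0

theorem pull_rankOne {k : ℕ} (X : E5) (ξ : Alt 1) (φ : Alt (k + 1)) :
    pull (rankOne X ξ) φ = φ + wedgeOne ξ (interior X φ) := by
  induction k with
  | zero =>
    refine alt_ext_interior fun v => ?_
    rw [interior_pull, pull_rankOne_zero, interior_add, interior_wedgeOne_zero, rankOne_apply,
      add_interior, smul_interior]
  | succ k ih =>
    refine alt_ext_interior fun v => ?_
    rw [interior_pull, ih, rankOne_apply, interior_add, interior_wedgeOne, add_interior,
      smul_interior, interior_add, interior_smul, interior_interior_self, smul_zero, add_zero,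
      interior_swap X v, ← neg_one_smul ℝ (interior v _), wedgeOne_smul]
    module

/-- Operators that are non-zero multiples of elements of the spin group. -/
def IsSpinScaled (f : Ev → Ev) : Prop :=
  ∃ k : ℝ, k ≠ 0 ∧ ∃ h ∈ spinOn, ∀ φ, f φ = k • h φ

theorem IsSpinScaled.comp {f g : Ev → Ev} (hf : IsSpinScaled f) (hg : IsSpinScaled g) :
    IsSpinScaled fun φ => f (g φ) := by
  obtain ⟨k, hk, a, ha, h1⟩ := hf
  obtain ⟨l, hl, b, hb, h2⟩ := hg
  refine ⟨k * l, mul_ne_zero hk hl, a * b, mul_mem ha hb, fun φ => ?_⟩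
  change f (g φ) = (k * l) • a (b φ)
  rw [h1, h2, (isLinearMap_of_mem_spinOn ha).map_smul, smul_smul]

theorem IsSpinScaled.congr {f g : Ev → Ev} (hf : IsSpinScaled f) (h : ∀ φ, g φ = f φ) :
    IsSpinScaled g := by
  rwa [show g = f from funext h]

/-- A rank one perturbation of the identity is, up to scale, the Clifford product of `X + ξ` and
`X + c ξ` for a suitable `c`. -/
theorem isSpinScaled_rankOne_aux {X : E5} {ξ : Alt 1} (h0 : pair X ξ ≠ 0) (h1 : 1 + pair X ξ ≠ 0) :
    IsSpinScaled (pullEv (rankOne X ξ)) := by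
  set s := pair X ξ with hs
  have hu : inner ((X, ξ) : Gen) (X, ξ) = s := inner_self _
  have hv : inner ((X, (1 + s)⁻¹ • ξ) : Gen) (X, (1 + s)⁻¹ • ξ) = (1 + s)⁻¹ * s := inner_self _
  have hc : (1 + s)⁻¹ * s ≠ 0 := mul_ne_zero (inv_ne_zero h1) h0
  have h := smul_cliff_mem_spinOn (u := (X, ξ)) (v := (X, (1 + s)⁻¹ • ξ)) (by rwa [hu]) (by rwa [hv])
  rw [hu, hv] at h
  have hk : √|s| * √|(1 + s)⁻¹ * s| ≠ 0 := by positivity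
  refine ⟨((1 + s)⁻¹ * s)⁻¹ * (√|s| * √|(1 + s)⁻¹ * s|), mul_ne_zero (inv_ne_zero hc) hk, _, h,
    fun φ => ?_⟩
  rw [smul_smul, mul_assoc, mul_inv_cancel₀ hk, mul_one, eq_inv_smul_iff₀ hc]
  have hw : ∀ (k : ℕ) (α : Alt k), wedgeOne ((1 + s)⁻¹ • ξ) α = (1 + s)⁻¹ • wedgeOne ξ α :=
    fun k α => LinearMap.map_smul₂ (wedgeOneL k) _ _ _
  rw [cliffOd_eq, cliffEv_eq]
  simp only [hw, pullEv, pull_rankOne]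
  have e : 1 - (1 + s)⁻¹ = (1 + s)⁻¹ * s := by field_simp; ring
  refine Prod.ext ?_ (Prod.ext ?_ ?_)
  · simp [interior_add, interior_interior_self, interior_smul, interior_wedgeOne_zero, smul_smul,
      ← hs]
  · simp only [interior_add, interior_interior_self, interior_smul, interior_wedgeOne,
      wedgeOne_add, wedgeOne_smul, wedgeOne_wedgeOne_self, ← hs, Prod.smul_snd, Prod.smul_fst]
    rw [← e]
    have : (1 - (1 + s)⁻¹) • φ.2.1 = ((1 + s)⁻¹ * s) • φ.2.1 := by rw [e]
    rw [smul_add, this]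
    module
  · simp only [interior_smul, interior_wedgeOne,
      wedgeOne_add, wedgeOne_smul, wedgeOne_wedgeOne_self, ← hs, Prod.smul_snd]
    rw [← e]
    have : (1 - (1 + s)⁻¹) • φ.2.2 = ((1 + s)⁻¹ * s) • φ.2.2 := by rw [e]
    rw [smul_add, this]
    module

theorem pullEv_pullEv (g h : E5 →L[ℝ] E5) (φ : Ev) :
    pullEv h (pullEv g φ) = pullEv (g.comp h) φ := rfl

theorem isSpinScaled_id : IsSpinScaled (pullEv (ContinuousLinearMap.id ℝ E5)) :=
  ⟨1, one_ne_zero, 1, one_mem _, fun φ => by rw [one_smul]; rfl⟩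

theorem isSpinScaled_rankOne {X : E5} {ξ : Alt 1} (h1 : 1 + pair X ξ ≠ 0) :
    IsSpinScaled (pullEv (rankOne X ξ)) := by
  by_cases h0 : pair X ξ = 0
  · by_cases hX : X = 0
    · refine isSpinScaled_id.congr fun φ => ?_
      have : rankOne X ξ = ContinuousLinearMap.id ℝ E5 := by
        ext1 v; rw [rankOne_apply, hX, smul_zero, add_zero]; rfl
      rw [this]
    -- a transvection is the product of two perturbations that are not
    obtain ⟨i, hi⟩ : ∃ i, X i ≠ 0 := by
      by_contra h
      push Not at h
      exact hX (by ext i; exact h i)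
    set η : Alt 1 := (X i)⁻¹ • stdDual i with hη
    have hηX : pair X η = 1 := by
      rw [hη, pair_smul_right, pair_stdDual, inv_mul_cancel₀ hi]
    have hξX : pair X (ξ + (-2⁻¹ : ℝ) • η) = -2⁻¹ := by
      rw [pair_add_right, pair_smul_right, h0, hηX]; ring
    have a1 := isSpinScaled_rankOne_aux (X := X) (ξ := ξ + (-2⁻¹ : ℝ) • η) (by rw [hξX]; norm_num)
      (by rw [hξX]; norm_num)
    have a2 := isSpinScaled_rankOne_aux (X := X) (ξ := η) (by rw [hηX]; norm_num)
      (by rw [hηX]; norm_num)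
    refine (a2.comp a1).congr fun φ => ?_
    rw [pullEv_pullEv]
    congr 1
    ext1 v
    simp only [ContinuousLinearMap.comp_apply, rankOne_apply, pair_add_left, pair_smul_left,
      pair_add_right, pair_smul_right, h0, hηX]
    module
  · exact isSpinScaled_rankOne_aux h0 h1

/-- The general linear group acts through non-zero multiples of elements of the spin group. -/
theorem isSpinScaled_pullEv_of_det_ne_zero (N : Matrix (Fin 5) (Fin 5) ℝ) (hN : N.det ≠ 0) :
    IsSpinScaled (pullEv (Matrix.toEuclideanCLM (𝕜 := ℝ) N)) := by
  have hmul : ∀ A B : Matrix (Fin 5) (Fin 5) ℝ,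
      IsSpinScaled (pullEv (Matrix.toEuclideanCLM (𝕜 := ℝ) A)) →
      IsSpinScaled (pullEv (Matrix.toEuclideanCLM (𝕜 := ℝ) B)) →
      IsSpinScaled (pullEv (Matrix.toEuclideanCLM (𝕜 := ℝ) (A * B))) := by
    intro A B hA hB
    refine (hB.comp hA).congr fun φ => ?_
    rw [pullEv_pullEv, map_mul]
    rfl
  have hone : ∀ (i j : Fin 5) (c : ℝ), (i = j → 1 + c ≠ 0) →
      IsSpinScaled (pullEv (Matrix.toEuclideanCLM (𝕜 := ℝ) (1 + Matrix.single i j c))) := by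
    intro i j c h
    refine (isSpinScaled_rankOne (X := stdE i) (ξ := c • stdDual j) ?_).congr fun φ => ?_
    · rw [pair_smul_right, pair_stdE_stdDual]
      split_ifs with hij
      · simpa using h hij.symm
      · simp
    · congr 1
      ext v k
      simp [rankOne_apply, pair_smul_right, pair_stdDual,
        Matrix.single_mulVec, stdE_apply, Function.update_apply]
  refine Matrix.diagonal_transvection_induction_of_det_ne_zero _ N hN (fun D hD => ?_)
    (fun t => ?_) (fun A B _ _ hA hB => hmul A B hA hB)
  · have hD' : ∀ i, D i ≠ 0 := by
      rw [Matrix.det_diagonal] at hD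
      exact fun i => Finset.prod_ne_zero_iff.1 hD i (Finset.mem_univ i)
    have key : ∀ s : Finset (Fin 5), IsSpinScaled (pullEv (Matrix.toEuclideanCLM (𝕜 := ℝ)
        (Matrix.diagonal fun i => if i ∈ s then D i else 1))) := by
      intro s
      induction s using Finset.induction_on with
      | empty =>
        refine isSpinScaled_id.congr fun φ => ?_
        have : (Matrix.diagonal fun i : Fin 5 => if i ∈ (∅ : Finset (Fin 5)) then D i else 1) =
            (1 : Matrix (Fin 5) (Fin 5) ℝ) := by simp
        rw [this, map_one]
        rfl
      | insert a s ha ih =>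
        have : (Matrix.diagonal fun i : Fin 5 => if i ∈ insert a s then D i else 1) =
            (1 + Matrix.single a a (D a - 1)) *
              Matrix.diagonal fun i : Fin 5 => if i ∈ s then D i else 1 := by
          have e : (1 + Matrix.single a a (D a - 1) : Matrix (Fin 5) (Fin 5) ℝ) =
              Matrix.diagonal fun i => if i = a then D a else 1 := by
            ext i j
            by_cases hij : i = j
            · subst hij
              by_cases hia : i = a
              · subst hia; simp
              · simp [hia, Ne.symm hia]
            · simp only [Matrix.add_apply, Matrix.one_apply_ne hij, Matrix.diagonal_apply_ne _ hij,
                Matrix.single_apply, zero_add]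
              rw [if_neg]
              rintro ⟨rfl, rfl⟩
              exact hij rfl
          rw [e, Matrix.diagonal_mul_diagonal]
          congr 1
          funext i
          by_cases hia : i = a
          · subst hia; simp [ha]
          · simp [hia]
        rw [this]
        exact hmul _ _ (hone a a _ fun _ => by simpa using hD' a) ih
    simpa using key Finset.univ
  · exact hone t.i t.j t.c fun h => absurd h t.hij

/-! ### The quartic on normal forms -/

theorem apply_stdE_ne_zero {μ : Alt 5} (hμ : μ ≠ 0) : μ stdE ≠ 0 :=
  fun h => hμ (alt5_ext (by rw [h]; rfl))

theorem coeff_self {μ : Alt 5} (hμ : μ ≠ 0) : coeff μ μ = 1 := div_self (apply_stdE_ne_zero hμ)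

theorem coeff_smul_self {μ : Alt 5} (hμ : μ ≠ 0) (α : Alt 5) : coeff μ α • μ = α :=
  alt5_ext (div_mul_cancel₀ _ (apply_stdE_ne_zero hμ))

/-- As `ξ ∧ μ` vanishes for degree reasons, contracting it with `Y` gives `ξ ∧ i_Y μ = ξ(Y) μ`. -/
theorem wedge_interior_volume (ξ : Alt 1) (Y : E5) (μ : Alt 5) :
    wedge ξ (interior Y μ) = pair Y ξ • μ := by
  have h := interior_wedgeOne Y ξ μ
  rw [alt_eq_zero_of_lt (by norm_num) (wedgeOne ξ μ), interior_zero] at h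
  rw [wedge14_eq]
  exact (sub_eq_zero.1 h.symm).symm

/-- The case of `mukai_cliffEv_symm` for a vector and forms of degrees two and four. -/
theorem wedge_interior_comm (X : E5) (Ω : Alt 2) (τ : Alt 4) :
    wedge (interior X τ) Ω = -wedge (interior X Ω) τ := by
  have h := mukai_cliffEv_symm (X, 0) (0, Ω, 0) (0, 0, τ)
  rw [cliffEv_vector, cliffEv_vector] at h
  simp [mukai] at h
  rw [h, neg_neg]

theorem val0_const (c : ℝ) : val0 (const c) = c := rfl

theorem const_val0 (φ : Alt 0) : const (val0 φ) = φ := by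
  ext v
  rw [Subsingleton.elim v ![]]
  rfl

/-- `Q(1 + i_Y μ) = 4 Y`. -/
theorem quadMap_one_add {μ : Alt 5} (hμ : μ ≠ 0) (Y : E5) :
    quadMap μ (const 1, 0, interior Y μ) = ((4 : ℝ) • Y, 0) := by
  refine inner_ext fun v => ?_
  rw [inner_quadMap]
  have : mukai (cliffEv v (const 1, 0, interior Y μ)) (const 1, 0, interior Y μ) =
      (2 * pair Y v.2) • μ := by
    simp only [mukai, cliffEv, wedge_zero_right, val0_const, interior_zero, wedge_zero,
      zero_add, sub_zero, one_smul, wedge_interior_volume]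
    module
  rw [this, coeff_smul, coeff_self hμ]
  simp only [inner, pair_smul_left, pair_zero_right]
  ring

theorem pair_interior (X Y : E5) (Ω : Alt 2) : pair Y (interior X Ω) = Ω ![X, Y] := rfl

/-- `f(Ω + i_{Y₁} μ, 1 + i_{Y₂} μ) = -8 Ω(Y₁, Y₂) μ²`: by `quadMap_one_add` it is four times `(Q(Ω
+ i_{Y₁} μ), Y₂)`. -/
theorem quartic_normalForm {μ : Alt 5} (hμ : μ ≠ 0) (Ω : Alt 2) (Y₁ Y₂ : E5) :
    quartic μ (normalForm Ω μ Y₁ Y₂) = -8 * Ω ![Y₁, Y₂] := by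
  change inner (quadMap μ (0, Ω, interior Y₁ μ)) (quadMap μ (const 1, 0, interior Y₂ μ)) = _
  rw [quadMap_one_add hμ, inner_quadMap, show (((4 : ℝ) • Y₂, 0) : Gen) = (4 : ℝ) • (Y₂, 0) by
    simp, cliffEv_smul_left, mukai_smul_left, coeff_smul, cliffEv_vector]
  have : mukai (interior Y₂ Ω, interior Y₂ (interior Y₁ μ), 0) (0, Ω, interior Y₁ μ) =
      (2 * Ω ![Y₂, Y₁]) • μ := by
    simp only [mukai, wedge_interior_comm, wedge_interior_volume, zero_wedge, pair_interior]
    module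
  rw [this, coeff_smul, coeff_self hμ, alt2_swap]
  ring

/-! ### Orbits -/

theorem matAct_matAct (A B : Matrix (Fin 2) (Fin 2) ℝ) (ρ : Fin 2 → Ev) :
    matAct A (matAct B ρ) = matAct (A * B) ρ := by
  funext i
  simp only [matAct, Fin.sum_univ_two, Matrix.mul_apply]
  module

theorem matAct_one (ρ : Fin 2 → Ev) : matAct 1 ρ = ρ := by
  funext i
  simp [matAct, Matrix.one_apply]

theorem matAct_map {g : Ev → Ev} (hg : IsLinearMap ℝ g) (A : Matrix (Fin 2) (Fin 2) ℝ)
    (ρ : Fin 2 → Ev) : matAct A (fun i => g (ρ i)) = fun i => g (matAct A ρ i) := by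
  funext i
  simp only [matAct, Fin.sum_univ_two, hg.map_add, hg.map_smul]

theorem mem_orbit_self (ρ : Fin 2 → Ev) : ρ ∈ orbit ρ :=
  ⟨1, one_mem _, 1, (matAct_one ρ).symm⟩

theorem mem_orbit_trans {ρ σ τ : Fin 2 → Ev} (h₁ : σ ∈ orbit ρ) (h₂ : τ ∈ orbit σ) :
    τ ∈ orbit ρ := by
  obtain ⟨g, hg, A, rfl⟩ := h₁
  obtain ⟨h, hh, B, rfl⟩ := h₂
  refine ⟨h * g, mul_mem hh hg, B * A, ?_⟩
  rw [← matAct_map (isLinearMap_of_mem_spinOn hh), matAct_matAct]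
  rfl

theorem mem_orbit_symm {ρ σ : Fin 2 → Ev} (h : σ ∈ orbit ρ) : ρ ∈ orbit σ := by
  obtain ⟨g, hg, A, rfl⟩ := h
  obtain ⟨g', hg', h₁, -⟩ := exists_inverse_of_mem_spinOn hg
  refine ⟨g', hg', A⁻¹, ?_⟩
  rw [matAct_map (isLinearMap_of_mem_spinOn hg')]
  simp only [matAct_map (isLinearMap_of_mem_spinOn hg), matAct_matAct, ← Units.val_mul,
    inv_mul_cancel, Units.val_one, matAct_one, h₁]

theorem spin_mem_orbit {g : Function.End Ev} (hg : g ∈ spinOn) (ρ : Fin 2 → Ev) :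
    (fun i => g (ρ i)) ∈ orbit ρ := ⟨g, hg, 1, (matAct_one _).symm⟩

theorem matAct_mem_orbit {A : Matrix (Fin 2) (Fin 2) ℝ} (hA : A.det ≠ 0) (ρ : Fin 2 → Ev) :
    matAct A ρ ∈ orbit ρ :=
  ⟨1, one_mem _, Matrix.GeneralLinearGroup.mkOfDetNeZero A hA, rfl⟩

/-- Scalars belong to `GL(2, ℝ)`, so that multiples of spin transformations preserve orbits. -/
theorem IsSpinScaled.mem_orbit {f : Ev → Ev} (hf : IsSpinScaled f) (ρ : Fin 2 → Ev) :
    (fun i => f (ρ i)) ∈ orbit ρ := by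
  obtain ⟨k, hk, g, hg, h⟩ := hf
  refine mem_orbit_trans (spin_mem_orbit hg ρ) ?_
  have : (fun i => f (ρ i)) = matAct (k • 1) fun i => g (ρ i) := by
    funext i
    simp [matAct, Matrix.one_apply, h, ite_smul]
  rw [this]
  exact matAct_mem_orbit (by simp [hk]) _

/-! ### Reduction to the standard element -/

theorem alt2_ext {α β : Alt 2} (h : ∀ i j, i < j → α ![stdE i, stdE j] = β ![stdE i, stdE j]) :
    α = β := by
  refine alt_ext_std fun v hv => ?_
  have e : (fun i => stdE (v i)) = ![stdE (v 0), stdE (v 1)] := by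
    funext i; fin_cases i <;> rfl
  rw [e]
  rcases lt_or_gt_of_ne (hv.ne (show (0 : Fin 2) ≠ 1 by decide)) with h' | h'
  · exact h _ _ h'
  · rw [alt2_swap α, alt2_swap β, h _ _ h']

/-- A frame adapted to a two-form that is non-zero on `(Y₁, Y₂)`: it begins with `Y₁, Y₂` and
continues with vectors in the common orthogonal complement. -/
theorem exists_frame {μ : Alt 5} (hμ : μ ≠ 0) {Ω : Alt 2} {Y₁ Y₂ : E5} (h : Ω ![Y₁, Y₂] ≠ 0) :
    ∃ b : Fin 5 → E5, b 0 = Y₁ ∧ b 1 = Y₂ ∧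
      (∀ j, 1 < j → Ω ![Y₁, b j] = 0 ∧ Ω ![Y₂, b j] = 0) ∧ μ b = μ stdE := by
  let L₁ : E5 →ₗ[ℝ] ℝ := ⟨⟨fun v => pair v (interior Y₁ Ω), fun _ _ => pair_add_left _ _ _⟩,
    fun _ _ => pair_smul_left _ _ _⟩
  let L₂ : E5 →ₗ[ℝ] ℝ := ⟨⟨fun v => pair v (interior Y₂ Ω), fun _ _ => pair_add_left _ _ _⟩,
    fun _ _ => pair_smul_left _ _ _⟩
  have l11 : L₁ Y₁ = 0 := alt2_zero _ _
  have l12 : L₁ Y₂ = Ω ![Y₁, Y₂] := rfl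
  have l21 : L₂ Y₁ = -Ω ![Y₁, Y₂] := alt2_swap _ _ _
  have l22 : L₂ Y₂ = 0 := alt2_zero _ _
  let L := L₁.prod L₂
  have hL : Function.Surjective L := by
    rintro ⟨a, c⟩
    refine ⟨(a / Ω ![Y₁, Y₂]) • Y₂ + (-c / Ω ![Y₁, Y₂]) • Y₁, ?_⟩
    simp only [L, map_add, map_smul, LinearMap.prod_apply, Function.prod_apply, l11, l12, l21, l22]
    ext <;> simp <;> field_simp
  have hdim : Module.finrank ℝ (LinearMap.ker L) = 3 := by
    have := LinearMap.finrank_range_add_finrank_ker L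
    rw [LinearMap.range_eq_top.2 hL, finrank_top] at this
    simp at this
    omega
  let w := Module.finBasisOfFinrankEq ℝ (LinearMap.ker L) hdim
  have hw : ∀ j, L₁ (w j) = 0 ∧ L₂ (w j) = 0 := by
    intro j
    have := (w j).2
    rw [LinearMap.mem_ker] at this
    exact ⟨congrArg Prod.fst this, congrArg Prod.snd this⟩
  let b : Fin 5 → E5 := ![Y₁, Y₂, w 0, w 1, w 2]
  have hb : LinearIndependent ℝ b := by
    rw [Fintype.linearIndependent_iff]
    intro g hg
    simp only [Fin.sum_univ_five, b] at hg
    simp at hg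
    have h1 := congrArg L₁ hg
    have h2 := congrArg L₂ hg
    simp only [map_add, map_smul, l11, l12, l21, l22, (hw _).1, (hw _).2, map_zero, smul_eq_mul,
      mul_zero, zero_add, add_zero, mul_neg, neg_eq_zero, mul_eq_zero, h, or_false] at h1 h2
    rw [h1, h2] at hg
    have h3 : ∑ i, (![g 2, g 3, g 4] : Fin 3 → ℝ) i • w i = 0 := by
      apply Subtype.ext
      simpa [Fin.sum_univ_three] using hg
    have h4 := Fintype.linearIndependent_iff.1 w.linearIndependent _ h3
    intro i
    fin_cases i
    exacts [h2, h1, h4 0, h4 1, h4 2]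
  have hμb : μ b ≠ 0 := by
    have e : (basisOfLinearIndependentOfCardEqFinrank hb (by simp) : Fin 5 → E5) = b := by simp
    rw [← e]
    refine (AlternatingMap.map_basis_ne_zero_iff _ μ.toAlternatingMap).2 fun h0 => hμ ?_
    ext v
    exact congrArg (fun γ => γ v) h0
  -- rescaling one vector of the complement adjusts the volume of the frame
  refine ⟨Function.update b 2 ((μ stdE / μ b) • b 2), rfl, rfl, fun j hj => ?_, ?_⟩
  · fin_cases j
    · simp at hj
    · simp at hj
    · have h1 := L₁.map_smul (μ stdE / μ b) (w 0)
      have h2 := L₂.map_smul (μ stdE / μ b) (w 0)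
      rw [(hw 0).1, smul_zero] at h1
      rw [(hw 0).2, smul_zero] at h2
      exact ⟨h1, h2⟩
    · exact hw 1
    · exact hw 2
  · rw [μ.map_update_smul, Function.update_eq_self, smul_eq_mul, div_mul_cancel₀ _ hμb]

/-- A frame of the same volume as the standard one is its image under a linear map, whose pullback
is a multiple of a spin transformation. -/
theorem exists_pull {μ : Alt 5} (hμ : μ ≠ 0) {b : Fin 5 → E5} (hb : μ b = μ stdE) :
    ∃ g : E5 →L[ℝ] E5, (∀ i, g (stdE i) = b i) ∧ IsSpinScaled (pullEv g) := by
  let N : Matrix (Fin 5) (Fin 5) ℝ := Matrix.of fun i j => b j i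
  have hN : ∀ v : Fin 5 → ℝ, N.mulVec v = ∑ j, v j • (b j : Fin 5 → ℝ) := by
    intro v
    ext i
    simp [N, Matrix.mulVec, dotProduct, mul_comm]
  refine ⟨Matrix.toEuclideanCLM (𝕜 := ℝ) N, fun i => ?_, isSpinScaled_pullEv_of_det_ne_zero N ?_⟩
  · ext k
    simp [stdE, N]
  · intro h0
    obtain ⟨v, hv, hv'⟩ := Matrix.exists_mulVec_eq_zero_iff.2 h0
    rw [hN] at hv'
    refine apply_stdE_ne_zero hμ ?_
    rw [← hb]
    refine μ.toAlternatingMap.map_linearDependent b fun hli => hv ?_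
    have := Fintype.linearIndependent_iff.1 hli v (by
      ext i
      simpa using congrFun hv' i)
    exact funext this

theorem alt5_swap (α : Alt 5) (w : Fin 5 → E5) (i j : Fin 5) (hij : i ≠ j) :
    α (w ∘ Equiv.swap i j) = -α w := alt_swap α _ _ i j hij rfl

/-- The standard representative of the open orbits: the normal form with `Y₁, Y₂` the first two
coordinate vectors and `Ω` a multiple of the product of the first two coordinate covectors. -/
def standard (μ : Alt 5) (a : ℝ) : Fin 2 → Ev :=
  normalForm (a • wedge (stdDual 0) (stdDual 1)) μ (stdE 0) (stdE 1)

/-- The action of a bivector `w ∧ e₁` removes the part of `Ω` in directions complementary to the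
first two coordinate vectors. -/
theorem standard_mem_orbit_of_adapted {μ : Alt 5} (hμ : μ ≠ 0) {Ω : Alt 2}
    (h : ∀ j, 1 < j → Ω ![stdE 0, stdE j] = 0 ∧ Ω ![stdE 1, stdE j] = 0) :
    standard μ (Ω ![stdE 0, stdE 1]) ∈ orbit (normalForm Ω μ (stdE 0) (stdE 1)) := by
  have hm := apply_stdE_ne_zero hμ
  -- `w` is chosen so that `i_w i_{e₁} i_{e₀} μ` cancels the part of `Ω` in the last three
  -- directions; `ξ` has the same coefficients, which makes `ξ(w)` a sum of squares
  set w : E5 := (-Ω ![stdE 3, stdE 4] / μ stdE) • stdE 2 + (Ω ![stdE 2, stdE 4] / μ stdE) • stdE 3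
    + (-Ω ![stdE 2, stdE 3] / μ stdE) • stdE 4 with hw
  set ξ : Alt 1 := (-Ω ![stdE 3, stdE 4] / μ stdE) • stdDual 2
    + (Ω ![stdE 2, stdE 4] / μ stdE) • stdDual 3
    + (-Ω ![stdE 2, stdE 3] / μ stdE) • stdDual 4 with hξ
  have hwξ : pair w ξ = (Ω ![stdE 3, stdE 4] / μ stdE) ^ 2 + (Ω ![stdE 2, stdE 4] / μ stdE) ^ 2
      + (Ω ![stdE 2, stdE 3] / μ stdE) ^ 2 := by
    simp [hw, hξ, pair_add_left, pair_add_right, pair_smul_left, pair_smul_right,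
      pair_stdE_stdDual]
    ring
  have key : interior w (interior (stdE 1) (interior (stdE 0) μ)) =
      Ω ![stdE 0, stdE 1] • wedge (stdDual 0) (stdDual 1) - Ω := by
    have e : ∀ k l m : Fin 5, interior (stdE k) (interior (stdE 1) (interior (stdE 0) μ))
        ![stdE l, stdE m] = μ (stdE ∘ ![0, 1, k, l, m]) := by
      intro k l m
      simp only [interior_apply]
      congr 1
      funext i; fin_cases i <;> rfl
    have hz : ∀ f : Fin 5 → Fin 5, ∀ i j, i ≠ j → f i = f j → μ (stdE ∘ f) = 0 :=
      fun f i j hij hf => μ.map_eq_zero_of_eq _ (i := i) (j := j) (congrArg stdE hf) hij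
    have h234 : μ (stdE ∘ ![0, 1, 2, 3, 4]) = μ stdE := by
      congr 1; funext i; fin_cases i <;> rfl
    have h324 : μ (stdE ∘ ![0, 1, 3, 2, 4]) = -μ stdE := by
      rw [← alt5_swap μ _ 2 3 (by decide)]
      congr 1; funext i; fin_cases i <;> rfl
    have h423 : μ (stdE ∘ ![0, 1, 4, 2, 3]) = μ stdE := by
      have := alt5_swap μ (stdE ∘ ![0, 1, 3, 2, 4]) 2 4 (by decide)
      rw [h324, neg_neg] at this
      rw [← this]
      congr 1; funext i; fin_cases i <;> rfl
    refine alt2_ext fun i j hij => ?_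
    have hexp : interior w (interior (stdE 1) (interior (stdE 0) μ)) ![stdE i, stdE j] =
        (-Ω ![stdE 3, stdE 4] / μ stdE) * μ (stdE ∘ ![0, 1, 2, i, j]) +
        (Ω ![stdE 2, stdE 4] / μ stdE) * μ (stdE ∘ ![0, 1, 3, i, j]) +
        (-Ω ![stdE 2, stdE 3] / μ stdE) * μ (stdE ∘ ![0, 1, 4, i, j]) := by
      rw [← e, ← e, ← e, hw, add_interior, add_interior, smul_interior, smul_interior,
        smul_interior]
      rfl
    have hrhs : (Ω ![stdE 0, stdE 1] • wedge (stdDual 0) (stdDual 1) - Ω : Alt 2)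
        ![stdE i, stdE j] = Ω ![stdE 0, stdE 1] * ((if 0 = i then 1 else 0) *
          (if 1 = j then 1 else 0) - (if 0 = j then 1 else 0) * (if 1 = i then 1 else 0)) -
          Ω ![stdE i, stdE j] := by
      have := wedge11_apply (stdDual 0) (stdDual 1) ![stdE i, stdE j]
      simp only [Matrix.cons_val_zero, Matrix.cons_val_one, pair_stdE_stdDual] at this
      rw [ContinuousAlternatingMap.sub_apply, ContinuousAlternatingMap.smul_apply, this,
        smul_eq_mul]
    rw [hexp, hrhs]
    have hj0 : j ≠ 0 := fun h => by subst h; exact absurd hij (Fin.not_lt_zero _)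
    rcases (show ∀ i j : Fin 5, i < j →
      i = 0 ∨ i = 1 ∨ (i = 2 ∧ j = 3) ∨ (i = 2 ∧ j = 4) ∨ (i = 3 ∧ j = 4) by decide) i j hij
      with rfl | rfl | ⟨rfl, rfl⟩ | ⟨rfl, rfl⟩ | ⟨rfl, rfl⟩
    · rw [hz ![0, 1, 2, 0, j] 0 3 (by decide) rfl, hz ![0, 1, 3, 0, j] 0 3 (by decide) rfl,
        hz ![0, 1, 4, 0, j] 0 3 (by decide) rfl]
      by_cases hj1 : j = 1
      · subst hj1; simp
      · have := (h j (by omega)).1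
        simp [this, Ne.symm hj1]
    · rw [hz ![0, 1, 2, 1, j] 1 3 (by decide) rfl, hz ![0, 1, 3, 1, j] 1 3 (by decide) rfl,
        hz ![0, 1, 4, 1, j] 1 3 (by decide) rfl]
      simp [(h j hij).2, hj0.symm]
    · rw [hz ![0, 1, 2, 2, 3] 2 3 (by decide) rfl, hz ![0, 1, 3, 2, 3] 2 4 (by decide) rfl, h423]
      simp
      field_simp
    · rw [hz ![0, 1, 2, 2, 4] 2 3 (by decide) rfl, hz ![0, 1, 4, 2, 4] 2 4 (by decide) rfl, h324]
      simp
      field_simp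
    · rw [hz ![0, 1, 3, 3, 4] 2 3 (by decide) rfl, hz ![0, 1, 4, 3, 4] 2 4 (by decide) rfl, h234]
      simp
      field_simp
  by_cases hw0 : pair w ξ = 0
  · have hw' : w = 0 := by
      rw [hwξ] at hw0
      have s1 := sq_nonneg (Ω ![stdE 3, stdE 4] / μ stdE)
      have s2 := sq_nonneg (Ω ![stdE 2, stdE 4] / μ stdE)
      have s3 := sq_nonneg (Ω ![stdE 2, stdE 3] / μ stdE)
      have h1 : Ω ![stdE 3, stdE 4] / μ stdE = 0 := pow_eq_zero_iff two_ne_zero |>.1 (by linarith)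
      have h2 : Ω ![stdE 2, stdE 4] / μ stdE = 0 := pow_eq_zero_iff two_ne_zero |>.1 (by linarith)
      have h3 : Ω ![stdE 2, stdE 3] / μ stdE = 0 := pow_eq_zero_iff two_ne_zero |>.1 (by linarith)
      rw [hw, neg_div, neg_div, h1, h2, h3]
      simp
    rw [hw', zero_interior, eq_comm, sub_eq_zero] at key
    rw [standard, key]
    exact mem_orbit_self _
  · have := spin_mem_orbit (one_add_cliff_mem_spinOn (w := (w, 0)) (η := (stdE 1, 0))
      (z := (0, ξ)) (by simp [inner]) (by simp [inner]) (by simp [inner]) (by simp [inner])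
      (by simp [inner, hξ, pair_add_right, pair_smul_right, pair_stdE_stdDual])
      (by simpa [inner] using hw0)) (normalForm Ω μ (stdE 0) (stdE 1))
    convert this using 1
    have hwΩ : interior w (interior (stdE 1) Ω) = 0 := by
      ext v
      rw [Subsingleton.elim v ![]]
      change pair w (interior (stdE 1) Ω) = 0
      rw [hw, pair_add_left, pair_add_left, pair_smul_left, pair_smul_left, pair_smul_left,
        pair_interior, pair_interior, pair_interior, (h 2 (by decide)).2,
        (h 3 (by decide)).2, (h 4 (by decide)).2]
      ring
    funext i
    rw [cliffEv_vector, cliffOd_vector]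
    fin_cases i
    · simp [standard, normalForm, hwΩ, key]
    · simp [standard, normalForm, interior_interior_self]

theorem pullEv_normalForm {μ : Alt 5} {g : E5 →L[ℝ] E5} (hg : pull g μ = μ) (Ω : Alt 2) (X₁ X₂ : E5)
    (i : Fin 2) :
    pullEv g (normalForm Ω μ (g X₁) (g X₂) i) = normalForm (pull g Ω) μ X₁ X₂ i := by
  fin_cases i
  · change (0, pull g Ω, pull g (interior (g X₁) μ)) = (0, pull g Ω, interior X₁ μ)
    rw [← interior_pull, hg]
  · change (const 1, pull g 0, pull g (interior (g X₂) μ)) = (const 1, 0, interior X₂ μ)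
    rw [← interior_pull, hg]
    rfl

/-- Every normal form with `Ω(Y₁, Y₂) ≠ 0` lies in the orbit of a standard element: a change of
frame adapts `Ω` to the coordinates, and a bivector removes its remaining components. -/
theorem standard_mem_orbit_normalForm {μ : Alt 5} (hμ : μ ≠ 0) {Ω : Alt 2} {Y₁ Y₂ : E5}
    (h : Ω ![Y₁, Y₂] ≠ 0) : standard μ (Ω ![Y₁, Y₂]) ∈ orbit (normalForm Ω μ Y₁ Y₂) := by
  obtain ⟨b, rfl, rfl, hb, hbμ⟩ := exists_frame hμ h
  obtain ⟨g, hg, hgs⟩ := exists_pull hμ hbμ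
  have e : ∀ i j, pull g Ω ![stdE i, stdE j] = Ω ![b i, b j] := by
    intro i j
    rw [pull_apply]
    congr 1
    funext k
    fin_cases k
    exacts [hg i, hg j]
  have h1 := hgs.mem_orbit (normalForm Ω μ (b 0) (b 1))
  have hgμ : pull g μ = μ := alt5_ext (by rw [pull_apply, ← hbμ]; simp only [hg])
  have h2 : (fun i => pullEv g (normalForm Ω μ (b 0) (b 1) i)) =
      normalForm (pull g Ω) μ (stdE 0) (stdE 1) := by
    funext i
    rw [← hg, ← hg, pullEv_normalForm hgμ]
  rw [h2] at h1
  refine mem_orbit_trans h1 ?_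
  rw [← e]
  exact standard_mem_orbit_of_adapted hμ fun j hj => by rw [e, e]; exact hb j hj

/-- The vector `Z` with `i_Z μ = τ`. -/
def vecOf (μ : Alt 5) (τ : Alt 4) : E5 := ∑ i, coeff μ (wedge (stdDual i) τ) • stdE i

/-- A form of degree four is determined by its products with the coordinate covectors. -/
theorem alt4_eq_zero {α : Alt 4} (h : ∀ i, wedge (stdDual i) α = 0) : α = 0 := by
  refine alt_ext_std fun v _ => ?_
  obtain ⟨m, hm⟩ : ∃ m, ∀ i, v i ≠ m := by
    by_contra hc
    push Not at hc
    have := Fintype.card_le_of_surjective v hc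
    simp at this
  have h1 := interior_wedgeOne (stdE m) (stdDual m) α
  rw [← wedge14_eq, h m] at h1
  have h2 := congrArg (fun γ : Alt 4 => γ fun i => stdE (v i)) h1
  simp only [ContinuousAlternatingMap.sub_apply, wedgeOne_apply, pair_stdE_stdDual,
    ContinuousAlternatingMap.smul_apply] at h2
  simp only [(hm _).symm, if_false, if_true, one_smul, zero_mul, mul_zero, Finset.sum_const_zero,
    sub_zero] at h2
  exact h2.symm

theorem interior_vecOf {μ : Alt 5} (hμ : μ ≠ 0) (τ : Alt 4) : interior (vecOf μ τ) μ = τ := by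
  refine sub_eq_zero.1 (alt4_eq_zero fun i => ?_)
  have : vecOf μ τ i = coeff μ (wedge (stdDual i) τ) :=
    sum_smul_stdE_apply (fun i => coeff μ (wedge (stdDual i) τ)) i
  refine (map_sub (wedgeL 1 4 (stdDual i)) _ _).trans (sub_eq_zero.2 ?_)
  rw [wedgeL_apply, wedge_interior_volume, pair_stdDual, this]
  exact coeff_smul_self hμ _

/-- Contraction of a volume form determines the vector. -/
theorem eq_of_interior_eq {μ : Alt 5} (hμ : μ ≠ 0) {X Y : E5} (h : interior X μ = interior Y μ) :
    X = Y := by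
  ext i
  have h1 := wedge_interior_volume (stdDual i) X μ
  rw [h, wedge_interior_volume] at h1
  have h2 := congrArg (coeff μ) h1
  rw [coeff_smul, coeff_smul, coeff_self hμ, mul_one, mul_one, pair_stdDual, pair_stdDual] at h2
  exact h2.symm

/-- A pair of even forms with degree-zero parts `0` and `1` is carried to a normal form by the
`B`-field transformation that removes the two-form part of the second one. -/
theorem expB_eq_normalForm {μ : Alt 5} (hμ : μ ≠ 0) {τ : Fin 2 → Ev} (h0 : (τ 0).1 = 0)
    (h1 : (τ 1).1 = const 1) (i : Fin 2) :
    expB ((-1 : ℝ) • (τ 1).2.1) (τ i) = normalForm (τ 0).2.1 μ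
      (vecOf μ (expB ((-1 : ℝ) • (τ 1).2.1) (τ 0)).2.2)
      (vecOf μ (expB ((-1 : ℝ) • (τ 1).2.1) (τ 1)).2.2) i := by
  have e0 := interior_vecOf hμ (expB ((-1 : ℝ) • (τ 1).2.1) (τ 0)).2.2
  have e1 := interior_vecOf hμ (expB ((-1 : ℝ) • (τ 1).2.1) (τ 1)).2.2
  fin_cases i
  · refine Prod.ext h0 (Prod.ext ?_ e0.symm)
    change (τ 0).2.1 + wedge _ (τ 0).1 = (τ 0).2.1
    rw [h0, wedge_zero, add_zero]
  · refine Prod.ext h1 (Prod.ext ?_ e1.symm)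
    change (τ 1).2.1 + wedge _ (τ 1).1 = 0
    rw [h1, wedge_zero_right, val0_const, one_smul]
    exact (congrArg _ (neg_one_smul ℝ _)).trans (add_neg_cancel _)

/-- A matrix of given determinant carrying a given non-zero vector to the second basis vector. -/
theorem exists_matrix_normalizing {c : Fin 2 → ℝ} (hc : ∃ i, c i ≠ 0) (s : ℝ) :
    ∃ A : Matrix (Fin 2) (Fin 2) ℝ, A.det = s ∧ A 0 0 * c 0 + A 0 1 * c 1 = 0 ∧
      A 1 0 * c 0 + A 1 1 * c 1 = 1 := by
  have hn : c 0 ^ 2 + c 1 ^ 2 ≠ 0 := by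
    obtain ⟨i, hi⟩ := hc
    fin_cases i
    · have : 0 < c 0 ^ 2 := by positivity
      positivity
    · have : 0 < c 1 ^ 2 := by positivity
      positivity
  refine ⟨!![s * c 1, -s * c 0; c 0 / (c 0 ^ 2 + c 1 ^ 2), c 1 / (c 0 ^ 2 + c 1 ^ 2)], ?_, ?_, ?_⟩
  · rw [Matrix.det_fin_two_of]
    field_simp
    ring
  · simp
    ring
  · simp
    field_simp

theorem matAct_fst (A : Matrix (Fin 2) (Fin 2) ℝ) (ρ : Fin 2 → Ev) (i : Fin 2) :
    (matAct A ρ i).1 = const (A i 0 * val0 (ρ 0).1 + A i 1 * val0 (ρ 1).1) := by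
  ext v
  rw [Subsingleton.elim v ![]]
  simp [matAct, Fin.sum_univ_two, const, val0]

theorem val0_ne_zero {φ : Alt 0} : val0 φ ≠ 0 ↔ φ ≠ 0 := by
  rw [not_iff_not]
  constructor
  · intro h; rw [← const_val0 φ, h]; rfl
  · rintro rfl; rfl

theorem const_zero : const 0 = 0 := rfl

theorem quartic_expB (μ : Alt 5) (B : Alt 2) (ρ : Fin 2 → Ev) :
    quartic μ (fun i => expB B (ρ i)) = quartic μ ρ := quartic_spin μ (expB_mem_spinOn B) ρ

/-- Transitivity: a pair of even forms with non-zero degree-zero part at which the quartic has the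
sign `ε` lies in the orbit of a standard element. -/
theorem standard_mem_orbit {μ : Alt 5} (hμ : μ ≠ 0) {ε : ℝ} (hε : ε = 1 ∨ ε = -1)
    {τ : Fin 2 → Ev} (hτ : ∃ i, (τ i).1 ≠ 0) (hq : 0 < ε * quartic μ τ) :
    standard μ (-ε / 8) ∈ orbit τ := by
  have hq0 : quartic μ τ ≠ 0 := fun h => by simp [h] at hq
  obtain ⟨A, hdet, hA0, hA1⟩ := exists_matrix_normalizing (c := fun i => val0 (τ i).1)
    (by simpa only [val0_ne_zero] using hτ) (√|quartic μ τ|)⁻¹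
  have hs : 0 < √|quartic μ τ| := Real.sqrt_pos.2 (abs_pos.2 hq0)
  set σ := matAct A τ with hσ
  have h0 : (σ 0).1 = 0 := by rw [hσ, matAct_fst, hA0, const_zero]
  have h1 : (σ 1).1 = const 1 := by rw [hσ, matAct_fst, hA1]
  have hσq : quartic μ σ = ε := by
    rw [hσ, quartic_matAct, hdet, inv_pow, Real.sq_sqrt (abs_nonneg _), inv_mul_eq_div,
      div_eq_iff (abs_ne_zero.2 hq0)]
    rcases hε with rfl | rfl
    · rw [abs_of_pos (by linarith)]; ring
    · rw [abs_of_neg (by linarith)]; ring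
  have hσo : σ ∈ orbit τ := matAct_mem_orbit (by rw [hdet]; exact inv_ne_zero hs.ne') τ
  have hn := funext (expB_eq_normalForm hμ h0 h1)
  have hno := spin_mem_orbit (expB_mem_spinOn ((-1 : ℝ) • (σ 1).2.1)) σ
  have hnq := quartic_expB μ ((-1 : ℝ) • (σ 1).2.1) σ
  rw [hn] at hno hnq
  rw [quartic_normalForm hμ, hσq] at hnq
  have hv : -ε / 8 = (σ 0).2.1 ![(vecOf μ (expB ((-1 : ℝ) • (σ 1).2.1) (σ 0)).2.2),
      (vecOf μ (expB ((-1 : ℝ) • (σ 1).2.1) (σ 1)).2.2)] := by linarith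
  rw [hv]
  refine mem_orbit_trans hσo (mem_orbit_trans hno (standard_mem_orbit_normalForm hμ ?_))
  rw [← hv]
  rcases hε with rfl | rfl <;> norm_num

/-- The group acts transitively on the pairs with non-zero degree-zero part and quartic of a given
sign. -/
theorem mem_orbit_of_sign {μ : Alt 5} (hμ : μ ≠ 0) {ε : ℝ} (hε : ε = 1 ∨ ε = -1)
    {ρ τ : Fin 2 → Ev} (hρ : ∃ i, (ρ i).1 ≠ 0) (hρq : 0 < ε * quartic μ ρ)
    (hτ : ∃ i, (τ i).1 ≠ 0) (hτq : 0 < ε * quartic μ τ) : τ ∈ orbit ρ :=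
  mem_orbit_trans (standard_mem_orbit hμ hε hρ hρq) (mem_orbit_symm (standard_mem_orbit hμ hε hτ hτq))

/-! ### Topology of the space of pairs -/

instance finiteDimensional_alt (k : ℕ) : FiniteDimensional ℝ (Alt k) := by
  let L : Alt k →ₗ[ℝ] ((Fin k → Fin 5) → ℝ) :=
    ⟨⟨fun α v => α fun i => stdE (v i), fun _ _ => rfl⟩, fun _ _ => rfl⟩
  exact FiniteDimensional.of_injective L fun α β h => alt_ext_std fun v _ => congrFun h v

/-- The bilinear form `(φ, φ') ↦ ⟨v · φ, φ'⟩`, in units of `μ`. -/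
def cliffPairing (μ : Alt 5) (v : Gen) : Ev →ₗ[ℝ] Ev →ₗ[ℝ] ℝ :=
  LinearMap.mk₂ ℝ (fun φ φ' => coeff μ (mukai (cliffEv v φ) φ'))
    (fun a b c => by simp only [cliffEv_add_right, mukai_add_left, coeff_add])
    (fun a b c => by simp only [cliffEv_smul_right, mukai_smul_left, coeff_smul, smul_eq_mul])
    (fun a b c => by simp only [mukai_add_right, coeff_add])
    (fun a b c => by simp only [mukai_smul_right, coeff_smul, smul_eq_mul])

theorem continuous_bilinear_self (L : Ev →ₗ[ℝ] Ev →ₗ[ℝ] ℝ) : Continuous fun φ => L φ φ := by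
  have h : Continuous fun φ => L.toContinuousBilinearMap φ φ := by fun_prop
  exact h

theorem continuous_quartic (μ : Alt 5) : Continuous (quartic μ) := by
  have h1 : ∀ v : Gen, Continuous fun φ : Ev => coeff μ (mukai (cliffEv v φ) φ) := by
    intro v
    exact continuous_bilinear_self (cliffPairing μ v)
  have h2 : Continuous (quadMap μ) := by
    unfold quadMap
    refine Continuous.prodMk (continuous_finsetSum _ fun i _ => ?_)
      (continuous_finsetSum _ fun i _ => ?_)
    · exact (continuous_const.mul (h1 _)).smul continuous_const
    · exact (continuous_const.mul (h1 _)).smul continuous_const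
  have h3 : ∀ i : Fin 2, Continuous fun ρ : Fin 2 → Ev => quadMap μ (ρ i) :=
    fun i => h2.comp (continuous_apply i)
  have h4 : Continuous fun ρ : Fin 2 → Ev =>
      innerL.toContinuousBilinearMap (quadMap μ (ρ 0)) (quadMap μ (ρ 1)) := by
    have := h3 0
    have := h3 1
    fun_prop
  exact h4

theorem continuous_spin_matAct {g : Function.End Ev} (hg : g ∈ spinOn)
    (A : Matrix (Fin 2) (Fin 2) ℝ) :
    Continuous fun ρ : Fin 2 → Ev => matAct A fun i => g (ρ i) := by
  have hgc : Continuous g :=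
    (isLinearMap_of_mem_spinOn hg).mk'.continuous_of_finiteDimensional
  have h : ∀ j : Fin 2, Continuous fun ρ : Fin 2 → Ev => g (ρ j) :=
    fun j => hgc.comp (continuous_apply j)
  exact continuous_pi fun i => continuous_finsetSum _ fun j _ => (h j).const_smul (A i j)

/-- Orbits of pairs of non-zero degree-zero part and non-zero quartic are open. -/
theorem inOpenOrbit_of_sign {μ : Alt 5} (hμ : μ ≠ 0) {ε : ℝ} (hε : ε = 1 ∨ ε = -1)
    {ρ : Fin 2 → Ev} (hρ : ∃ i, (ρ i).1 ≠ 0) (hρq : 0 < ε * quartic μ ρ) : InOpenOrbit ρ := by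
  -- an element of the orbit need not have a degree-zero part, but a group element carries a
  -- neighbourhood of it into the open set `U`, which is contained in the orbit
  let U : Set (Fin 2 → Ev) := {τ | (∃ i, (τ i).1 ≠ 0) ∧ 0 < ε * quartic μ τ}
  have hU : IsOpen U := by
    have h1 : IsOpen {τ : Fin 2 → Ev | ∃ i, (τ i).1 ≠ 0} := by
      rw [show {τ : Fin 2 → Ev | ∃ i, (τ i).1 ≠ 0} = ⋃ i, {τ | (τ i).1 ≠ 0} by ext; simp]
      exact isOpen_iUnion fun i =>
        isOpen_ne.preimage (continuous_fst.comp (continuous_apply i))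
    exact h1.inter (isOpen_lt continuous_const (continuous_const.mul (continuous_quartic μ)))
  refine isOpen_iff_mem_nhds.2 fun τ hτ => ?_
  obtain ⟨g, hg, A, hA⟩ := mem_orbit_symm hτ
  have hc := (continuous_spin_matAct hg (A : Matrix (Fin 2) (Fin 2) ℝ)).continuousAt (x := τ)
  have hmem := hc.preimage_mem_nhds (hU.mem_nhds (show _ ∈ U by
    rw [← hA]
    exact ⟨hρ, hρq⟩))
  filter_upwards [hmem] with σ hσ
  have h1 := mem_orbit_of_sign hμ hε hρ hρq hσ.1 hσ.2
  exact mem_orbit_trans h1 (mem_orbit_symm ⟨g, hg, A, rfl⟩)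

theorem quartic_eq_zero_of_mem_orbit {μ : Alt 5} {ρ τ : Fin 2 → Ev} (h : quartic μ ρ = 0)
    (hτ : τ ∈ orbit ρ) : quartic μ τ = 0 := by
  obtain ⟨g, hg, A, rfl⟩ := hτ
  rw [quartic_matAct, quartic_spin μ hg, h, mul_zero]

/-- The quartic does not vanish on open orbits, being a semi-invariant polynomial that does not
vanish identically. -/
theorem quartic_ne_zero_of_inOpenOrbit {μ : Alt 5} (hμ : μ ≠ 0) {ρ : Fin 2 → Ev}
    (h : InOpenOrbit ρ) : quartic μ ρ ≠ 0 := by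
  intro h0
  set σ := standard μ 1 with hσ
  have hσq : quartic μ σ ≠ 0 := by
    rw [hσ, standard, quartic_normalForm hμ, ContinuousAlternatingMap.smul_apply]
    have := wedge11_apply (stdDual 0) (stdDual 1) ![stdE 0, stdE 1]
    simp only [Matrix.cons_val_zero, Matrix.cons_val_one, pair_stdE_stdDual] at this
    rw [this]
    norm_num
  have hev : ∀ᶠ t : ℝ in nhds 0, quartic μ (fun i => ρ i + t • σ i) = 0 := by
    have hc : Continuous fun t : ℝ => fun i => ρ i + t • σ i := by fun_prop
    have := hc.continuousAt.preimage_mem_nhds (x := 0)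
      (h.mem_nhds (by simpa using mem_orbit_self ρ))
    filter_upwards [this] with t ht
    exact quartic_eq_zero_of_mem_orbit h0 ht
  obtain ⟨δ, hδ, hδ'⟩ := Metric.eventually_nhds_iff.1 hev
  -- `f(ρ + t σ)` is a polynomial in `t` with leading coefficient `f(σ)`, which its values at `±δ/4`
  -- and `±δ/2`, together with the value at zero, determine
  have hpoly : ∀ t : ℝ, quartic μ (fun i => ρ i + t • σ i) =
      quartic μ ρ
      + t * (2 * inner (quadPol μ (ρ 0) (σ 0)) (quadMap μ (ρ 1)) +
        2 * inner (quadMap μ (ρ 0)) (quadPol μ (ρ 1) (σ 1)))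
      + t ^ 2 * (inner (quadMap μ (σ 0)) (quadMap μ (ρ 1)) + inner (quadMap μ (ρ 0)) (quadMap μ (σ 1))
        + 4 * inner (quadPol μ (ρ 0) (σ 0)) (quadPol μ (ρ 1) (σ 1)))
      + t ^ 3 * (2 * inner (quadPol μ (ρ 0) (σ 0)) (quadMap μ (σ 1)) +
        2 * inner (quadMap μ (σ 0)) (quadPol μ (ρ 1) (σ 1)))
      + t ^ 4 * quartic μ σ := by
    intro t
    have e : ∀ i, quadMap μ (ρ i + t • σ i) =
        quadMap μ (ρ i) + (2 * t) • quadPol μ (ρ i) (σ i) + t ^ 2 • quadMap μ (σ i) := by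
      intro i
      have := quadMap_comb μ 1 t (ρ i) (σ i)
      simpa only [one_smul, one_pow, mul_one] using this
    simp only [quartic, e, inner_add_left, inner_add_right, inner_smul_left, inner_smul_right]
    ring
  have hz : ∀ t : ℝ, |t| < δ → quartic μ (fun i => ρ i + t • σ i) = 0 := fun t ht =>
    hδ' (by simpa [Real.dist_eq] using ht)
  have a1 := hz (δ / 4) (by rw [abs_of_pos (by positivity)]; linarith)
  have a2 := hz (-(δ / 4)) (by rw [abs_neg, abs_of_pos (by positivity)]; linarith)
  have a3 := hz (δ / 2) (by rw [abs_of_pos (by positivity)]; linarith)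
  have a4 := hz (-(δ / 2)) (by rw [abs_neg, abs_of_pos (by positivity)]; linarith)
  rw [hpoly, h0] at a1 a2 a3 a4
  have : (δ / 4) ^ 4 * quartic μ σ = 0 := by linear_combination (a3 + a4 - 4 * (a1 + a2)) / 24
  exact hσq ((mul_eq_zero.1 this).resolve_left (by positivity))

/-! ### The derivative of the invariant volume -/

/-- Associativity `ξ ∧ (B ∧ φ) = (ξ ∧ B) ∧ φ`, stated for forms `χ` and `β` of literal degree in
place of the inner products, so that the evaluation lemmas apply without identifying degrees such
as `1 + 2` and `3`. -/
theorem wedge_wedge12_aux (ξ : Alt 1) (B φ : Alt 2) (χ : Alt 3) (β : Alt 4)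
    (hχ : ∀ v : Fin 3 → E5, χ v = wedge ξ B v) (hβ : ∀ v : Fin 4 → E5, β v = wedge B φ v) :
    (wedge ξ β : Alt 5) = wedge χ φ := by
  refine ContinuousAlternatingMap.ext fun v => ?_
  have h1 := wedge14_apply ξ β v
  have h2 := wedge32_apply χ φ v
  simp only [hχ, hβ] at h1 h2
  simp only [wedge22_apply, wedge12_apply] at h1 h2
  refine h1.trans (Eq.trans ?_ h2.symm)
  simp
  ring

theorem wedge_wedge12 (ξ : Alt 1) (B φ : Alt 2) :
    (wedge (q := 4) ξ (wedge B φ) : Alt 5) = wedge (p := 3) (wedge ξ B) φ :=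
  wedge_wedge12_aux ξ B φ _ _ (fun _ => rfl) (fun _ => rfl)

theorem interior_wedge22_self (Y : E5) (Ω : Alt 2) :
    (interior (k := 3) Y (wedge (p := 2) (q := 2) Ω Ω) : Alt 3) =
      (2 : ℝ) • (wedge (p := 1) (q := 2) (interior (k := 1) Y Ω) Ω : Alt 3) := by
  refine ContinuousAlternatingMap.ext fun v => ?_
  have h1 := wedge22_apply Ω Ω (Matrix.vecCons Y v)
  have h2 := wedge12_apply (interior Y Ω) Ω v
  rw [show (Matrix.vecCons Y v : Fin 4 → E5) 0 = Y from rfl,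
    show (Matrix.vecCons Y v : Fin 4 → E5) 1 = v 0 from rfl,
    show (Matrix.vecCons Y v : Fin 4 → E5) 2 = v 1 from rfl,
    show (Matrix.vecCons Y v : Fin 4 → E5) 3 = v 2 from rfl] at h1
  simp only [pair_interior] at h2
  refine h1.trans (Eq.trans ?_ (congrArg (fun t => (2 : ℝ) * t) h2).symm)
  ring

/-- The transpose of `e^B` for the Mukai pairing. -/
def expOd (B : Alt 2) (ψ : Od) : Od :=
  (ψ.1, ψ.2.1 - (wedge ψ.1 B : Alt 3), ψ.2.2 - (wedge ψ.2.1 B : Alt 5) +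
    (2⁻¹ : ℝ) • (wedge (q := 4) ψ.1 (wedge B B) : Alt 5))

theorem expB_eq (B : Alt 2) (φ : Ev) : expB B φ = (φ.1, φ.2.1 + val0 φ.1 • B,
    φ.2.2 + (wedge B φ.2.1 : Alt 4) + (2⁻¹ * val0 φ.1) • (wedge B B : Alt 4)) := by
  have h1 : wedge B φ.1 = val0 φ.1 • B := wedge_zero_right B φ.1
  have h2 : wedge B (val0 φ.1 • B) = val0 φ.1 • wedge B B := wedge_smul_right ..
  refine Prod.ext rfl (Prod.ext ?_ ?_)
  · exact congrArg (φ.2.1 + ·) h1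
  · change φ.2.2 + wedge B φ.2.1 + (2⁻¹ : ℝ) • (wedge B (wedge B φ.1 : Alt 2) : Alt 4) = _
    rw [mul_smul, ← h2, ← h1]

theorem wedge_sub_left {p q : ℕ} (α α' : Alt p) (β : Alt q) :
    wedge (α - α') β = wedge α β - wedge α' β := LinearMap.map_sub₂ (wedgeL p q) α α' β

/-- The identity behind `mukai_expB`, with the products `χ = ψ₁ ∧ B`, `W = B ∧ φ₂` and `W₂ = B ∧ B`
as variables. -/
theorem mukai_exp_aux (B φ₂ : Alt 2) (χ ψ₃ : Alt 3) (W W₂ φ₄ : Alt 4) (ψ₁ : Alt 1) (ψ₅ : Alt 5)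
    (φ₀ : Alt 0) (h : (wedge ψ₁ W : Alt 5) = wedge χ φ₂) :
    mukai (ψ₁, ψ₃, ψ₅) (φ₀, φ₂ + val0 φ₀ • B, φ₄ + W + (2⁻¹ * val0 φ₀) • W₂) =
      mukai (ψ₁, ψ₃ - χ, ψ₅ - wedge ψ₃ B + (2⁻¹ : ℝ) • wedge ψ₁ W₂) (φ₀, φ₂, φ₄) := by
  refine alt5_ext ?_
  have e2 : wedge (ψ₃ - χ) φ₂ = wedge ψ₃ φ₂ - wedge χ φ₂ := wedge_sub_left ..
  have h' := congrArg (fun α : Alt 5 => α stdE) h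
  rw [mukai_stdE, mukai_stdE]
  simp only [wedge_add_right, wedge_smul_right, e2]
  change (wedge ψ₁ φ₄ stdE + wedge ψ₁ W stdE + 2⁻¹ * val0 φ₀ * wedge ψ₁ W₂ stdE) -
    (wedge ψ₃ φ₂ stdE + val0 φ₀ * wedge ψ₃ B stdE) + val0 φ₀ * ψ₅ stdE =
    wedge ψ₁ φ₄ stdE - (wedge ψ₃ φ₂ stdE - wedge χ φ₂ stdE) + val0 φ₀ *
      (ψ₅ stdE - wedge ψ₃ B stdE + 2⁻¹ * wedge ψ₁ W₂ stdE)
  rw [h']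
  ring

theorem mukai_expB (B : Alt 2) (ψ : Od) (φ : Ev) :
    mukai ψ (expB B φ) = mukai (expOd B ψ) φ := by
  rw [expB_eq]
  have h := mukai_exp_aux B φ.2.1 (wedge (p := 1) (q := 2) ψ.1 B) ψ.2.1
    (wedge (p := 2) (q := 2) B φ.2.1) (wedge (p := 2) (q := 2) B B) φ.2.2 ψ.1 ψ.2.2 φ.1
  have h2 := h (wedge_wedge12 ψ.1 B φ.2.1)
  exact h2

theorem expB_add_right (B : Alt 2) (φ φ' : Ev) : expB B (φ + φ') = expB B φ + expB B φ' :=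
  (isLinearMap_of_mem_spinOn (expB_mem_spinOn B)).map_add φ φ'

theorem expB_smul_right (B : Alt 2) (c : ℝ) (φ : Ev) : expB B (c • φ) = c • expB B φ :=
  (isLinearMap_of_mem_spinOn (expB_mem_spinOn B)).map_smul c φ

theorem isLinearMap_expB (B : Alt 2) : IsLinearMap ℝ (expB B) :=
  isLinearMap_of_mem_spinOn (expB_mem_spinOn B)

/-- `e^B ∘ A` as a continuous linear map. -/
def transform (A : Matrix (Fin 2) (Fin 2) ℝ) (B : Alt 2) : (Fin 2 → Ev) →L[ℝ] (Fin 2 → Ev) :=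
  LinearMap.toContinuousLinearMap
    { toFun := fun ρ i => expB B (matAct A ρ i)
      map_add' := fun ρ σ => by
        funext i
        have : matAct A (ρ + σ) i = matAct A ρ i + matAct A σ i := by
          simp only [matAct, Pi.add_apply, smul_add, Finset.sum_add_distrib]
        rw [this, expB_add_right]; rfl
      map_smul' := fun c ρ => by
        funext i
        have : matAct A (c • ρ) i = c • matAct A ρ i := by
          simp only [matAct, Pi.smul_apply, Finset.smul_sum, smul_comm c]
        rw [this, expB_smul_right]; rfl }

theorem transform_apply (A : Matrix (Fin 2) (Fin 2) ℝ) (B : Alt 2) (ρ : Fin 2 → Ev) (i : Fin 2) :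
    transform A B ρ i = expB B (matAct A ρ i) := rfl

theorem quartic_transform (μ : Alt 5) {A : Matrix (Fin 2) (Fin 2) ℝ} (hA : A.det = 1) (B : Alt 2)
    (ρ : Fin 2 → Ev) : quartic μ (transform A B ρ) = quartic μ ρ := by
  refine (quartic_expB μ B (matAct A ρ)).trans ?_
  rw [quartic_matAct, hA, one_pow, one_mul]

theorem vol_transform (μ : Alt 5) {A : Matrix (Fin 2) (Fin 2) ℝ} (hA : A.det = 1) (B : Alt 2)
    (ρ : Fin 2 → Ev) : vol μ (transform A B ρ) = vol μ ρ := by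
  rw [vol, vol, quartic_transform μ hA]

/-- The volume is invariant under `e^B A` with `A ∈ SL(2, ℝ)`, so that `ρ̂` is transported by the
transpose of this map. -/
theorem IsHat.of_transform {μ : Alt 5} {A : Matrix (Fin 2) (Fin 2) ℝ} (hA : A.det = 1) {B : Alt 2}
    {ρ : Fin 2 → Ev} {ρ' : Fin 2 → Od} (h : IsHat μ (transform A B ρ) ρ') :
    IsHat μ ρ fun j => A 0 j • expOd B (ρ' 0) + A 1 j • expOd B (ρ' 1) := by
  obtain ⟨L, hL, hL'⟩ := h
  refine ⟨L.comp (transform A B), ?_, fun σ => ?_⟩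
  · have h1 := hL.comp ρ (transform A B).hasFDerivAt
    rwa [show vol μ ∘ transform A B = vol μ from funext (vol_transform μ hA B)] at h1
  · rw [ContinuousLinearMap.comp_apply, hL']
    simp only [transform_apply, mukai_expB, matAct, Fin.sum_univ_two, mukai_add_right,
      mukai_smul_right, mukai_add_left, mukai_smul_left]
    abel

/-- The Mukai pairing is non-degenerate. -/
theorem mukai_nondegenerate {μ : Alt 5} (hμ : μ ≠ 0) {ψ : Od} (h : ∀ φ, mukai ψ φ = 0) : ψ = 0 := by
  -- the left and right kernels are exchanged by Clifford multiplication
  have hr : ∀ ψ : Od, (∀ φ, mukai ψ φ = 0) → ∀ v ψ', mukai ψ' (cliffOd v ψ) = 0 := by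
    intro ψ h v ψ'
    rw [mukai_cliffOd_symm]; exact h _
  have hl : ∀ φ : Ev, (∀ ψ, mukai ψ φ = 0) → ∀ v φ', mukai (cliffEv v φ) φ' = 0 := by
    intro φ h v φ'
    rw [mukai_cliffEv_symm]; exact h _
  have h0 : ∀ φ : Ev, (∀ ψ, mukai ψ φ = 0) → φ.1 = 0 := by
    intro φ h
    have h1 := congrArg (fun α : Alt 5 => α stdE) (h (0, 0, μ))
    simp only [mukai_stdE, zero_wedge] at h1
    have h2 : val0 φ.1 * μ stdE = 0 := by simpa using h1
    by_contra hc
    exact mul_ne_zero (val0_ne_zero.2 hc) (apply_stdE_ne_zero hμ) h2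
  have h1 : ∀ ψ : Od, (∀ φ, mukai ψ φ = 0) → ψ.1 = 0 := by
    intro ψ h
    refine alt_ext_interior fun X => ?_
    have := h0 _ (hr ψ h (X, 0))
    rwa [cliffOd_vector] at this
  refine Prod.ext (h1 ψ h) (Prod.ext ?_ ?_)
  · refine alt_ext_interior fun X => alt_ext_interior fun Y => ?_
    have := h1 _ (hl _ (hr ψ h (X, 0)) (Y, 0))
    rwa [cliffOd_vector, cliffEv_vector] at this
  · refine alt5_ext ?_
    have h1 := congrArg (fun α : Alt 5 => α stdE) (h (const 1, 0, 0))
    simp only [mukai_stdE, wedge_zero, val0_const, one_mul] at h1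
    simpa using h1

/-- The form `ρ̂` is determined by `ρ`, the Mukai pairing being non-degenerate. -/
theorem IsHat.unique {μ : Alt 5} (hμ : μ ≠ 0) {ρ : Fin 2 → Ev} {ρ' ρ'' : Fin 2 → Od} (h : IsHat μ ρ ρ')
    (h' : IsHat μ ρ ρ'') : ρ' = ρ'' := by
  obtain ⟨L, hL, hL'⟩ := h
  obtain ⟨K, hK, hK'⟩ := h'
  have e := hL.unique hK
  subst e
  funext i
  refine sub_eq_zero.1 (mukai_nondegenerate hμ fun φ => ?_)
  have h1 := (hL' (Pi.single i φ)).symm.trans (hK' (Pi.single i φ))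
  rw [Finset.sum_eq_single i, Finset.sum_eq_single i] at h1
  · rw [mukai_sub_left, sub_eq_zero]
    simpa using h1
  all_goals simp +contextual [← mukaiL_apply]

theorem coeff_smul_left (c : ℝ) (μ α : Alt 5) : coeff (c • μ) α = c⁻¹ * coeff μ α := by
  simp only [coeff, ContinuousAlternatingMap.smul_apply, smul_eq_mul]
  rw [div_mul_eq_div_div, div_eq_mul_inv, div_eq_mul_inv, div_eq_mul_inv]
  ring

theorem quartic_smul (c : ℝ) (μ : Alt 5) (ρ : Fin 2 → Ev) :
    quartic (c • μ) ρ = (c⁻¹) ^ 2 * quartic μ ρ := by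
  have h : ∀ φ, quadMap (c • μ) φ = c⁻¹ • quadMap μ φ := fun φ =>
    inner_ext fun v => by rw [inner_quadMap, inner_smul_left, inner_quadMap, coeff_smul_left]
  rw [quartic, quartic, h, h, inner_smul_left, inner_smul_right]
  ring

theorem vol_smul {c : ℝ} (hc : 0 < c) (μ : Alt 5) : vol (c • μ) = vol μ := by
  funext ρ
  rw [vol, vol, quartic_smul, abs_mul, abs_of_pos (by positivity : 0 < c⁻¹ ^ 2),
    Real.sqrt_mul (by positivity), Real.sqrt_sq (by positivity), smul_smul]
  congr 1
  field_simp

theorem isHat_smul {c : ℝ} (hc : 0 < c) (μ : Alt 5) (ρ : Fin 2 → Ev) (ρ' : Fin 2 → Od) :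
    IsHat (c • μ) ρ ρ' ↔ IsHat μ ρ ρ' := by
  rw [IsHat, IsHat, vol_smul hc]

/-- The polarisation of `quadMap` as a bilinear map. -/
def quadPolL (μ : Alt 5) : Ev →ₗ[ℝ] Ev →ₗ[ℝ] Gen :=
  LinearMap.mk₂ ℝ (quadPol μ) (quadPol_add_left μ) (quadPol_smul_left μ)
    (fun a b c => by
      rw [quadPol_comm, quadPol_add_left, quadPol_comm μ b, quadPol_comm μ c])
    (fun c a b => by rw [quadPol_comm, quadPol_smul_left, quadPol_comm μ b])

/-- The derivative of the quartic, `D f(σ) = 2 ⟨Q(ρ₂) · ρ₁, σ₁⟩ + 2 ⟨Q(ρ₁) · ρ₂, σ₂⟩`. -/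
theorem hasFDerivAt_quartic (μ : Alt 5) (ρ : Fin 2 → Ev) :
    ∃ L : (Fin 2 → Ev) →L[ℝ] ℝ, HasFDerivAt (quartic μ) L ρ ∧ ∀ σ, L σ =
      2 * coeff μ (mukai (cliffEv (quadMap μ (ρ 1)) (ρ 0)) (σ 0)) +
      2 * coeff μ (mukai (cliffEv (quadMap μ (ρ 0)) (ρ 1)) (σ 1)) := by
  have hp : ∀ i : Fin 2, HasFDerivAt (fun ρ : Fin 2 → Ev => ρ i)
      (ContinuousLinearMap.proj (R := ℝ) (φ := fun _ : Fin 2 => Ev) i) ρ :=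
    fun i => (ContinuousLinearMap.proj (R := ℝ) (φ := fun _ : Fin 2 => Ev) i).hasFDerivAt
  have hq := fun i : Fin 2 => (quadPolL μ).toContinuousBilinearMap.hasFDerivAt_of_bilinear (hp i) (hp i)
  have hf := innerL.toContinuousBilinearMap.hasFDerivAt_of_bilinear (hq 0) (hq 1)
  have e : quartic μ = fun ρ => innerL.toContinuousBilinearMap
      ((quadPolL μ).toContinuousBilinearMap (ρ 0) (ρ 0))
      ((quadPolL μ).toContinuousBilinearMap (ρ 1) (ρ 1)) := by
    funext ρ
    change quartic μ ρ = inner (quadPol μ (ρ 0) (ρ 0)) (quadPol μ (ρ 1) (ρ 1))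
    rw [quadPol_self, quadPol_self]; rfl
  rw [← e] at hf
  refine ⟨_, hf, fun σ => ?_⟩
  change inner (quadPol μ (ρ 0) (ρ 0)) (quadPol μ (ρ 1) (σ 1) + quadPol μ (σ 1) (ρ 1)) +
    inner (quadPol μ (ρ 0) (σ 0) + quadPol μ (σ 0) (ρ 0)) (quadPol μ (ρ 1) (ρ 1)) = _
  rw [quadPol_comm μ (σ 1), quadPol_comm μ (σ 0), quadPol_self, quadPol_self, inner_comm,
    inner_add_left, inner_add_left, inner_quadPol, inner_quadPol]
  ring

set_option maxRecDepth 4000 in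
/-- The form `ρ̂` where the quartic has absolute value one. -/
theorem isHat_of_normalized {μ : Alt 5} (hμ : μ ≠ 0) {ε : ℝ} (hε : ε = 1 ∨ ε = -1)
    {ρ : Fin 2 → Ev} (hρ : quartic μ ρ = ε) :
    IsHat μ ρ ![ε • cliffEv (quadMap μ (ρ 1)) (ρ 0), ε • cliffEv (quadMap μ (ρ 0)) (ρ 1)] := by
  obtain ⟨L, hL, hL'⟩ := hasFDerivAt_quartic μ ρ
  have hεε : ε * ε = 1 := by rcases hε with rfl | rfl <;> norm_num
  have h1 : HasFDerivAt (fun τ => ε * quartic μ τ) (ε • L) ρ := hL.const_mul ε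
  have h2 := (h1.sqrt (by rw [hρ, hεε]; exact one_ne_zero)).smul_const μ
  have hev : ∀ᶠ τ in nhds ρ, 0 < ε * quartic μ τ :=
    (continuous_const.mul (continuous_quartic μ)).continuousAt.eventually
      (lt_mem_nhds (by change (0 : ℝ) < ε * quartic μ ρ; rw [hρ, hεε]; exact one_pos))
  refine ⟨_, h2.congr_of_eventuallyEq ?_, fun σ => ?_⟩
  · filter_upwards [hev] with τ hτ
    rw [vol]
    congr 2
    rcases hε with rfl | rfl
    · rw [abs_of_pos (by linarith)]; ring
    · rw [abs_of_neg (by linarith)]; ring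
  · have h3 : (∑ i, mukai ((![ε • cliffEv (quadMap μ (ρ 1)) (ρ 0),
        ε • cliffEv (quadMap μ (ρ 0)) (ρ 1)] : Fin 2 → Od) i) (σ i)) =
        ε • mukai (cliffEv (quadMap μ (ρ 1)) (ρ 0)) (σ 0) +
        ε • mukai (cliffEv (quadMap μ (ρ 0)) (ρ 1)) (σ 1) := by
      rw [Fin.sum_univ_two, ← mukai_smul_left, ← mukai_smul_left]; rfl
    rw [h3, ← coeff_smul_self hμ (mukai (cliffEv (quadMap μ (ρ 1)) (ρ 0)) (σ 0)),
      ← coeff_smul_self hμ (mukai (cliffEv (quadMap μ (ρ 0)) (ρ 1)) (σ 1))]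
    simp only [ContinuousLinearMap.smulRight_apply, _root_.smul_apply, hL', hρ, hεε,
      Real.sqrt_one, smul_eq_mul]
    module

/-- The form `ρ̂` of the normal form `(Ω + i_{Y₁} φ, 1 + i_{Y₂} φ)` when `Ω(Y₁, Y₂) = -ε / 8` with
`ε = ±1`; see `isHat_normalForm`. -/
def normalFormHat (ε : ℝ) (Ω : Alt 2) (φ : Alt 5) (Y₁ Y₂ : E5) : Fin 2 → Od :=
  ![((4 * ε) • interior Y₂ Ω, (4 * ε) • interior Y₂ (interior Y₁ φ), 0),
    ((-4 * ε) • interior Y₁ Ω, (4 * ε) • wedge (interior Y₂ Ω) Ω, (2⁻¹ : ℝ) • φ)]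

set_option maxRecDepth 4000 in
/-- `Q(Ω + i_Y φ) = V - 4 i_Y Ω` with `i_V φ = -2 Ω ∧ Ω`. -/
theorem quadMap_two_four {φ : Alt 5} (hφ : φ ≠ 0) (Ω : Alt 2) (Y : E5) :
    quadMap φ (0, Ω, interior Y φ) =
      (vecOf φ ((-2 : ℝ) • wedge Ω Ω), (-4 : ℝ) • interior Y Ω) := by
  set V := vecOf φ ((-2 : ℝ) • wedge Ω Ω) with hV
  have hVφ : interior V φ = (-2 : ℝ) • wedge Ω Ω := interior_vecOf hφ _
  refine linear_ext_gen (F := fun v => inner (quadMap φ (0, Ω, interior Y φ)) v)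
    (isLinearMap_inner _) (isLinearMap_inner _) (fun l => ?_) (fun ξ => ?_) |> inner_ext
  · rw [inner_quadMap, cliffEv_vector]
    have : mukai (interior (stdE l) Ω, interior (stdE l) (interior Y φ), 0) (0, Ω, interior Y φ) =
        (2 * Ω ![stdE l, Y]) • φ := by
      simp only [mukai, wedge_interior_comm, wedge_interior_volume, zero_wedge, pair_interior]
      module
    rw [this, coeff_smul, coeff_self hφ, alt2_swap]
    simp only [inner, pair_zero_right, pair_smul_right, pair_interior]
    ring
  · rw [inner_quadMap, cliffEv_covector]
    have h1 := wedge_interior_volume ξ V φ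
    rw [hVφ, wedge_smul_right, wedge_wedge12] at h1
    have : mukai (val0 0 • ξ, wedge ξ Ω, wedge ξ (interior Y φ)) (0, Ω, interior Y φ) =
        (2⁻¹ * pair V ξ) • φ := by
      have h2 : val0 0 = 0 := rfl
      simp only [mukai, h2, zero_smul, zero_wedge, wedge_zero]
      rw [mul_smul, ← h1, smul_smul]
      module
    rw [this, coeff_smul, coeff_self hφ]
    simp only [inner, pair_zero_left]
    ring

set_option maxRecDepth 4000 in
theorem isHat_normalForm {φ : Alt 5} (hφ : φ ≠ 0) {ε : ℝ} (hε : ε = 1 ∨ ε = -1) {Ω : Alt 2}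
    {Y₁ Y₂ : E5} (h : Ω ![Y₁, Y₂] = -ε / 8) :
    IsHat φ (normalForm Ω φ Y₁ Y₂) (normalFormHat ε Ω φ Y₁ Y₂) := by
  have hq : quartic φ (normalForm Ω φ Y₁ Y₂) = ε := by rw [quartic_normalForm hφ, h]; ring
  have hh := isHat_of_normalized hφ hε hq
  have hεε : ε * ε = 1 := by rcases hε with rfl | rfl <;> norm_num
  convert hh using 1
  have q1 : quadMap φ (normalForm Ω φ Y₁ Y₂ 1) = ((4 : ℝ) • Y₂, 0) := quadMap_one_add hφ Y₂
  have q0 := quadMap_two_four hφ Ω Y₁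
  funext i
  fin_cases i
  · change _ = ε • cliffEv (quadMap φ (normalForm Ω φ Y₁ Y₂ 1)) (0, Ω, interior Y₁ φ)
    rw [q1, cliffEv_vector]
    refine Prod.ext ?_ (Prod.ext ?_ ?_)
    · change (4 * ε) • interior Y₂ Ω = ε • interior ((4 : ℝ) • Y₂) Ω
      rw [smul_interior, smul_smul, mul_comm]
    · change (4 * ε) • interior Y₂ (interior Y₁ φ) = ε • interior ((4 : ℝ) • Y₂) (interior Y₁ φ)
      rw [smul_interior, smul_smul, mul_comm]
    · exact (smul_zero ε).symm
  · change _ = ε • cliffEv (quadMap φ (0, Ω, interior Y₁ φ)) (const 1, 0, interior Y₂ φ)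
    rw [q0]
    refine Prod.ext ?_ (Prod.ext ?_ ?_)
    · change (-4 * ε) • interior Y₁ Ω = ε • ((interior (k := 1) _ 0 : Alt 1) +
        (wedge (p := 1) (q := 0) ((-4 : ℝ) • interior Y₁ Ω) (const 1) : Alt 1))
      rw [wedge_zero_right, val0_const, interior_zero, zero_add, one_smul, smul_smul, mul_comm]
    · change (4 * ε) • wedge (interior Y₂ Ω) Ω =
        ε • ((interior (k := 3) (vecOf φ ((-2 : ℝ) • wedge Ω Ω)) (interior Y₂ φ) : Alt 3) +
          (wedge (p := 1) (q := 2) _ 0 : Alt 3))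
      rw [interior_swap, interior_vecOf hφ, wedge_zero, add_zero, interior_smul,
        interior_wedge22_self]
      module
    · change (2⁻¹ : ℝ) • φ = ε • wedge ((-4 : ℝ) • interior Y₁ Ω) (interior Y₂ φ)
      rw [wedge_interior_volume, pair_smul_right, pair_interior, h, smul_smul]
      congr 1
      linear_combination (-1 / 2 : ℝ) * hεε

/-! ### Differential calculus on the model space -/

open ContinuousAlternatingMap (alternatizeUncurryFin alternatizeUncurryFin_apply
  alternatizeUncurryFin_add)

/-- The interior product as a continuous bilinear map. -/
def interiorB (k : ℕ) : E5 →L[ℝ] Alt (k + 1) →L[ℝ] Alt k := (interiorL k).toContinuousBilinearMap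

/-- The wedge product as a continuous bilinear map. -/
def wedgeB (p q : ℕ) : Alt p →L[ℝ] Alt q →L[ℝ] Alt (p + q) := (wedgeL p q).toContinuousBilinearMap

theorem interiorB_apply {k : ℕ} (X : E5) (α : Alt (k + 1)) : interiorB k X α = interior X α := rfl

/-- Contraction with the first slot of an alternatization: the algebraic core of Cartan's
formula. -/
theorem interior_alternatizeUncurryFin {k : ℕ} (F : E5 →L[ℝ] Alt (k + 1)) (X : E5) :
    interior X (alternatizeUncurryFin F) =
      F X - alternatizeUncurryFin ((interiorB k X).comp F) := by
  ext v
  rw [interior_apply, alternatizeUncurryFin_apply, Fin.sum_univ_succ,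
    ContinuousAlternatingMap.sub_apply, alternatizeUncurryFin_apply, sub_eq_add_neg,
    ← Finset.sum_neg_distrib]
  congr 1
  · simp
  · refine Finset.sum_congr rfl fun i _ => ?_
    have e : Fin.removeNth i.succ (Matrix.vecCons X v) = Matrix.vecCons X (Fin.removeNth i v) := by
      funext j
      refine Fin.cases ?_ (fun j => ?_) j
      · simp [Fin.removeNth]
      · simp [Fin.removeNth]
    rw [e, ContinuousLinearMap.comp_apply, interiorB_apply, interior_apply]
    simp [pow_succ]

theorem hasFDerivAt_interior {k : ℕ} {Y : E5 → E5} {α : E5 → Alt (k + 1)} {y : E5}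
    (hY : DifferentiableAt ℝ Y y) (hα : DifferentiableAt ℝ α y) :
    HasFDerivAt (fun z => interior (Y z) (α z))
      ((interiorB k (Y y)).comp (fderiv ℝ α y) +
        ((interiorB k).flip (α y)).comp (fderiv ℝ Y y)) y :=
  (interiorB k).hasFDerivAt_of_bilinear hY.hasFDerivAt hα.hasFDerivAt

theorem extDeriv_interior {k : ℕ} {Y : E5 → E5} {α : E5 → Alt (k + 1)} {y : E5}
    (hY : DifferentiableAt ℝ Y y) (hα : DifferentiableAt ℝ α y) :
    extDeriv (fun z => interior (Y z) (α z)) y =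
      alternatizeUncurryFin ((interiorB k (Y y)).comp (fderiv ℝ α y)) +
        alternatizeUncurryFin (((interiorB k).flip (α y)).comp (fderiv ℝ Y y)) := by
  rw [extDeriv, (hasFDerivAt_interior hY hα).fderiv, alternatizeUncurryFin_add]

/-- Cartan's formula `L_Y = d i_Y + i_Y d` on the model space. -/
theorem cartan {k : ℕ} {Y : E5 → E5} {α : E5 → Alt (k + 1)} {y : E5}
    (hY : DifferentiableAt ℝ Y y) (hα : DifferentiableAt ℝ α y) :
    fderiv ℝ α y (Y y) + ContinuousAlternatingMap.fderivCompContinuousLinearMap (α y)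
      (ContinuousLinearMap.id ℝ E5) (fderiv ℝ Y y) =
    extDeriv (fun z => interior (Y z) (α z)) y + interior (Y y) (extDeriv α y) := by
  have h : ContinuousAlternatingMap.fderivCompContinuousLinearMap (α y)
      (ContinuousLinearMap.id ℝ E5) (fderiv ℝ Y y) =
      alternatizeUncurryFin (((interiorB k).flip (α y)).comp (fderiv ℝ Y y)) := by
    rw [ContinuousAlternatingMap.fderivCompContinuousLinearMap_eq_alternatizeUncurryFin]
    rfl
  rw [extDeriv_interior hY hα, h, extDeriv, interior_alternatizeUncurryFin]
  abel

/-- The formula `i_{[Y₁,Y₂]} = d i_{Y₁} i_{Y₂} + i_{Y₁} d i_{Y₂} - i_{Y₂} d i_{Y₁} - i_{Y₂} i_{Y₁} d`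
on the model space. -/
theorem interior_lieBracket {k : ℕ} {Y₁ Y₂ : E5 → E5} {α : E5 → Alt (k + 2)} {y : E5}
    (hY₁ : DifferentiableAt ℝ Y₁ y) (hY₂ : DifferentiableAt ℝ Y₂ y)
    (hα : DifferentiableAt ℝ α y) :
    interior (VectorField.lieBracket ℝ Y₁ Y₂ y) (α y) =
      extDeriv (fun z => interior (Y₁ z) (interior (Y₂ z) (α z))) y +
        interior (Y₁ y) (extDeriv (fun z => interior (Y₂ z) (α z)) y) -
        interior (Y₂ y) (extDeriv (fun z => interior (Y₁ z) (α z)) y) -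
        interior (Y₂ y) (interior (Y₁ y) (extDeriv α y)) := by
  have h2 := hasFDerivAt_interior hY₂ hα
  have swap : ∀ (X Z : E5) (β : Alt (k + 2)), interior X (interior Z β) = -interior Z (interior X β) :=
    fun X Z β => interior_swap X Z β
  have e1 : (interiorB k (Y₁ y)).comp ((interiorB (k + 1) (Y₂ y)).comp (fderiv ℝ α y)) =
      -(interiorB k (Y₂ y)).comp ((interiorB (k + 1) (Y₁ y)).comp (fderiv ℝ α y)) :=
    ContinuousLinearMap.ext fun v => swap (Y₁ y) (Y₂ y) (fderiv ℝ α y v)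
  have e2 : ((interiorB k).flip (interior (Y₂ y) (α y))).comp (fderiv ℝ Y₁ y) =
      -(interiorB k (Y₂ y)).comp (((interiorB (k + 1)).flip (α y)).comp (fderiv ℝ Y₁ y)) :=
    ContinuousLinearMap.ext fun v => swap (fderiv ℝ Y₁ y v) (Y₂ y) (α y)
  have neg : ∀ G : E5 →L[ℝ] Alt k, alternatizeUncurryFin (-G) = -alternatizeUncurryFin G :=
    fun G => map_neg (ContinuousAlternatingMap.alternatizeUncurryFinCLM ℝ E5 ℝ) G
  rw [extDeriv_interior hY₁ h2.differentiableAt, extDeriv_interior hY₂ hα,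
    extDeriv_interior hY₁ hα, h2.fderiv, extDeriv, ContinuousLinearMap.comp_add,
    alternatizeUncurryFin_add]
  simp only [interior_add, interior_alternatizeUncurryFin, e1, e2, neg]
  simp only [ContinuousLinearMap.comp_apply, ContinuousLinearMap.flip_apply, interiorB_apply,
    VectorField.lieBracket, sub_eq_add_neg, interior_add, add_interior]
  have n1 : ∀ X (β : Alt (k + 2)), interior X (-β) = -interior X β := fun X β =>
    map_neg (interiorB (k + 1) X) β
  have n2 : ∀ X (β : Alt (k + 2)), interior (-X) β = -interior X β := fun X β =>
    LinearMap.map_neg₂ (interiorL (k + 1)) X β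
  simp only [n1, n2, interior_alternatizeUncurryFin, ContinuousLinearMap.comp_apply,
    interiorB_apply]
  abel

theorem alternatizeUncurryFin_apply_one (F : E5 →L[ℝ] Alt 1) (v : Fin 2 → E5) :
    alternatizeUncurryFin F v = F (v 0) ![v 1] - F (v 1) ![v 0] := by
  have e0 : Fin.removeNth 0 v = ![v 1] := by funext i; fin_cases i; rfl
  have e1 : Fin.removeNth 1 v = ![v 0] := by funext i; fin_cases i; rfl
  rw [alternatizeUncurryFin_apply, Fin.sum_univ_two, e0, e1]
  simp [sub_eq_add_neg]

theorem alternatizeUncurryFin_apply_two (F : E5 →L[ℝ] Alt 2) (v : Fin 3 → E5) :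
    alternatizeUncurryFin F v =
      F (v 0) ![v 1, v 2] - F (v 1) ![v 0, v 2] + F (v 2) ![v 0, v 1] := by
  have e0 : Fin.removeNth 0 v = ![v 1, v 2] := by funext i; fin_cases i <;> rfl
  have e1 : Fin.removeNth 1 v = ![v 0, v 2] := by funext i; fin_cases i <;> rfl
  have e2 : Fin.removeNth 2 v = ![v 0, v 1] := by funext i; fin_cases i <;> rfl
  rw [alternatizeUncurryFin_apply, Fin.sum_univ_three, e0, e1, e2]
  simp [sub_eq_add_neg]

theorem alternatizeUncurryFin_apply_three (F : E5 →L[ℝ] Alt 3) (v : Fin 4 → E5) :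
    alternatizeUncurryFin F v =
      F (v 0) ![v 1, v 2, v 3] - F (v 1) ![v 0, v 2, v 3] + F (v 2) ![v 0, v 1, v 3]
        - F (v 3) ![v 0, v 1, v 2] := by
  have e0 : Fin.removeNth 0 v = ![v 1, v 2, v 3] := by funext i; fin_cases i <;> rfl
  have e1 : Fin.removeNth 1 v = ![v 0, v 2, v 3] := by funext i; fin_cases i <;> rfl
  have e2 : Fin.removeNth 2 v = ![v 0, v 1, v 3] := by funext i; fin_cases i <;> rfl
  have e3 : Fin.removeNth 3 v = ![v 0, v 1, v 2] := by funext i; fin_cases i <;> rfl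
  rw [alternatizeUncurryFin_apply, Fin.sum_univ_four, e0, e1, e2, e3]
  simp [sub_eq_add_neg, pow_succ]

theorem alternatizeUncurryFin_apply_four (F : E5 →L[ℝ] Alt 4) (v : Fin 5 → E5) :
    alternatizeUncurryFin F v =
      F (v 0) ![v 1, v 2, v 3, v 4] - F (v 1) ![v 0, v 2, v 3, v 4]
        + F (v 2) ![v 0, v 1, v 3, v 4] - F (v 3) ![v 0, v 1, v 2, v 4]
        + F (v 4) ![v 0, v 1, v 2, v 3] := by
  have e0 : Fin.removeNth 0 v = ![v 1, v 2, v 3, v 4] := by funext i; fin_cases i <;> rfl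
  have e1 : Fin.removeNth 1 v = ![v 0, v 2, v 3, v 4] := by funext i; fin_cases i <;> rfl
  have e2 : Fin.removeNth 2 v = ![v 0, v 1, v 3, v 4] := by funext i; fin_cases i <;> rfl
  have e3 : Fin.removeNth 3 v = ![v 0, v 1, v 2, v 4] := by funext i; fin_cases i <;> rfl
  have e4 : Fin.removeNth 4 v = ![v 0, v 1, v 2, v 3] := by funext i; fin_cases i <;> rfl
  rw [alternatizeUncurryFin_apply, Fin.sum_univ_five, e0, e1, e2, e3, e4]
  simp [sub_eq_add_neg, pow_succ]

/-- The algebraic form of the Leibniz rule for closed forms of degrees one and two. -/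
theorem alternatizeUncurryFin_wedge12 {α : Alt 1} {β : Alt 2} {F : E5 →L[ℝ] Alt 1}
    {G : E5 →L[ℝ] Alt 2} {K : E5 →L[ℝ] Alt 3} (hF : alternatizeUncurryFin F = 0)
    (hG : alternatizeUncurryFin G = 0)
    (hK : ∀ (u : E5) (v : Fin 3 → E5), K u v = wedge α (G u) v + wedge (F u) β v) :
    alternatizeUncurryFin K = 0 := by
  have hF' : ∀ a b : E5, F a ![b] - F b ![a] = 0 := fun a b => by
    have h := congrArg (fun γ : Alt 2 => γ ![a, b]) hF
    exact (alternatizeUncurryFin_apply_one F ![a, b]).symm.trans h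
  have hG' : ∀ a b c : E5, G a ![b, c] - G b ![a, c] + G c ![a, b] = 0 := fun a b c => by
    have h := congrArg (fun γ : Alt 3 => γ ![a, b, c]) hG
    exact (alternatizeUncurryFin_apply_two G ![a, b, c]).symm.trans h
  refine ContinuousAlternatingMap.ext fun v => (alternatizeUncurryFin_apply_three K v).trans ?_
  change _ = (0 : ℝ)
  simp only [hK, wedge12_apply, pair]
  simp only [Matrix.cons_val]
  linear_combination hF' (v 0) (v 1) * β ![v 2, v 3] - hF' (v 0) (v 2) * β ![v 1, v 3] +
    hF' (v 0) (v 3) * β ![v 1, v 2] + hF' (v 1) (v 2) * β ![v 0, v 3] -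
    hF' (v 1) (v 3) * β ![v 0, v 2] + hF' (v 2) (v 3) * β ![v 0, v 1] -
    α ![v 0] * hG' (v 1) (v 2) (v 3) + α ![v 1] * hG' (v 0) (v 2) (v 3) -
    α ![v 2] * hG' (v 0) (v 1) (v 3) + α ![v 3] * hG' (v 0) (v 1) (v 2)

/-- The algebraic form of the Leibniz rule for two closed forms of degree two. -/
theorem alternatizeUncurryFin_wedge22 {α β : Alt 2} {F G : E5 →L[ℝ] Alt 2} {K : E5 →L[ℝ] Alt 4}
    (hF : alternatizeUncurryFin F = 0) (hG : alternatizeUncurryFin G = 0)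
    (hK : ∀ (u : E5) (v : Fin 4 → E5), K u v = wedge α (G u) v + wedge (F u) β v) :
    alternatizeUncurryFin K = 0 := by
  have key : ∀ {H : E5 →L[ℝ] Alt 2}, alternatizeUncurryFin H = 0 →
      ∀ a b c : E5, H a ![b, c] - H b ![a, c] + H c ![a, b] = 0 := fun {H} hH a b c => by
    have h := congrArg (fun γ : Alt 3 => γ ![a, b, c]) hH
    exact (alternatizeUncurryFin_apply_two H ![a, b, c]).symm.trans h
  have f := key hF
  have g := key hG
  refine ContinuousAlternatingMap.ext fun v => (alternatizeUncurryFin_apply_four K v).trans ?_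
  change _ = (0 : ℝ)
  simp only [hK, wedge22_apply]
  simp only [Matrix.cons_val]
  linear_combination f (v 0) (v 1) (v 2) * β ![v 3, v 4] - f (v 0) (v 1) (v 3) * β ![v 2, v 4] +
    f (v 0) (v 1) (v 4) * β ![v 2, v 3] + f (v 0) (v 2) (v 3) * β ![v 1, v 4] -
    f (v 0) (v 2) (v 4) * β ![v 1, v 3] + f (v 0) (v 3) (v 4) * β ![v 1, v 2] -
    f (v 1) (v 2) (v 3) * β ![v 0, v 4] + f (v 1) (v 2) (v 4) * β ![v 0, v 3] -
    f (v 1) (v 3) (v 4) * β ![v 0, v 2] + f (v 2) (v 3) (v 4) * β ![v 0, v 1] +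
    α ![v 3, v 4] * g (v 0) (v 1) (v 2) - α ![v 2, v 4] * g (v 0) (v 1) (v 3) +
    α ![v 2, v 3] * g (v 0) (v 1) (v 4) + α ![v 1, v 4] * g (v 0) (v 2) (v 3) -
    α ![v 1, v 3] * g (v 0) (v 2) (v 4) + α ![v 1, v 2] * g (v 0) (v 3) (v 4) -
    α ![v 0, v 4] * g (v 1) (v 2) (v 3) + α ![v 0, v 3] * g (v 1) (v 2) (v 4) -
    α ![v 0, v 2] * g (v 1) (v 3) (v 4) + α ![v 0, v 1] * g (v 2) (v 3) (v 4)

/-- The wedge product of a closed one-form and a closed two-form is closed. -/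
theorem extDeriv_wedge12 {α : E5 → Alt 1} {β : E5 → Alt 2} {y : E5} (hα : DifferentiableAt ℝ α y)
    (hβ : DifferentiableAt ℝ β y) (hdα : extDeriv α y = 0) (hdβ : extDeriv β y = 0) :
    extDeriv (n := 3) (fun z => wedge (α z) (β z)) y = 0 := by
  have hd := (wedgeB 1 2).hasFDerivAt_of_bilinear hα.hasFDerivAt hβ.hasFDerivAt
  exact (congrArg alternatizeUncurryFin hd.fderiv).trans
    (alternatizeUncurryFin_wedge12 hdα hdβ fun u v => rfl)

/-- The wedge product of two closed two-forms is closed. -/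
theorem extDeriv_wedge22 {α β : E5 → Alt 2} {y : E5} (hα : DifferentiableAt ℝ α y)
    (hβ : DifferentiableAt ℝ β y) (hdα : extDeriv α y = 0) (hdβ : extDeriv β y = 0) :
    extDeriv (n := 4) (fun z => wedge (α z) (β z)) y = 0 := by
  have hd := (wedgeB 2 2).hasFDerivAt_of_bilinear hα.hasFDerivAt hβ.hasFDerivAt
  exact (congrArg alternatizeUncurryFin hd.fderiv).trans
    (alternatizeUncurryFin_wedge22 hdα hdβ fun u v => rfl)

/-! ### Forms and vector fields in charts -/

section Charts

variable {M : Type*} [TopologicalSpace M] [ChartedSpace E5 M]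

/-- The derivative of the inverse of the chart around `x₀`. -/
def chartDeriv (x₀ : M) (y : E5) : E5 →L[ℝ] E5 :=
  (mfderiv 𝓘(ℝ, E5) (𝓡 5) (extChartAt (𝓡 5) x₀).symm y : E5 →L[ℝ] E5)

theorem inChart_apply {k : ℕ} (α : Form M k) (x₀ : M) (y : E5) :
    inChart α x₀ y = pull (chartDeriv x₀ y) (α ((extChartAt (𝓡 5) x₀).symm y)) := rfl

theorem inChart_wedge {p q : ℕ} (α : Form M p) (β : Form M q) (x₀ : M) :
    inChart (fun x => wedge (α x) (β x)) x₀ = fun y => wedge (inChart α x₀ y) (inChart β x₀ y) :=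
  funext fun _ => pull_wedge _ _ _

theorem inChart_add {k : ℕ} (α β : Form M k) (x₀ : M) :
    inChart (fun x => α x + β x) x₀ = inChart α x₀ + inChart β x₀ := rfl

theorem inChart_smul {k : ℕ} (f : M → ℝ) (α : Form M k) (x₀ : M) :
    inChart (fun x => f x • α x) x₀ =
      fun y => f ((extChartAt (𝓡 5) x₀).symm y) • inChart α x₀ y := rfl

theorem target_mem_nhds {x₀ : M} {y : E5} (hy : y ∈ (extChartAt (𝓡 5) x₀).target) :
    (extChartAt (𝓡 5) x₀).target ∈ nhds y :=
  (isOpen_extChartAt_target x₀).mem_nhds hy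

theorem SmoothForm.differentiableAt {k : ℕ} {α : Form M k} (h : SmoothForm α) (x : M) :
    DifferentiableAt ℝ (inChart α x) (extChartAt (𝓡 5) x x) :=
  ((h x).contDiffAt (target_mem_nhds (mem_extChartAt_target x))).differentiableAt (by norm_num)

variable [IsManifold (𝓡 5) ∞ M]

theorem isInvertible_chartDeriv {x₀ : M} {y : E5} (hy : y ∈ (extChartAt (𝓡 5) x₀).target) :
    (chartDeriv x₀ y).IsInvertible := by
  have : IsManifold (𝓡 5) 1 M := IsManifold.of_le (n := ∞) (by norm_num)
  have h := isInvertible_mfderivWithin_extChartAt_symm hy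
  rwa [(𝓡 5).range_eq_univ, mfderivWithin_univ] at h

theorem chartDeriv_fieldInChart (Y : (x : M) → TangentSpace (𝓡 5) x) {x₀ : M} {y : E5}
    (hy : y ∈ (extChartAt (𝓡 5) x₀).target) :
    chartDeriv x₀ y (fieldInChart Y x₀ y) = Y ((extChartAt (𝓡 5) x₀).symm y) :=
  (isInvertible_chartDeriv hy).self_apply_inverse _

/-- The chart is a local diffeomorphism, so that pullback commutes with contraction. -/
theorem inChart_interior {k : ℕ} (Y : (x : M) → TangentSpace (𝓡 5) x) (α : Form M (k + 1)) {x₀ : M}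
    {y : E5} (hy : y ∈ (extChartAt (𝓡 5) x₀).target) :
    inChart (fun x => interior (Y x) (α x)) x₀ y =
      interior (fieldInChart Y x₀ y) (inChart α x₀ y) := by
  rw [inChart_apply, inChart_apply, interior_pull, chartDeriv_fieldInChart Y hy]

theorem pull_injective {g : E5 →L[ℝ] E5} (hg : g.IsInvertible) {k : ℕ} {α : Alt k}
    (h : pull g α = 0) : α = 0 := by
  have h1 := congrArg (pull g.inverse) h
  rwa [pull_pull, hg.self_comp_inverse, pull_id] at h1

theorem inChart_ne_zero {k : ℕ} {α : Form M k} {x₀ : M} {y : E5}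
    (hy : y ∈ (extChartAt (𝓡 5) x₀).target) (h : α ((extChartAt (𝓡 5) x₀).symm y) ≠ 0) :
    inChart α x₀ y ≠ 0 :=
  fun h0 => h (pull_injective (isInvertible_chartDeriv hy) h0)

theorem isInvertible_mfderiv_chart (x : M) :
    (mfderiv (𝓡 5) 𝓘(ℝ, E5) (extChartAt (𝓡 5) x) x : E5 →L[ℝ] E5).IsInvertible := by
  have : IsManifold (𝓡 5) 1 M := IsManifold.of_le (n := ∞) (by norm_num)
  exact isInvertible_mfderiv_extChartAt (mem_extChartAt_source x)

theorem fromChart_eq_zero_iff {k : ℕ} (x : M) (α : Alt k) : fromChart x α = 0 ↔ α = 0 :=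
  ⟨fun h => pull_injective (isInvertible_mfderiv_chart x) h, fun h => by rw [h]; rfl⟩

/-- The form `d α` at `x` is computed in the chart at `x`, so that its vanishing is a statement
about the exterior derivative on the model space. -/
theorem d_eq_zero_iff {k : ℕ} (α : Form M k) (x : M) :
    d α x = 0 ↔ extDeriv (inChart α x) (extChartAt (𝓡 5) x x) = 0 :=
  fromChart_eq_zero_iff x _

/-- A vector field is smooth if and only if its coordinate expressions are smooth. -/
theorem smoothField_iff {Y : (x : M) → TangentSpace (𝓡 5) x} :
    SmoothField Y ↔ ∀ x₀ : M, ContDiffOn ℝ ∞ (fieldInChart Y x₀) (extChartAt (𝓡 5) x₀).target := by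
  have : IsManifold (𝓡 5) 1 M := IsManifold.of_le (n := ∞) (by norm_num)
  have : IsManifold (𝓡 5) (∞ + 1) M := by simpa using! ‹IsManifold (𝓡 5) ∞ M›
  constructor
  · intro h x₀ y hy
    have hs : ContMDiffAt 𝓘(ℝ, E5) (𝓡 5) ∞ (extChartAt (𝓡 5) x₀).symm y :=
      (contMDiffOn_extChartAt_symm x₀).contMDiffAt (target_mem_nhds hy)
    have := ContMDiffAt.mpullback_vectorField_preimage (V := Y) (m := ∞) (n := ∞) (h _) hs
      (isInvertible_chartDeriv hy) (by norm_num)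
    exact (contMDiffAt_vectorSpace_iff_contDiffAt.1 this).contDiffWithinAt
  · intro h x₀
    have hV : ContMDiffAt 𝓘(ℝ, E5) (𝓘(ℝ, E5).tangent) ∞
        (fun y => (⟨y, fieldInChart Y x₀ y⟩ : TangentBundle 𝓘(ℝ, E5) E5)) (extChartAt (𝓡 5) x₀ x₀) :=
      contMDiffAt_vectorSpace_iff_contDiffAt.2
        ((h x₀).contDiffAt (target_mem_nhds (mem_extChartAt_target x₀)))
    have h1 := ContMDiffAt.mpullback_vectorField_preimage (m := ∞) (n := ∞) hV
      (contMDiffAt_extChartAt (I := 𝓡 5) (x := x₀)) (isInvertible_mfderiv_chart x₀) (by norm_num)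
    refine h1.congr_of_eventuallyEq ?_
    have h2 := VectorField.eventuallyEq_mpullback_mpullbackWithin_extChartAt (I := 𝓡 5) (s := Set.univ)
      (x := x₀) Y
    rw [(𝓡 5).range_eq_univ, VectorField.mpullbackWithin_univ, nhdsWithin_univ] at h2
    filter_upwards [h2] with x hx
    rw [hx]; rfl

end Charts

/-! ### Smooth and closed forms -/

theorem contDiffOn_bilinear {E F G H : Type*} [NormedAddCommGroup E] [NormedSpace ℝ E]
    [NormedAddCommGroup F] [NormedSpace ℝ F] [NormedAddCommGroup G] [NormedSpace ℝ G]
    [NormedAddCommGroup H] [NormedSpace ℝ H] (B : E →L[ℝ] F →L[ℝ] G) {f : H → E} {g : H → F}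
    {s : Set H} (hf : ContDiffOn ℝ ∞ f s) (hg : ContDiffOn ℝ ∞ g s) :
    ContDiffOn ℝ ∞ (fun y => B (f y) (g y)) s :=
  B.isBoundedBilinearMap.contDiff.comp_contDiffOn (hf.prodMk hg)

section SmoothForms

variable {M : Type*} [TopologicalSpace M] [ChartedSpace E5 M]

theorem SmoothForm.add {k : ℕ} {α β : Form M k} (hα : SmoothForm α) (hβ : SmoothForm β) :
    SmoothForm fun x => α x + β x := fun x₀ => (hα x₀).add (hβ x₀)

theorem SmoothForm.const_smul {k : ℕ} {α : Form M k} (c : ℝ) (hα : SmoothForm α) :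
    SmoothForm fun x => c • α x := fun x₀ => (hα x₀).const_smul c

theorem SmoothForm.wedge {p q : ℕ} {α : Form M p} {β : Form M q} (hα : SmoothForm α)
    (hβ : SmoothForm β) : SmoothForm fun x => wedge (α x) (β x) := fun x₀ => by
  have h : ContDiffOn ℝ ∞ (fun y => GenGeom.wedge (inChart α x₀ y) (inChart β x₀ y))
      (extChartAt (𝓡 5) x₀).target := contDiffOn_bilinear (wedgeB p q) (hα x₀) (hβ x₀)
  exact h.congr fun y _ => congrFun (inChart_wedge α β x₀) y

/-- Smoothness of a real function, tested in the charts. -/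
def SmoothFun (f : M → ℝ) : Prop :=
  ∀ x₀ : M, ContDiffOn ℝ ∞ (fun y => f ((extChartAt (𝓡 5) x₀).symm y)) (extChartAt (𝓡 5) x₀).target

theorem SmoothForm.smul {k : ℕ} {f : M → ℝ} {α : Form M k} (hf : SmoothFun f) (hα : SmoothForm α) :
    SmoothForm fun x => f x • α x := fun x₀ => by
  rw [inChart_smul]
  exact (hf x₀).smul (hα x₀)

/-- Evaluation of a form on fixed vectors. -/
def evalAt {k : ℕ} (v : Fin k → E5) : Alt k →L[ℝ] ℝ :=
  LinearMap.toContinuousLinearMap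
    { toFun := fun α => α v
      map_add' := fun _ _ => rfl
      map_smul' := fun _ _ => rfl }

theorem SmoothForm.smoothFun {α : Form M 0} (hα : SmoothForm α) : SmoothFun fun x => val0 (α x) :=
  fun x₀ => by
    refine ((evalAt (k := 0) ![]).contDiff.comp_contDiffOn (hα x₀)).congr fun y _ => ?_
    exact congrArg (α ((extChartAt (𝓡 5) x₀).symm y)) (Subsingleton.elim _ _)

theorem SmoothFun.continuous {f : M → ℝ} (hf : SmoothFun f) : Continuous f := by
  rw [continuous_iff_continuousAt]
  intro x
  have h1 := ((hf x).continuousOn.continuousAt (target_mem_nhds (mem_extChartAt_target x))).comp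
    (continuousAt_extChartAt (I := 𝓡 5) x)
  refine h1.congr ?_
  filter_upwards [extChartAt_source_mem_nhds (I := 𝓡 5) x] with z hz
  simp only [Function.comp_apply, (extChartAt (𝓡 5) x).left_inv hz]

theorem smoothForm_const (c : ℝ) : SmoothForm fun _ : M => const c := fun x₀ => by
  have : inChart (fun _ : M => const c) x₀ = fun _ => const c := rfl
  rw [this]; exact contDiffOn_const

theorem SmoothForm.congr {k : ℕ} {α β : Form M k} (hα : SmoothForm α) (h : ∀ x, β x = α x) :
    SmoothForm β := by rwa [show β = α from funext h]

theorem SmoothForm.smoothClosed {α : Form M 5} (hα : SmoothForm α) : SmoothClosed α :=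
  ⟨hα, fun _ => alt_eq_zero_of_lt (by norm_num) _⟩

theorem SmoothClosed.congr {k : ℕ} {α β : Form M k} (hα : SmoothClosed α) (h : ∀ x, β x = α x) :
    SmoothClosed β := by rwa [show β = α from funext h]

variable [IsManifold (𝓡 5) ∞ M]

theorem SmoothForm.interior {k : ℕ} {Y : (x : M) → TangentSpace (𝓡 5) x} {α : Form M (k + 1)}
    (hY : SmoothField Y) (hα : SmoothForm α) : SmoothForm fun x => interior (Y x) (α x) := fun x₀ =>
  (contDiffOn_bilinear (interiorB k) (smoothField_iff.1 hY x₀) (hα x₀)).congr fun _ hy =>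
    inChart_interior Y α hy

/-- The construction of the vector `Z` with `i_Z μ = τ` is natural, though its definition uses
coordinates. -/
theorem fieldInChart_vecOf {μ : Form M 5} (hμ : ∀ x, μ x ≠ 0) (τ : Form M 4) {x₀ : M} {y : E5}
    (hy : y ∈ (extChartAt (𝓡 5) x₀).target) :
    fieldInChart (fun x => vecOf (μ x) (τ x)) x₀ y = vecOf (inChart μ x₀ y) (inChart τ x₀ y) := by
  have hne := inChart_ne_zero (x₀ := x₀) hy (hμ _)
  refine eq_of_interior_eq hne ?_
  rw [interior_vecOf hne]
  refine (inChart_interior (fun x => (vecOf (μ x) (τ x) : TangentSpace (𝓡 5) x)) μ hy).symm.trans ?_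
  rw [show (fun x => interior (vecOf (μ x) (τ x)) (μ x)) = τ from
    funext fun x => interior_vecOf (hμ x) (τ x)]

/-- The vector field `Z` determined by `i_Z μ = τ` is smooth. -/
theorem smoothField_vecOf {μ : Form M 5} (hμ : IsVolumeForm μ) {τ : Form M 4} (hτ : SmoothForm τ) :
    SmoothField fun x => (vecOf (μ x) (τ x) : TangentSpace (𝓡 5) x) := by
  refine smoothField_iff.2 fun x₀ => ContDiffOn.congr ?_ fun y hy => fieldInChart_vecOf hμ.2 τ hy
  refine ContDiffOn.sum (f := fun (i : Fin 5) (y : E5) =>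
    coeff (inChart μ x₀ y) (wedge (stdDual i) (inChart τ x₀ y)) • stdE i) fun i _ => ?_
  refine ContDiffOn.smul (f := fun y : E5 => (wedge (stdDual i) (inChart τ x₀ y) : Alt 5) stdE /
    inChart μ x₀ y stdE) (ContDiffOn.div ?_ ?_ fun y hy => ?_) contDiffOn_const
  · exact ((evalAt (k := 5) stdE).comp (wedgeB 1 4 (stdDual i))).contDiff.comp_contDiffOn (hτ x₀)
  · exact (evalAt (k := 5) stdE).contDiff.comp_contDiffOn (hμ.1 x₀)
  · exact apply_stdE_ne_zero (inChart_ne_zero hy (hμ.2 _))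

theorem SmoothClosed.add {k : ℕ} {α β : Form M k} (hα : SmoothClosed α) (hβ : SmoothClosed β) :
    SmoothClosed fun x => α x + β x := by
  refine ⟨hα.1.add hβ.1, fun x => (d_eq_zero_iff _ x).2 ?_⟩
  rw [inChart_add, extDeriv_add (hα.1.differentiableAt x) (hβ.1.differentiableAt x),
    (d_eq_zero_iff _ x).1 (hα.2 x), (d_eq_zero_iff _ x).1 (hβ.2 x), add_zero]

theorem SmoothClosed.const_smul {k : ℕ} {α : Form M k} (c : ℝ) (hα : SmoothClosed α) :
    SmoothClosed fun x => c • α x := by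
  refine ⟨hα.1.const_smul c, fun x => (d_eq_zero_iff _ x).2 ?_⟩
  have e : inChart (fun x => c • α x) x = c • inChart α x := rfl
  rw [e, extDeriv_smul, (d_eq_zero_iff _ x).1 (hα.2 x), smul_zero]

theorem SmoothClosed.wedge12 {α : Form M 1} {β : Form M 2} (hα : SmoothClosed α)
    (hβ : SmoothClosed β) : SmoothClosed (k := 3) fun x => wedge (α x) (β x) := by
  refine ⟨hα.1.wedge hβ.1, fun x => (d_eq_zero_iff (k := 3) _ x).2 ?_⟩
  exact (congrArg (fun γ : E5 → Alt 3 => extDeriv γ _) (inChart_wedge α β x)).trans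
    (extDeriv_wedge12 (hα.1.differentiableAt x) (hβ.1.differentiableAt x)
      ((d_eq_zero_iff _ x).1 (hα.2 x)) ((d_eq_zero_iff _ x).1 (hβ.2 x)))

theorem SmoothClosed.wedge22 {α β : Form M 2} (hα : SmoothClosed α) (hβ : SmoothClosed β) :
    SmoothClosed (k := 4) fun x => wedge (α x) (β x) := by
  refine ⟨hα.1.wedge hβ.1, fun x => (d_eq_zero_iff (k := 4) _ x).2 ?_⟩
  exact (congrArg (fun γ : E5 → Alt 4 => extDeriv γ _) (inChart_wedge α β x)).trans
    (extDeriv_wedge22 (hα.1.differentiableAt x) (hβ.1.differentiableAt x)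
      ((d_eq_zero_iff _ x).1 (hα.2 x)) ((d_eq_zero_iff _ x).1 (hβ.2 x)))

theorem smoothClosed_const (c : ℝ) : SmoothClosed fun _ : M => const c := by
  refine ⟨smoothForm_const c, fun x => (d_eq_zero_iff _ x).2 ?_⟩
  have e : inChart (fun _ : M => const c) x = fun _ => const c := rfl
  rw [e, extDeriv, fderiv_fun_const]
  exact map_zero (ContinuousAlternatingMap.alternatizeUncurryFinCLM ℝ E5 ℝ)

theorem smoothClosed_zero (k : ℕ) : SmoothClosed fun _ : M => (0 : Alt k) := by
  have e : ∀ x₀ : M, inChart (fun _ : M => (0 : Alt k)) x₀ = fun _ => 0 := fun x₀ => rfl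
  refine ⟨fun x₀ => by rw [e]; exact contDiffOn_const, fun x => (d_eq_zero_iff _ x).2 ?_⟩
  rw [e, extDeriv, fderiv_fun_const]
  exact map_zero (ContinuousAlternatingMap.alternatizeUncurryFinCLM ℝ E5 ℝ)

/-! ### Cartan's formula and commuting fields on the manifold -/

theorem SmoothField.differentiableAt {Y : (x : M) → TangentSpace (𝓡 5) x} (hY : SmoothField Y)
    (x : M) : DifferentiableAt ℝ (fieldInChart Y x) (extChartAt (𝓡 5) x x) :=
  ((smoothField_iff.1 hY x).contDiffAt
    (target_mem_nhds (mem_extChartAt_target x))).differentiableAt (by norm_num)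

theorem inChart_interior_eventuallyEq {k : ℕ} (Y : (x : M) → TangentSpace (𝓡 5) x)
    (α : Form M (k + 1)) (x : M) :
    inChart (fun x => interior (Y x) (α x)) x =ᶠ[nhds (extChartAt (𝓡 5) x x)]
      fun y => interior (fieldInChart Y x y) (inChart α x y) := by
  filter_upwards [target_mem_nhds (mem_extChartAt_target x)] with y hy using inChart_interior Y α hy

/-- For a closed form, `L_Y α = d i_Y α`. -/
theorem lieDeriv_eq_zero_iff {k : ℕ} {Y : (x : M) → TangentSpace (𝓡 5) x} {α : Form M (k + 1)}
    (hY : SmoothField Y) (hα : SmoothClosed α) (x : M) :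
    lieDeriv Y α x = 0 ↔ d (fun x => interior (Y x) (α x)) x = 0 := by
  rw [d_eq_zero_iff, (inChart_interior_eventuallyEq Y α x).extDeriv_eq, lieDeriv,
    fromChart_eq_zero_iff, cartan (hY.differentiableAt x) (hα.1.differentiableAt x),
    (d_eq_zero_iff _ x).1 (hα.2 x), interior_zero, add_zero]

/-- The bracket on the manifold is computed in the chart at the point. -/
theorem mlieBracket_eq_zero_iff (Y₁ Y₂ : (x : M) → TangentSpace (𝓡 5) x) (x : M) :
    VectorField.mlieBracket (𝓡 5) Y₁ Y₂ x = 0 ↔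
      VectorField.lieBracket ℝ (fieldInChart Y₁ x) (fieldInChart Y₂ x) (extChartAt (𝓡 5) x x) = 0 := by
  rw [VectorField.mlieBracket, VectorField.mlieBracketWithin_apply, (𝓡 5).range_eq_univ,
    VectorField.mpullbackWithin_univ, VectorField.mpullbackWithin_univ, Set.preimage_univ,
    Set.univ_inter]
  change (mfderiv (𝓡 5) 𝓘(ℝ, E5) (extChartAt (𝓡 5) x) x : E5 →L[ℝ] E5).inverse
    (VectorField.lieBracketWithin (E := E5) ℝ (fieldInChart Y₁ x) (fieldInChart Y₂ x) Set.univ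
      (extChartAt (𝓡 5) x x)) = 0 ↔ _
  rw [VectorField.lieBracketWithin_univ]
  have h := isInvertible_mfderiv_chart x
  constructor
  · intro h0
    have h1 := congrArg (mfderiv (𝓡 5) 𝓘(ℝ, E5) (extChartAt (𝓡 5) x) x : E5 →L[ℝ] E5) h0
    exact (h.self_apply_inverse _).symm.trans (h1.trans (map_zero _))
  · intro h0
    exact (congrArg _ h0).trans (map_zero _)

/-- If `i_{Y₁} φ` and `i_{Y₂} φ` are closed for a volume form `φ`, then `[Y₁, Y₂] = 0` if and only
if `i_{Y₁} i_{Y₂} φ` is closed. -/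
theorem mlieBracket_eq_zero_iff_closed {φ : Form M 5} (hφ : IsVolumeForm φ)
    {Y₁ Y₂ : (x : M) → TangentSpace (𝓡 5) x} (hY₁ : SmoothField Y₁) (hY₂ : SmoothField Y₂) (x : M)
    (h1 : d (fun x => interior (Y₁ x) (φ x)) x = 0) (h2 : d (fun x => interior (Y₂ x) (φ x)) x = 0) :
    VectorField.mlieBracket (𝓡 5) Y₁ Y₂ x = 0 ↔
      d (fun x => interior (Y₁ x) (interior (Y₂ x) (φ x))) x = 0 := by
  have key := interior_lieBracket (hY₁.differentiableAt x) (hY₂.differentiableAt x)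
    (hφ.1.differentiableAt x)
  have e1 := (inChart_interior_eventuallyEq Y₁ φ x).extDeriv_eq
  have e2 := (inChart_interior_eventuallyEq Y₂ φ x).extDeriv_eq
  have e3 : inChart (fun x => interior (Y₁ x) (interior (Y₂ x) (φ x))) x
      =ᶠ[nhds (extChartAt (𝓡 5) x x)]
      fun y => interior (fieldInChart Y₁ x y) (interior (fieldInChart Y₂ x y) (inChart φ x y)) := by
    filter_upwards [inChart_interior_eventuallyEq Y₁ (fun x => interior (Y₂ x) (φ x)) x,
      inChart_interior_eventuallyEq Y₂ φ x] with y hy hy'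
    rw [hy, hy']
  rw [d_eq_zero_iff] at h1 h2
  rw [← e1, h1, ← e2, h2, ← e3.extDeriv_eq, interior_zero, interior_zero,
    alt_eq_zero_of_lt (by norm_num) (extDeriv (inChart φ x) _), interior_zero, interior_zero, add_zero,
    sub_zero, sub_zero] at key
  rw [mlieBracket_eq_zero_iff, d_eq_zero_iff, ← key]
  refine ⟨fun h => by rw [h, zero_interior], fun h => ?_⟩
  refine eq_of_interior_eq (inChart_ne_zero (mem_extChartAt_target x) (hφ.2 _)) ?_
  rw [h, zero_interior]

/-- A closed function on a connected manifold is constant. -/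
theorem SmoothClosed.exists_eq_const [ConnectedSpace M] {α : Form M 0} (hα : SmoothClosed α) :
    ∃ c, ∀ x, α x = const c := by
  have hf := hα.1.smoothFun
  have hval : ∀ (x : M) z, inChart α x z = const (val0 (α ((extChartAt (𝓡 5) x).symm z))) := by
    intro x z
    rw [const_val0]
    ext v
    exact congrArg (α ((extChartAt (𝓡 5) x).symm z)) (Subsingleton.elim _ _)
  set f : M → ℝ := fun x => val0 (α x) with hfdef
  -- the derivative in the chart at a point vanishes there, hence it vanishes in every chart
  have h0 : ∀ x : M, HasFDerivAt (fun z => f ((extChartAt (𝓡 5) x).symm z)) (0 : E5 →L[ℝ] ℝ)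
      (extChartAt (𝓡 5) x x) := by
    intro x
    have hd := (((hf x).contDiffAt (target_mem_nhds (mem_extChartAt_target x))).differentiableAt
      (by norm_num)).hasFDerivAt
    have h1 := (d_eq_zero_iff α x).1 (hα.2 x)
    rw [funext (hval x)] at h1
    have h2 := (extDeriv_constOfIsEmpty (𝕜 := ℝ) (fun z => f ((extChartAt (𝓡 5) x).symm z))
      (extChartAt (𝓡 5) x x)).symm.trans h1
    have h3 : fderiv ℝ (fun z => f ((extChartAt (𝓡 5) x).symm z)) (extChartAt (𝓡 5) x x) = 0 := by
      ext v
      exact congrArg (fun γ : Alt 1 => γ ![v]) h2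
    rwa [h3] at hd
  have h1 : ∀ x₀ : M, ∀ y ∈ (extChartAt (𝓡 5) x₀).target,
      HasFDerivAt (fun z => f ((extChartAt (𝓡 5) x₀).symm z)) (0 : E5 →L[ℝ] ℝ) y := by
    intro x₀ y hy
    set x := (extChartAt (𝓡 5) x₀).symm y with hx
    have hs : ContMDiffAt 𝓘(ℝ, E5) (𝓡 5) ∞ (extChartAt (𝓡 5) x₀).symm y :=
      (contMDiffOn_extChartAt_symm x₀).contMDiffAt (target_mem_nhds hy)
    have hT : DifferentiableAt ℝ (extChartAt (𝓡 5) x ∘ (extChartAt (𝓡 5) x₀).symm) y :=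
      ((contMDiffAt_extChartAt (I := 𝓡 5) (x := x)).comp y hs).contDiffAt.differentiableAt
        (by norm_num)
    have h2 := HasFDerivAt.comp y (h0 x) hT.hasFDerivAt
    rw [ContinuousLinearMap.zero_comp] at h2
    refine h2.congr_of_eventuallyEq ?_
    filter_upwards [hs.continuousAt.eventually (extChartAt_source_mem_nhds (I := 𝓡 5) x)] with z hz
    simp only [Function.comp_apply, (extChartAt (𝓡 5) x).left_inv hz]
  have hloc : IsLocallyConstant f := by
    refine (IsLocallyConstant.iff_eventually_eq f).2 fun x => ?_
    obtain ⟨r, hr, hball⟩ := Metric.mem_nhds_iff.1 (target_mem_nhds (mem_extChartAt_target x))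
    filter_upwards [extChartAt_source_mem_nhds (I := 𝓡 5) x,
      (continuousAt_extChartAt (I := 𝓡 5) x).eventually (Metric.ball_mem_nhds _ hr)] with z hz hz'
    have h2 := (convex_ball (extChartAt (𝓡 5) x x) r).is_const_of_fderivWithin_eq_zero (𝕜 := ℝ)
      (f := fun z => f ((extChartAt (𝓡 5) x).symm z))
      (fun w hw => (h1 x w (hball hw)).differentiableAt.differentiableWithinAt)
      (fun w hw => ((h1 x w (hball hw)).hasFDerivWithinAt).fderivWithin
        (Metric.isOpen_ball.uniqueDiffWithinAt hw)) hz' (Metric.mem_ball_self hr)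
    simpa only [(extChartAt (𝓡 5) x).left_inv hz,
      (extChartAt (𝓡 5) x).left_inv (mem_extChartAt_source x)] using h2
  obtain ⟨x₁⟩ := (inferInstance : Nonempty M)
  exact ⟨f x₁, fun x => by rw [hloc.apply_eq_of_preconnectedSpace x₁ x, hfdef, const_val0]⟩

end SmoothForms

/-! ### Closed mixed forms -/

theorem transform_transform (A A' : Matrix (Fin 2) (Fin 2) ℝ) (B B' : Alt 2) (ρ : Fin 2 → Ev) :
    transform A' B' (transform A B ρ) = transform (A' * A) (B' + B) ρ := by
  funext i
  rw [transform_apply, transform_apply, expB_add, ← matAct_matAct]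
  congr 1
  exact congrFun (matAct_map (isLinearMap_expB B) A' (matAct A ρ)) i

theorem transform_inv (A : Matrix.SpecialLinearGroup (Fin 2) ℝ) (B : Alt 2) (ρ : Fin 2 → Ev) :
    transform (A⁻¹ : Matrix.SpecialLinearGroup (Fin 2) ℝ) ((-1 : ℝ) • B) (transform A B ρ) = ρ := by
  have h : ((A⁻¹ : Matrix.SpecialLinearGroup (Fin 2) ℝ) : Matrix (Fin 2) (Fin 2) ℝ) * A = 1 := by
    rw [← Matrix.SpecialLinearGroup.coe_mul, inv_mul_cancel, Matrix.SpecialLinearGroup.coe_one]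
  rw [transform_transform, h, show (-1 : ℝ) • B + B = 0 by module]
  funext i
  rw [transform_apply, expB_zero, matAct_one]

section Closed

variable {M : Type*} [TopologicalSpace M] [ChartedSpace E5 M] [IsManifold (𝓡 5) ∞ M]

theorem SmoothClosedEv.add {φ φ' : M → Ev} (h : SmoothClosedEv φ) (h' : SmoothClosedEv φ') :
    SmoothClosedEv fun x => φ x + φ' x :=
  ⟨h.1.add h'.1, h.2.1.add h'.2.1, h.2.2.add h'.2.2⟩

theorem SmoothClosedEv.const_smul {φ : M → Ev} (c : ℝ) (h : SmoothClosedEv φ) :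
    SmoothClosedEv fun x => c • φ x :=
  ⟨h.1.const_smul c, h.2.1.const_smul c, h.2.2.const_smul c⟩

theorem SmoothClosedEv.matAct {ρ : M → Fin 2 → Ev} (A : Matrix (Fin 2) (Fin 2) ℝ)
    (h : ∀ i, SmoothClosedEv fun x => ρ x i) (i : Fin 2) :
    SmoothClosedEv fun x => matAct A (ρ x) i := by
  have e : (fun x => GenGeom.matAct A (ρ x) i) = fun x => A i 0 • ρ x 0 + A i 1 • ρ x 1 := by
    funext x; simp only [GenGeom.matAct, Fin.sum_univ_two]
  rw [e]
  exact ((h 0).const_smul _).add ((h 1).const_smul _)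

/-- A closed `B`-field preserves closedness. The degree-zero part is required to be constant so
that no Leibniz rule for functions is needed; on a connected manifold closedness implies this. -/
theorem SmoothClosedEv.expB {B : Form M 2} {φ : M → Ev} {c : ℝ} (hB : SmoothClosed B)
    (h : SmoothClosedEv φ) (hc : ∀ x, (φ x).1 = const c) :
    SmoothClosedEv fun x => expB (B x) (φ x) := by
  have e : (fun x => GenGeom.expB (B x) (φ x)) = fun x => ((φ x).1, (φ x).2.1 + c • B x,
      (φ x).2.2 + (wedge (B x) (φ x).2.1 : Alt 4) +
        (2⁻¹ * c) • (wedge (B x) (B x) : Alt 4)) := by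
    funext x; rw [expB_eq, hc, val0_const]
  rw [e]
  exact ⟨h.1, h.2.1.add (hB.const_smul c),
    (h.2.2.add (hB.wedge22 h.2.1)).add ((hB.wedge22 hB).const_smul _)⟩

theorem SmoothClosedOd.add {ψ ψ' : M → Od} (h : SmoothClosedOd ψ) (h' : SmoothClosedOd ψ') :
    SmoothClosedOd fun x => ψ x + ψ' x :=
  ⟨h.1.add h'.1, h.2.1.add h'.2.1, h.2.2.add h'.2.2⟩

theorem SmoothClosedOd.const_smul {ψ : M → Od} (c : ℝ) (h : SmoothClosedOd ψ) :
    SmoothClosedOd fun x => c • ψ x :=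
  ⟨h.1.const_smul c, h.2.1.const_smul c, h.2.2.const_smul c⟩

/-- The transpose of a closed `B`-field preserves closedness; in degree five closedness is
automatic. -/
theorem SmoothClosedOd.expOd {B : Form M 2} {ψ : M → Od} (hB : SmoothClosed B)
    (h : SmoothClosedOd ψ) : SmoothClosedOd fun x => expOd (B x) (ψ x) := by
  refine ⟨h.1, ?_, SmoothForm.smoothClosed ?_⟩
  · refine (h.2.1.add ((h.1.wedge12 hB).const_smul (-1))).congr fun x => ?_
    change (ψ x).2.1 - (wedge (ψ x).1 (B x) : Alt 3) = _
    module
  · have h1 : SmoothForm fun x => (wedge (ψ x).2.1 (B x) : Alt 5) :=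
      SmoothForm.wedge (p := 3) (q := 2) h.2.1.1 hB.1
    have h2 : SmoothForm fun x => (wedge (q := 4) (ψ x).1 (wedge (B x) (B x)) : Alt 5) :=
      SmoothForm.wedge (p := 1) (q := 4) h.1.1 (SmoothForm.wedge hB.1 hB.1)
    refine ((h.2.2.1.add (h1.const_smul (-1))).add (h2.const_smul 2⁻¹)).congr fun x => ?_
    change (ψ x).2.2 - (wedge (ψ x).2.1 (B x) : Alt 5) + _ = _
    module

/-- A linear combination, with coefficients a column of `A`, of `B`-field transforms of closed odd
forms is closed. -/
theorem SmoothClosedOd.transform {ψ : M → Fin 2 → Od} {B : Form M 2}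
    (A : Matrix (Fin 2) (Fin 2) ℝ) (hB : SmoothClosed B)
    (h : ∀ i, SmoothClosedOd fun x => ψ x i) (j : Fin 2) :
    SmoothClosedOd fun x => A 0 j • GenGeom.expOd (B x) (ψ x 0) +
      A 1 j • GenGeom.expOd (B x) (ψ x 1) :=
  ((SmoothClosedOd.expOd hB (h 0)).const_smul _).add ((SmoothClosedOd.expOd hB (h 1)).const_smul _)

theorem SmoothClosed.of_const_smul {k : ℕ} {α : Form M k} {c : ℝ} (hc : c ≠ 0)
    (h : SmoothClosed fun x => c • α x) : SmoothClosed α :=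
  (h.const_smul c⁻¹).congr fun x => by rw [smul_smul, inv_mul_cancel₀ hc, one_smul]

variable {μ : Form M 5} {ε : ℝ} {Ω : Form M 2} {φ : Form M 5}
  {Y₁ Y₂ : (x : M) → TangentSpace (𝓡 5) x}

/-- If the normal form and its `ρ̂` are closed, then `Y₁` and `Y₂` commute and preserve `Ω`
and `φ`. -/
theorem isReducedData_of_closed (hε : ε = 1 ∨ ε = -1) (hφ : IsVolumeForm φ)
    (hpos : ∀ x, 0 < coeff (μ x) (φ x)) (hY₁ : SmoothField Y₁) (hY₂ : SmoothField Y₂)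
    (hpair : ∀ x, Ω x ![Y₁ x, Y₂ x] = -ε / 8)
    (hn : ∀ i, SmoothClosedEv fun x => normalForm (Ω x) (φ x) (Y₁ x) (Y₂ x) i)
    (hn' : ∀ i, SmoothClosedOd fun x => normalFormHat ε (Ω x) (φ x) (Y₁ x) (Y₂ x) i) :
    IsReducedData μ ε Ω φ Y₁ Y₂ := by
  have hε4 : 4 * ε ≠ 0 := by rcases hε with rfl | rfl <;> norm_num
  have hε4' : -4 * ε ≠ 0 := by rcases hε with rfl | rfl <;> norm_num
  have hΩ : SmoothClosed Ω := (hn 0).2.1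
  have hφc := hφ.1.smoothClosed
  have h1 : SmoothClosed fun x => interior (Y₁ x) (φ x) := (hn 0).2.2
  have h2 : SmoothClosed fun x => interior (Y₂ x) (φ x) := (hn 1).2.2
  have g2 : SmoothClosed fun x => interior (Y₂ x) (Ω x) := SmoothClosed.of_const_smul hε4 (hn' 0).1
  have g1 : SmoothClosed fun x => interior (Y₁ x) (Ω x) := SmoothClosed.of_const_smul hε4' (hn' 1).1
  have g21 : SmoothClosed fun x => interior (Y₂ x) (interior (Y₁ x) (φ x)) :=
    SmoothClosed.of_const_smul hε4 (hn' 0).2.1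
  have g12 : SmoothClosed fun x => interior (Y₁ x) (interior (Y₂ x) (φ x)) :=
    (g21.const_smul (-1)).congr fun _ =>
      (interior_swap _ _ _).trans (neg_one_smul ℝ _).symm
  exact
    { closed := hΩ
      volume := hφ
      positive := hpos
      smooth₁ := hY₁
      smooth₂ := hY₂
      commute := fun x =>
        (mlieBracket_eq_zero_iff_closed hφ hY₁ hY₂ x (h1.2 x) (h2.2 x)).2 (g12.2 x)
      preserve_form₁ := fun x => (lieDeriv_eq_zero_iff hY₁ hΩ x).2 (g1.2 x)
      preserve_form₂ := fun x => (lieDeriv_eq_zero_iff hY₂ hΩ x).2 (g2.2 x)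
      preserve_vol₁ := fun x => (lieDeriv_eq_zero_iff hY₁ hφc x).2 (h1.2 x)
      preserve_vol₂ := fun x => (lieDeriv_eq_zero_iff hY₂ hφc x).2 (h2.2 x)
      pairing := hpair }

namespace IsReducedData

theorem closed_interior_vol₁ (h : IsReducedData μ ε Ω φ Y₁ Y₂) :
    SmoothClosed fun x => interior (Y₁ x) (φ x) :=
  ⟨h.volume.1.interior h.smooth₁, fun x =>
    (lieDeriv_eq_zero_iff h.smooth₁ h.volume.1.smoothClosed x).1 (h.preserve_vol₁ x)⟩

theorem closed_interior_vol₂ (h : IsReducedData μ ε Ω φ Y₁ Y₂) :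
    SmoothClosed fun x => interior (Y₂ x) (φ x) :=
  ⟨h.volume.1.interior h.smooth₂, fun x =>
    (lieDeriv_eq_zero_iff h.smooth₂ h.volume.1.smoothClosed x).1 (h.preserve_vol₂ x)⟩

theorem closed_normalForm (h : IsReducedData μ ε Ω φ Y₁ Y₂) (i : Fin 2) :
    SmoothClosedEv fun x => normalForm (Ω x) (φ x) (Y₁ x) (Y₂ x) i := by
  fin_cases i
  · exact ⟨smoothClosed_zero 0, h.closed, h.closed_interior_vol₁⟩
  · exact ⟨smoothClosed_const 1, smoothClosed_zero 2, h.closed_interior_vol₂⟩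

theorem closed_normalFormHat (h : IsReducedData μ ε Ω φ Y₁ Y₂) (i : Fin 2) :
    SmoothClosedOd fun x => normalFormHat ε (Ω x) (φ x) (Y₁ x) (Y₂ x) i := by
  have g1 : SmoothClosed fun x => interior (Y₁ x) (Ω x) :=
    ⟨h.closed.1.interior h.smooth₁, fun x =>
      (lieDeriv_eq_zero_iff h.smooth₁ h.closed x).1 (h.preserve_form₁ x)⟩
  have g2 : SmoothClosed fun x => interior (Y₂ x) (Ω x) :=
    ⟨h.closed.1.interior h.smooth₂, fun x =>
      (lieDeriv_eq_zero_iff h.smooth₂ h.closed x).1 (h.preserve_form₂ x)⟩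
  have g12 : SmoothClosed fun x => interior (Y₁ x) (interior (Y₂ x) (φ x)) :=
    ⟨h.closed_interior_vol₂.1.interior h.smooth₁, fun x =>
      (mlieBracket_eq_zero_iff_closed h.volume h.smooth₁ h.smooth₂ x (h.closed_interior_vol₁.2 x)
        (h.closed_interior_vol₂.2 x)).1 (h.commute x)⟩
  have g21 : SmoothClosed fun x => interior (Y₂ x) (interior (Y₁ x) (φ x)) :=
    (g12.const_smul (-1)).congr fun _ =>
      (interior_swap _ _ _).trans (neg_one_smul ℝ _).symm
  fin_cases i
  · exact ⟨g2.const_smul _, g21.const_smul _, smoothClosed_zero 5⟩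
  · exact ⟨g1.const_smul _, (g2.wedge12 h.closed).const_smul _,
      h.volume.1.smoothClosed.const_smul _⟩

end IsReducedData

end Closed

/-! ### Solutions -/

/-- A nowhere vanishing continuous function on a connected space has a constant sign. -/
theorem exists_sign {X : Type*} [TopologicalSpace X] [ConnectedSpace X] {q : X → ℝ}
    (hq : Continuous q) (h0 : ∀ x, q x ≠ 0) :
    ∃ ε : ℝ, (ε = 1 ∨ ε = -1) ∧ ∀ x, 0 < ε * q x := by
  by_cases hp : ∀ x, 0 < q x
  · exact ⟨1, Or.inl rfl, fun x => by rw [one_mul]; exact hp x⟩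
  · push Not at hp
    obtain ⟨a, ha⟩ := hp
    refine ⟨-1, Or.inr rfl, fun x => ?_⟩
    have : q x < 0 := by
      by_contra hx
      obtain ⟨z, hz⟩ := mem_range_of_exists_le_of_exists_ge hq ⟨a, ha⟩ ⟨x, not_lt.1 hx⟩
      exact h0 z hz
    linarith

theorem det_inv (A : Matrix.SpecialLinearGroup (Fin 2) ℝ) :
    ((A⁻¹ : Matrix.SpecialLinearGroup (Fin 2) ℝ) : Matrix (Fin 2) (Fin 2) ℝ).det = 1 :=
  (A⁻¹).2

section Solutions

variable {M : Type*} [TopologicalSpace M] [ChartedSpace E5 M]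

theorem SmoothFun.sqrt_abs {q : M → ℝ} (hq : SmoothFun q) (h0 : ∀ x, q x ≠ 0) :
    SmoothFun fun x => Real.sqrt |q x| := fun x₀ =>
  ((hq x₀).abs fun _ _ => h0 _).sqrt fun _ _ => abs_ne_zero.2 (h0 _)

variable [IsManifold (𝓡 5) ∞ M]

/-- The reduction of a solution. Its degree-zero part is constant, so that a constant `A ∈ SL(2,
ℝ)` and a closed `B`-field bring it to normal form; this normal form and its `ρ̂` are closed,
being transforms of `ρ` and `ρ̂` by `A` and `B`. -/
theorem exists_reducedData [ConnectedSpace M] {μ : Form M 5} (hμ : IsVolumeForm μ)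
    {ρ : M → Fin 2 → Ev} (hρ : IsSolution μ ρ) (hne : ∃ x i, (ρ x i).1 ≠ 0) :
    ∃ ε : ℝ, (ε = 1 ∨ ε = -1) ∧ (∀ x, 0 < ε * quartic (μ x) (ρ x)) ∧
      ∃ (A : Matrix.SpecialLinearGroup (Fin 2) ℝ) (B Ω : Form M 2)
        (φ : Form M 5) (Y₁ Y₂ : (x : M) → TangentSpace (𝓡 5) x),
        SmoothClosed B ∧ IsReducedData μ ε Ω φ Y₁ Y₂ ∧
        TransformsTo A B ρ Ω φ Y₁ Y₂ ∧ ∀ x, vol (μ x) (ρ x) = φ x := by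
  obtain ⟨hopen, hcl, ρ', hhat, hcl'⟩ := hρ
  choose c hc using fun i => (hcl i).1.exists_eq_const
  have hc0 : ∃ i, c i ≠ 0 := by
    obtain ⟨x, i, hi⟩ := hne
    exact ⟨i, fun h => hi (by rw [hc, h, const_zero])⟩
  obtain ⟨A₀, hA, hA0, hA1⟩ := exists_matrix_normalizing hc0 1
  set A : Matrix.SpecialLinearGroup (Fin 2) ℝ := ⟨A₀, hA⟩ with hAdef
  set σ : M → Fin 2 → Ev := fun x => matAct A₀ (ρ x) with hσ
  have hσcl : ∀ i, SmoothClosedEv fun x => σ x i := SmoothClosedEv.matAct A₀ hcl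
  have hσ0 : ∀ x, (σ x 0).1 = 0 := fun x => by
    rw [hσ, matAct_fst, hc, hc, val0_const, val0_const, hA0, const_zero]
  have hσ1 : ∀ x, (σ x 1).1 = const 1 := fun x => by
    rw [hσ, matAct_fst, hc, hc, val0_const, val0_const, hA1]
  -- the `B`-field removing the degree-two part of the second component
  set B : Form M 2 := fun x => (-1 : ℝ) • (σ x 1).2.1 with hBdef
  have hB : SmoothClosed B := (hσcl 1).2.1.const_smul (-1)
  set τ : M → Fin 2 → Ev := fun x => transform A₀ (B x) (ρ x) with hτ
  have hτcl : ∀ i, SmoothClosedEv fun x => τ x i := by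
    intro i
    have : ∃ c, ∀ x, (σ x i).1 = const c := by
      fin_cases i
      · exact ⟨0, hσ0⟩
      · exact ⟨1, hσ1⟩
    obtain ⟨c, hc⟩ := this
    exact SmoothClosedEv.expB hB (hσcl i) hc
  set Ω : Form M 2 := fun x => (σ x 0).2.1 with hΩdef
  have hnf : ∀ (ν : Form M 5), (∀ x, ν x ≠ 0) → ∀ x, τ x =
      normalForm (Ω x) (ν x) (vecOf (ν x) (τ x 0).2.2) (vecOf (ν x) (τ x 1).2.2) :=
    fun ν hν x => funext fun i => expB_eq_normalForm (hν x) (hσ0 x) (hσ1 x) i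
  set q : M → ℝ := fun x => quartic (μ x) (ρ x) with hqdef
  have hqτ : ∀ x, quartic (μ x) (τ x) = q x := fun x => quartic_transform (μ x) hA (B x) (ρ x)
  have hq0 : ∀ x, q x ≠ 0 := fun x => quartic_ne_zero_of_inOpenOrbit (hμ.2 x) (hopen x)
  -- `f(ρ) = -8 Ω(Y₁, Y₂)` for the vector fields formed with `μ`, which shows that it is smooth
  have hqs : SmoothFun q := by
    have h1 := smoothField_vecOf hμ (hτcl 0).2.2.1
    have h2 := smoothField_vecOf hμ (hτcl 1).2.2.1
    have h3 := (((hσcl 0).2.1.1.interior h1).interior h2).const_smul (-8) |>.smoothFun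
    have e : q = fun x => val0 ((-8 : ℝ) • interior (vecOf (μ x) (τ x 1).2.2)
        (interior (vecOf (μ x) (τ x 0).2.2) (Ω x))) := by
      funext x
      rw [← hqτ x]
      conv_lhs => rw [hnf μ hμ.2 x, quartic_normalForm (hμ.2 x)]
      rfl
    rw [e]
    exact h3
  obtain ⟨ε, hε, hεq⟩ := exists_sign hqs.continuous hq0
  have hgpos : ∀ x, 0 < Real.sqrt |q x| := fun x => Real.sqrt_pos.2 (abs_pos.2 (hq0 x))
  set φ : Form M 5 := fun x => Real.sqrt |q x| • μ x with hφdef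
  have hφ : IsVolumeForm φ :=
    ⟨SmoothForm.smul (hqs.sqrt_abs hq0) hμ.1, fun x => smul_ne_zero (hgpos x).ne' (hμ.2 x)⟩
  have hpos : ∀ x, 0 < coeff (μ x) (φ x) := fun x => by
    rw [hφdef, coeff_smul, coeff_self (hμ.2 x), mul_one]; exact hgpos x
  -- the vector fields are formed with the invariant volume, for which `f(ρ) = ε`
  set Y₁ : (x : M) → TangentSpace (𝓡 5) x := fun x => vecOf (φ x) (τ x 0).2.2 with hY₁
  set Y₂ : (x : M) → TangentSpace (𝓡 5) x := fun x => vecOf (φ x) (τ x 1).2.2 with hY₂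
  have hn : ∀ x, τ x = normalForm (Ω x) (φ x) (Y₁ x) (Y₂ x) := hnf φ hφ.2
  have hpair : ∀ x, Ω x ![Y₁ x, Y₂ x] = -ε / 8 := by
    intro x
    have h1 := quartic_normalForm (hφ.2 x) (Ω x) (Y₁ x) (Y₂ x)
    rw [← hn x, hφdef, quartic_smul, hqτ x, inv_pow, Real.sq_sqrt (abs_nonneg _)] at h1
    have h2 : |q x|⁻¹ * q x = ε := by
      rw [inv_mul_eq_iff_eq_mul₀ (abs_ne_zero.2 (hq0 x))]
      have := hεq x
      rcases hε with rfl | rfl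
      · rw [abs_of_pos (by linarith)]; ring
      · rw [abs_of_neg (by linarith)]; ring
    rw [h2] at h1
    linarith
  have hhatn : ∀ x, (fun j => (A⁻¹).1 0 j • expOd ((-1 : ℝ) • B x) (ρ' x 0) +
      (A⁻¹).1 1 j • expOd ((-1 : ℝ) • B x) (ρ' x 1)) =
      normalFormHat ε (Ω x) (φ x) (Y₁ x) (Y₂ x) := by
    intro x
    refine IsHat.unique (hμ.2 x) (ρ := τ x) (IsHat.of_transform (det_inv A) ?_) ?_
    · have := transform_inv A (B x) (ρ x)
      rw [show transform A (B x) (ρ x) = τ x from rfl] at this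
      rw [this]
      exact hhat x
    · rw [hn x]
      exact (isHat_smul (hgpos x) (μ x) _ _).1 (isHat_normalForm (hφ.2 x) hε (hpair x))
  refine ⟨ε, hε, hεq, A, B, Ω, φ, Y₁, Y₂, hB, ?_, fun x i => congrFun (hn x) i, fun x => rfl⟩
  refine isReducedData_of_closed hε hφ hpos (smoothField_vecOf hφ (hτcl 0).2.2.1)
    (smoothField_vecOf hφ (hτcl 1).2.2.1) hpair (fun i => ?_) fun i => ?_
  · simpa only [hn] using hτcl i
  · have h1 := SmoothClosedOd.transform (A⁻¹).1 (hB.const_smul (-1)) hcl' i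
    have e : (fun x => normalFormHat ε (Ω x) (φ x) (Y₁ x) (Y₂ x) i) = fun x =>
        (A⁻¹).1 0 i • expOd ((-1 : ℝ) • B x) (ρ' x 0) +
          (A⁻¹).1 1 i • expOd ((-1 : ℝ) • B x) (ρ' x 1) :=
      funext fun x => (congrFun (hhatn x) i).symm
    rw [e]
    exact h1

/-- Every `ρ` whose transform by `A ∈ SL(2, ℝ)` and a closed `B`-field is a normal form given by
reduced data is a solution. -/
theorem IsReducedData.isSolution {μ : Form M 5} (hμ : IsVolumeForm μ) {ε : ℝ}
    {A : Matrix.SpecialLinearGroup (Fin 2) ℝ} {B Ω : Form M 2} {φ : Form M 5}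
    {Y₁ Y₂ : (x : M) → TangentSpace (𝓡 5) x} {ρ : M → Fin 2 → Ev} (hε : ε = 1 ∨ ε = -1)
    (hB : SmoothClosed B) (h : IsReducedData μ ε Ω φ Y₁ Y₂)
    (hρ : TransformsTo A B ρ Ω φ Y₁ Y₂) :
    IsSolution μ ρ ∧ (∀ x, ∃ i, (ρ x i).1 ≠ 0) ∧ (∀ x, 0 < ε * quartic (μ x) (ρ x)) ∧
      ∀ x, vol (μ x) (ρ x) = φ x := by
  have hεε : ε * ε = 1 := by rcases hε with rfl | rfl <;> norm_num
  set n : M → Fin 2 → Ev := fun x => normalForm (Ω x) (φ x) (Y₁ x) (Y₂ x) with hn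
  have hρn : ∀ x, transform A (B x) (ρ x) = n x := fun x => funext fun i => hρ x i
  have hρ' : ∀ x, ρ x = transform (A⁻¹ : Matrix.SpecialLinearGroup (Fin 2) ℝ)
      ((-1 : ℝ) • B x) (n x) := fun x => by rw [← hρn x, transform_inv]
  set c : M → ℝ := fun x => coeff (μ x) (φ x) with hcdef
  have hφ : ∀ x, φ x = c x • μ x := fun x => (coeff_smul_self (hμ.2 x) (φ x)).symm
  have hqφ : ∀ x, quartic (φ x) (ρ x) = ε := fun x => by
    rw [← quartic_transform (φ x) A.2 (B x), hρn x]
    refine (quartic_normalForm (h.volume.2 x) (Ω x) (Y₁ x) (Y₂ x)).trans ?_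
    rw [h.pairing x]
    ring
  have hq : ∀ x, quartic (μ x) (ρ x) = c x ^ 2 * ε := fun x => by
    have hc := (h.positive x).ne'
    rw [← hqφ x, hφ x, quartic_smul, ← mul_assoc, ← mul_pow, mul_inv_cancel₀ hc, one_pow, one_mul]
  have hsign : ∀ x, 0 < ε * quartic (μ x) (ρ x) := fun x => by
    have hc := h.positive x
    rw [hq x, show ε * (c x ^ 2 * ε) = c x ^ 2 * (ε * ε) by ring, hεε, mul_one]
    exact pow_pos hc 2
  have hfst : ∀ x, ∃ i, (ρ x i).1 ≠ 0 := by
    intro x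
    by_contra hc
    push Not at hc
    have h1 : (transform A (B x) (ρ x) 1).1 = const 0 := by
      refine (matAct_fst A.1 (ρ x) 1).trans ?_
      rw [hc, hc]
      congr 1
      change A.1 1 0 * 0 + A.1 1 1 * 0 = 0
      ring
    rw [hρn x] at h1
    exact one_ne_zero (congrArg val0 h1)
  have hvol : ∀ x, vol (μ x) (ρ x) = φ x := fun x => by
    rw [← vol_smul (h.positive x), ← hφ x, vol, hqφ x]
    rcases hε with rfl | rfl <;> simp
  refine ⟨⟨fun x => inOpenOrbit_of_sign (hμ.2 x) hε (hfst x) (hsign x), fun i => ?_,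
    fun x j => A.1 0 j • expOd (B x) (normalFormHat ε (Ω x) (φ x) (Y₁ x) (Y₂ x) 0) +
      A.1 1 j • expOd (B x) (normalFormHat ε (Ω x) (φ x) (Y₁ x) (Y₂ x) 1), fun x => ?_,
    SmoothClosedOd.transform A.1 hB h.closed_normalFormHat⟩, hfst, hsign, hvol⟩
  · have h1 := SmoothClosedEv.matAct (A⁻¹).1 h.closed_normalForm i
    have h2 := SmoothClosedEv.expB (hB.const_smul (-1)) h1 (c := (A⁻¹).1 i 1) fun x => by
      rw [matAct_fst]
      congr 1
      change (A⁻¹).1 i 0 * 0 + (A⁻¹).1 i 1 * 1 = _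
      ring
    have e : (fun x => ρ x i) = fun x => expB ((-1 : ℝ) • B x) (matAct (A⁻¹).1 (n x) i) :=
      funext fun x => congrFun (hρ' x) i
    rw [e]
    exact h2
  · refine IsHat.of_transform A.2 ?_
    rw [hρn x]
    refine (isHat_smul (h.positive x) (μ x) _ _).1 ?_
    rw [← hφ x]
    exact isHat_normalForm (h.volume.2 x) hε (h.pairing x)

end Solutions

end GenGeom

end

theorem mainTheorem2 {M : Type*} [TopologicalSpace M] [ChartedSpace GenGeom.E5 M]
    [IsManifold (𝓡 5) ∞ M] [ConnectedSpace M]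
    (μ : GenGeom.Form M 5) (hμ : GenGeom.IsVolumeForm μ) :
    (∀ ρ : M → Fin 2 → GenGeom.Ev, GenGeom.IsSolution μ ρ → (∃ x i, (ρ x i).1 ≠ 0) →
      ∃ ε : ℝ, (ε = 1 ∨ ε = -1) ∧ (∀ x, 0 < ε * GenGeom.quartic (μ x) (ρ x)) ∧
        ∃ (A : Matrix.SpecialLinearGroup (Fin 2) ℝ) (B Ω : GenGeom.Form M 2)
          (φ : GenGeom.Form M 5) (Y₁ Y₂ : (x : M) → TangentSpace (𝓡 5) x),
          GenGeom.SmoothClosed B ∧ GenGeom.IsReducedData μ ε Ω φ Y₁ Y₂ ∧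
          GenGeom.TransformsTo A B ρ Ω φ Y₁ Y₂ ∧
          ∀ x, GenGeom.vol (μ x) (ρ x) = φ x) ∧
    (∀ (ε : ℝ) (A : Matrix.SpecialLinearGroup (Fin 2) ℝ) (B Ω : GenGeom.Form M 2)
      (φ : GenGeom.Form M 5) (Y₁ Y₂ : (x : M) → TangentSpace (𝓡 5) x)
      (ρ : M → Fin 2 → GenGeom.Ev), (ε = 1 ∨ ε = -1) →
      GenGeom.SmoothClosed B → GenGeom.IsReducedData μ ε Ω φ Y₁ Y₂ →
      GenGeom.TransformsTo A B ρ Ω φ Y₁ Y₂ →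
      GenGeom.IsSolution μ ρ ∧ (∀ x, ∃ i, (ρ x i).1 ≠ 0) ∧
        (∀ x, 0 < ε * GenGeom.quartic (μ x) (ρ x)) ∧
        ∀ x, GenGeom.vol (μ x) (ρ x) = φ x) := by
  exact ⟨fun ρ hρ hne => GenGeom.exists_reducedData hμ hρ hne,
    fun ε A B Ω φ Y₁ Y₂ ρ hε hB h hρ => h.isSolution hμ hε hB hρ⟩
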